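/- Let $\mathbb{P}^3=\mathrm{Proj}\,\mathbb{C}[z_0,z_1,z_2,z_3]$ and let $\wp_\infty=\{z_0=0\}\cong\mathbb{P}^2$ be the plane at infinity. For a sheaf of $\mathcal{O}_{\mathbb{P}^3}$-modules $\mathcal{F}$ and $a\in\mathbb{Z}$ write $\mathcal{F}(a)=\mathcal{F}\otimes\mathcal{O}_{\mathbb{P}^3}(a)$, and let $\Omega^p=\Omega^p_{\mathbb{P}^3/\mathbb{C}}$ be the sheaf of differential forms of degree $p$. Let $N\ge 0$ and $k$ be integers, and let $\mathcal{E}$ be a torsion free coherent sheaf on $\mathbb{P}^3$ representing a point of $\mathfrak{M}_{N,k}(\mathbb{P}^3)$, that is, $$\mathrm{rank}(\mathcal{E})=N,\qquad c_1(\mathcal{E})=0,\qquad \mathrm{ch}_2(\mathcal{E})=0,\qquad \mathrm{ch}_3(\mathcal{E})=-k,\qquad \mathcal{E}|_{\wp_\infty}\cong\mathcal{O}_{\wp_\infty}^{\oplus N}.$$ Suppose that $H^2(\mathbb{P}^3,\mathcal{E}(-2))=0$. Then $$H^2\big(\mathbb{P}^3,\mathcal{E}(-1)\big)=H^2\big(\mathbb{P}^3,\mathcal{E}(-1)\otimes\Omega^1(1)\big)=H^2\big(\mathbb{P}^3,\mathcal{E}(-1)\otimes\Omega^2(2)\big)=0.$$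 Moreover $H^2\big(\mathbb{P}^3,\mathcal{E}(-1)\otimes\Omega^p(p)\big)=0$ for all $0\le p\le 3$, so the row $q=2$ of the Beilinson spectral sequence $E_1^{-p,q}=H^q\big(\mathbb{P}^3,\mathcal{E}(-1)\otimes\Omega^p(p)\big)\otimes\mathcal{O}_{\mathbb{P}^3}(-p)$ of $\mathcal{E}(-1)$ vanishes. -/

import Mathlib

open AlgebraicGeometry CategoryTheory TopologicalSpace Opposite

noncomputable section

namespace ProjSheaf

/-! ### Exterior powers of presheaves of modules -/

section ExteriorPower

universe u v w

variable {C : Type u} [Category.{v} C] {R : Cᵒᵖ ⥤ CommRingCat.{w}}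

lemma map_update (M : PresheafOfModules.{w} (R ⋙ forget₂ CommRingCat RingCat))
    {X Y : Cᵒᵖ} (f : X ⟶ Y) {p : ℕ} [DecidableEq (Fin p)] (m : Fin p → M.obj X) (i : Fin p)
    (z : M.obj X) :
    (fun j => (M.map f (Function.update m i z j) : M.obj Y)) =
      Function.update (fun j => (M.map f (m j) : M.obj Y)) i (M.map f z) := by
  ext j
  rcases eq_or_ne j i with rfl | hj
  · simp
  · simp [hj]

/-- The restriction map `⋀ᵖ M(U) ⟶ ⋀ᵖ M(V)`, sending `m₁ ∧ ⋯ ∧ mₚ` to `m₁|V ∧ ⋯ ∧ mₚ|V`. -/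
def exteriorPowerMap (M : PresheafOfModules.{w} (R ⋙ forget₂ CommRingCat RingCat)) (p : ℕ)
    {X Y : Cᵒᵖ} (f : X ⟶ Y) :
    ModuleCat.exteriorPower (R := R.obj X) (M.obj X) p ⟶
      (ModuleCat.restrictScalars (R.map f).hom).obj
        (ModuleCat.exteriorPower (R := R.obj Y) (M.obj Y) p) :=
  let ι : (M.obj Y) [⋀^Fin p]→ₗ[R.obj Y] ⋀[R.obj Y]^p (M.obj Y) := exteriorPower.ιMulti (R.obj Y) p
  ModuleCat.exteriorPower.desc (R := R.obj X) (M := M.obj X) (n := p)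
    (N := (ModuleCat.restrictScalars (R.map f).hom).obj
        (ModuleCat.exteriorPower (R := R.obj Y) (M.obj Y) p))
    { toFun := fun m => ι (fun i => M.map f (m i))
      map_update_add' := by
        intro _ m i x y
        refine (congrArg ι (map_update M f m i _)).trans ?_
        refine (congrArg (fun z => ι (Function.update _ i z))
          ((M.map f).hom.map_add x y)).trans ?_
        refine (ι.map_update_add _ i _ _).trans ?_
        exact (congrArg₂ (fun a b : ⋀[R.obj Y]^p (M.obj Y) => a + b)
          (congrArg ι (map_update M f m i x)) (congrArg ι (map_update M f m i y))).symm
      map_update_smul' := by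
        intro _ m i r x
        refine (congrArg ι (map_update M f m i _)).trans ?_
        refine (congrArg (fun z => ι (Function.update _ i z)) (M.map_smul f r x)).trans ?_
        refine (ι.map_update_smul _ i (R.map f r) _).trans ?_
        exact (congrArg (fun a : ⋀[R.obj Y]^p (M.obj Y) => (R.map f r : R.obj Y) • a)
          (congrArg ι (map_update M f m i x))).symm
      map_eq_zero_of_eq' := by
        intro m i j h hij
        exact ι.map_eq_zero_of_eq _ (congrArg (fun z => (M.map f z : M.obj Y)) h) hij }

lemma exteriorPowerMap_mk (M : PresheafOfModules.{w} (R ⋙ forget₂ CommRingCat RingCat)) (p : ℕ)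
    {X Y : Cᵒᵖ} (f : X ⟶ Y) (m : Fin p → M.obj X) :
    exteriorPowerMap M p f (exteriorPower.ιMulti (R.obj X) p (M := M.obj X) m) =
      exteriorPower.ιMulti (R.obj Y) p (M := M.obj Y) (fun i => M.map f (m i)) :=
  ModuleCat.exteriorPower.desc_mk _ _

/-- The presheaf of modules `U ↦ ⋀ᵖ M(U)`. -/
def exteriorPowerPresheaf (M : PresheafOfModules.{w} (R ⋙ forget₂ CommRingCat RingCat)) (p : ℕ) :
    PresheafOfModules.{w} (R ⋙ forget₂ CommRingCat RingCat) where
  obj X := ModuleCat.exteriorPower (R := R.obj X) (M.obj X) p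
  map f := exteriorPowerMap M p f
  map_id X := by
    refine ModuleCat.exteriorPower.hom_ext (R := R.obj X) (M := M.obj X) ?_
    refine ModuleCat.AlternatingMap.ext fun m => ?_
    refine (exteriorPowerMap_mk M p (𝟙 X) m).trans ?_
    simp only [M.map_id]
    rfl
  map_comp {X Y Z} f g := by
    refine ModuleCat.exteriorPower.hom_ext (R := R.obj X) (M := M.obj X) ?_
    refine ModuleCat.AlternatingMap.ext fun m => ?_
    refine (exteriorPowerMap_mk M p (f ≫ g) m).trans ?_
    refine Eq.trans ?_ (congrArg (exteriorPowerMap M p g) (exteriorPowerMap_mk M p f m)).symm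
    refine Eq.trans ?_ (exteriorPowerMap_mk M p g _).symm
    simp only [M.map_comp]
    rfl

end ExteriorPower

/-! ### Sheaves of modules on a scheme -/

section Modules

variable {X : Scheme.{0}}

/-- The sheaf of modules associated with a presheaf of modules. -/
def sheafify (F : PresheafOfModules.{0} (X.presheaf ⋙ forget₂ CommRingCat RingCat)) : X.Modules :=
  (PresheafOfModules.sheafification (𝟙 X.ringCatSheaf.obj)).obj F

/-- The tensor product `F ⊗ G` over the structure sheaf. -/
def tensor (F G : X.Modules) : X.Modules :=
  sheafify (PresheafOfModules.Monoidal.tensorObj (R := X.presheaf) F.val G.val)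

/-- The sheaf cohomology group `H^q(X, F)`. -/
def H (q : ℕ) (F : X.Modules) : Type :=
  ((SheafOfModules.toSheaf X.ringCatSheaf).obj F).H q

/-- `F` is coherent (for a Noetherian scheme `X`): locally of finite presentation. -/
def IsCoherent (F : X.Modules) : Prop :=
  SheafOfModules.IsFinitePresentation (R := X.ringCatSheaf) F

/-- `F` is torsion free (for an integral scheme `X`): no nonzero section of `F` over an open set
is killed by a non-zero-divisor of the structure sheaf. -/
def IsTorsionFree (F : X.Modules) : Prop :=
  ∀ U : X.Opens, Module.IsTorsionFree Γ(X, U) Γ(F, U)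

/-- The rank of the stalk `F_x` over the local ring `𝒪_{X,x}`. At the generic point of an integral
scheme this is the rank of `F`. -/
def stalkRank (F : X.Modules) (x : X) : ℕ :=
  let M : PresheafOfModules.{0} (X.presheaf ⋙ forget₂ CommRingCat RingCat) := F.val
  Module.finrank (X.presheaf.stalk x) (TopCat.Presheaf.stalk (C := Ab) M.presheaf x)

/-- The free sheaf `𝒪^{⊕ N}`. -/
def freeSheaf (X : Scheme.{0}) (N : ℕ) : X.Modules :=
  SheafOfModules.free (R := X.ringCatSheaf) (Fin N)

/-- For a scheme over `k`, the morphism from the constant presheaf `k` to the structure sheaf. -/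
def constants {k : CommRingCat.{0}} (f : X ⟶ Spec k) :
    (Functor.const (Opens X)ᵒᵖ).obj k ⟶ X.presheaf where
  app U := (Scheme.ΓSpecIso k).inv ≫ f.appTop ≫ X.presheaf.map (homOfLE le_top).op
  naturality U V i := by
    simp [← Functor.map_comp]
    rfl

/-- The sheaf `Ω^p_{X/k}` of relative differential forms of degree `p`: the sheaf associated with
`U ↦ ⋀ᵖ Ω_{Γ(X, U)/k}`. -/
def Omega {k : CommRingCat.{0}} (f : X ⟶ Spec k) (p : ℕ) : X.Modules :=
  sheafify (exteriorPowerPresheaf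
    (PresheafOfModules.DifferentialsConstruction.relativeDifferentials' (constants f)) p)

end Modules

/-! ### Serre's twisting sheaves -/

section Twist

variable {A σ : Type} [CommRing A] [SetLike σ A] [AddSubgroupClass σ A] (𝒜 : ℕ → σ) [GradedRing 𝒜]

/-- The localization `A_𝔭` at a point `𝔭` of `Proj A`. -/
abbrev Loc (x : ProjectiveSpectrum 𝒜) : Type :=
  Localization.AtPrime x.asHomogeneousIdeal.toIdeal

/-- `f` is given on the open set `U` by one fraction `r / s` with `r`, `s` homogeneous,
`deg r = deg s + n` and `s` vanishing nowhere on `U`. -/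
def IsTwistedFraction (n : ℤ) {U : Opens (ProjectiveSpectrum.top 𝒜)}
    (f : ∀ x : U, Loc 𝒜 x.1) : Prop :=
  ∃ (i j : ℕ) (_ : (i : ℤ) = j + n) (r : 𝒜 i) (s : 𝒜 j)
    (hs : ∀ x : U, s.1 ∉ x.1.asHomogeneousIdeal),
    ∀ x : U, f x = Localization.mk r.1 ⟨s.1, hs x⟩

/-- The local condition defining the sections of `𝒪(n)`: being locally a fraction of degree `n`. -/
def isLocallyTwistedFraction (n : ℤ) : TopCat.LocalPredicate (X := ProjectiveSpectrum.top 𝒜) (Loc 𝒜) :=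
  TopCat.PrelocalPredicate.sheafify
    { pred := fun f => IsTwistedFraction 𝒜 n f
      res := by
        rintro V U i f ⟨a, b, hab, r, s, hs, h⟩
        exact ⟨a, b, hab, r, s, fun x => hs (i x), fun x => h (i x)⟩ }

variable {𝒜} in
lemma isLocallyTwistedFraction_iff {n : ℤ} {U : Opens (ProjectiveSpectrum.top 𝒜)}
    {f : ∀ x : U, Loc 𝒜 x.1} :
    (isLocallyTwistedFraction 𝒜 n).pred f ↔
      ∀ x : U, ∃ V : Opens (ProjectiveSpectrum.top 𝒜), x.1 ∈ V ∧ ∃ i : V ⟶ U,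
        IsTwistedFraction 𝒜 n (fun y : V => f (i y)) :=
  ⟨fun h x => let ⟨V, m, i, hV⟩ := h x; ⟨V, m, i, hV⟩,
    fun h x => let ⟨V, m, i, hV⟩ := h x; ⟨V, m, i, hV⟩⟩

variable {𝒜} in
lemma mul_notMem (x : ProjectiveSpectrum 𝒜) {s t : A} (hs : s ∉ x.asHomogeneousIdeal)
    (ht : t ∉ x.asHomogeneousIdeal) : s * t ∉ x.asHomogeneousIdeal :=
  fun h => (x.isPrime.mem_or_mem h).elim hs ht

variable {𝒜} in
lemma exists_homogeneous_notMem (x : ProjectiveSpectrum 𝒜) :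
    ∃ i : ℕ, 0 < i ∧ ∃ t ∈ 𝒜 i, t ∉ x.asHomogeneousIdeal := by
  by_contra! h
  exact x.not_irrelevant_le ((HomogeneousIdeal.irrelevant_le 𝒜).2 fun i hi t ht => h i hi t ht)

/-- The group of sections of `𝒪(n)` over `U`. -/
def twistSections (n : ℤ) (U : Opens (ProjectiveSpectrum.top 𝒜)) :
    AddSubgroup (∀ x : U, Loc 𝒜 x.1) where
  carrier := {f | (isLocallyTwistedFraction 𝒜 n).pred f}
  zero_mem' := isLocallyTwistedFraction_iff.2 fun x => by
    obtain ⟨i, hi, t, ht, htx⟩ := exists_homogeneous_notMem x.1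
    have hn : -n ≤ (n.natAbs : ℤ) * i := by
      have : (n.natAbs : ℤ) * 1 ≤ (n.natAbs : ℤ) * i := by gcongr; omega
      omega
    refine ⟨U ⊓ ProjectiveSpectrum.basicOpen 𝒜 t, ⟨x.2, htx⟩, Opens.infLELeft _ _,
      ((n.natAbs : ℤ) * i + n).toNat, n.natAbs * i, by rw [Int.toNat_of_nonneg (by omega)]; push_cast; rfl, ⟨0, zero_mem _⟩,
      ⟨t ^ n.natAbs, SetLike.pow_mem_graded n.natAbs ht⟩, fun y h => y.2.2 ?_, fun y => ?_⟩
    · exact y.1.isPrime.mem_of_pow_mem _ h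
    · exact (Localization.mk_zero _).symm
  add_mem' {f g} hf hg := isLocallyTwistedFraction_iff.2 fun x => by
    obtain ⟨V, hV, i, a, b, hab, r, s, hs, h⟩ := isLocallyTwistedFraction_iff.1 hf x
    obtain ⟨V', hV', i', a', b', hab', r', s', hs', h'⟩ := isLocallyTwistedFraction_iff.1 hg x
    refine ⟨V ⊓ V', ⟨hV, hV'⟩, Opens.infLELeft _ _ ≫ i, a + b', b + b', by push_cast; omega,
      ⟨s.1 * r'.1 + s'.1 * r.1, add_mem ?_ ?_⟩, ⟨s.1 * s'.1, SetLike.mul_mem_graded s.2 s'.2⟩,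
      fun y => mul_notMem y.1 (hs ⟨y.1, y.2.1⟩) (hs' ⟨y.1, y.2.2⟩), fun y => ?_⟩
    · exact (by omega : b + a' = a + b') ▸ SetLike.mul_mem_graded s.2 r'.2
    · exact add_comm b' a ▸ SetLike.mul_mem_graded s'.2 r.2
    · refine (congrArg₂ (· + ·) (h ⟨y.1, y.2.1⟩) (h' ⟨y.1, y.2.2⟩)).trans ?_
      exact Localization.add_mk _ _ _ _
  neg_mem' {f} hf := isLocallyTwistedFraction_iff.2 fun x => by
    obtain ⟨V, hV, i, a, b, hab, r, s, hs, h⟩ := isLocallyTwistedFraction_iff.1 hf x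
    exact ⟨V, hV, i, a, b, hab, ⟨-r.1, neg_mem r.2⟩, s, hs,
      fun y => (congrArg Neg.neg (h y)).trans (Localization.neg_mk _ _)⟩

lemma smul_mem_twistSections (n : ℤ) (U : Opens (ProjectiveSpectrum.top 𝒜))
    (a : (ProjectiveSpectrum.Proj.structureSheaf 𝒜).1.obj (op U))
    (f : twistSections 𝒜 n U) :
    (fun x : U => (a.1 x).val * f.1 x) ∈ twistSections 𝒜 n U :=
  (isLocallyTwistedFraction_iff (n := n) (f := fun x : U => (a.1 x).val * f.1 x)).2 fun x => by
    obtain ⟨V, hV, i, c, d, hcd, r, s, hs, h⟩ := isLocallyTwistedFraction_iff.1 f.2 x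
    obtain ⟨V', hV', i', e, r', s', hs', h'⟩ := a.2 x
    refine ⟨V ⊓ V', ⟨hV, hV'⟩, Opens.infLELeft _ _ ≫ i, e + c, e + d, by push_cast; omega,
      ⟨r'.1 * r.1, SetLike.mul_mem_graded r'.2 r.2⟩, ⟨s'.1 * s.1, SetLike.mul_mem_graded s'.2 s.2⟩,
      fun y => mul_notMem y.1 (hs' ⟨y.1, y.2.2⟩) (hs ⟨y.1, y.2.1⟩), fun y => ?_⟩
    refine (congrArg₂ (· * ·) ((congrArg HomogeneousLocalization.val (h' ⟨y.1, y.2.2⟩)).trans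
      (HomogeneousLocalization.val_mk _)) (h ⟨y.1, y.2.1⟩)).trans ?_
    exact Localization.mk_mul _ _ _ _

instance (n : ℤ) (U : (Proj 𝒜).Opens) : Module Γ(Proj 𝒜, U) (twistSections 𝒜 n U) where
  smul a f := ⟨_, smul_mem_twistSections 𝒜 n U a f⟩
  one_smul _ := Subtype.ext <| funext fun _ =>
    (congrArg (· * _) HomogeneousLocalization.val_one).trans (one_mul _)
  mul_smul _ _ _ := Subtype.ext <| funext fun _ =>
    (congrArg (· * _) (HomogeneousLocalization.val_mul _ _)).trans (mul_assoc _ _ _)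
  smul_zero _ := Subtype.ext <| funext fun _ => mul_zero _
  smul_add _ _ _ := Subtype.ext <| funext fun _ => mul_add _ _ _
  add_smul _ _ _ := Subtype.ext <| funext fun _ =>
    (congrArg (· * _) (HomogeneousLocalization.val_add _ _)).trans (add_mul _ _ _)
  zero_smul _ := Subtype.ext <| funext fun _ =>
    (congrArg (· * _) HomogeneousLocalization.val_zero).trans (zero_mul _)

/-- The presheaf of abelian groups `U ↦ Γ(U, 𝒪(n))`. -/
def twistPresheaf (n : ℤ) : TopCat.Presheaf Ab.{0} (ProjectiveSpectrum.top 𝒜) where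
  obj U := AddCommGrpCat.of (twistSections 𝒜 n U.unop)
  map {U V} i := AddCommGrpCat.ofHom
    { toFun := fun f => ⟨fun x => f.1 (i.unop x),
        (isLocallyTwistedFraction 𝒜 n).res i.unop f.1 f.2⟩
      map_zero' := rfl
      map_add' := fun _ _ => rfl }

lemma twistPresheaf_isSheaf (n : ℤ) : (twistPresheaf 𝒜 n).IsSheaf :=
  (TopCat.Presheaf.isSheaf_iff_isSheaf_comp (forget Ab) (twistPresheaf 𝒜 n)).mpr
    (TopCat.Presheaf.isSheaf_of_iso (NatIso.ofComponents (fun _ => Iso.refl _) (by cat_disch))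
      (TopCat.subsheafToTypes (isLocallyTwistedFraction 𝒜 n)).property)

instance (n : ℤ) (U : (Opens (Proj 𝒜))ᵒᵖ) :
    Module ((Proj 𝒜).ringCatSheaf.obj.obj U) ((twistPresheaf 𝒜 n).obj U) :=
  inferInstanceAs (Module Γ(Proj 𝒜, U.unop) (twistSections 𝒜 n U.unop))

/-- Serre's twisting sheaf `𝒪(n)` on `Proj A`. -/
def twist (n : ℤ) : (Proj 𝒜).Modules where
  val := PresheafOfModules.ofPresheaf (R := (Proj 𝒜).ringCatSheaf.obj) (twistPresheaf 𝒜 n)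
    (fun _ _ _ _ _ => rfl)
  isSheaf := twistPresheaf_isSheaf 𝒜 n

end Twist

/-! ### Complex projective space and its sheaves -/

section ProjectiveSpace

/-- The grading of `ℂ[z₀, …, zₙ₋₁]` by degree. -/
abbrev grading (n : ℕ) : ℕ → Submodule ℂ (MvPolynomial (Fin n) ℂ) :=
  MvPolynomial.homogeneousSubmodule (Fin n) ℂ

instance (n : ℕ) : GradedAlgebra (grading n) := MvPolynomial.gradedAlgebra

/-- The complex projective space `ℙⁿ = Proj ℂ[z₀, …, zₙ]`. -/
abbrev PSpace (n : ℕ) : Scheme.{0} := Proj (grading (n + 1))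

/-- The structure morphism `ℙⁿ ⟶ Spec ℂ`. -/
def structureMap (n : ℕ) : PSpace n ⟶ Spec (CommRingCat.of ℂ) :=
  Proj.toSpecZero (grading (n + 1)) ≫
    Spec.map (CommRingCat.ofHom (algebraMap ℂ (grading (n + 1) 0)))

/-- The line bundle `𝒪(a)` on `ℙⁿ`. -/
def OO (n : ℕ) (a : ℤ) : (PSpace n).Modules := twist (grading (n + 1)) a

/-- The twist `F(a) = F ⊗ 𝒪(a)` of a sheaf of modules on `ℙⁿ`. -/
def twistBy {n : ℕ} (F : (PSpace n).Modules) (a : ℤ) : (PSpace n).Modules := tensor F (OO n a)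

/-- The sheaf `Ω^p` of differential forms on `ℙⁿ` over `ℂ`. -/
def OmegaP (n p : ℕ) : (PSpace n).Modules := Omega (structureMap n) p

/-- The generic point of `ℙⁿ`, that is, the zero ideal. -/
def genericPt (n : ℕ) : PSpace n :=
  (show ProjectiveSpectrum (grading (n + 1)) from
    { asHomogeneousIdeal := ⊥
      isPrime := by
        rw [HomogeneousIdeal.toIdeal_bot]
        exact Ideal.isPrime_bot
      not_irrelevant_le := fun h => by
        have h0 := h (HomogeneousIdeal.mem_irrelevant_of_mem (grading (n + 1)) one_pos
          (MvPolynomial.isHomogeneous_X ℂ (0 : Fin (n + 1))))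
        exact MvPolynomial.X_ne_zero (R := ℂ) (0 : Fin (n + 1)) h0 })

/-- The rank of a coherent sheaf on `ℙⁿ`. -/
def rank {n : ℕ} (F : (PSpace n).Modules) : ℕ := stalkRank F (genericPt n)

/-- The graded homomorphism `ℂ[z₀, …, zₙ₊₁] ⟶ ℂ[z₀, …, zₙ]` with `z₀ ↦ 0` and `zᵢ₊₁ ↦ zᵢ`. -/
def setZero (n : ℕ) : (grading (n + 2)) →+*ᵍ (grading (n + 1)) where
  __ := ((MvPolynomial.aeval (Fin.cons 0 MvPolynomial.X) :
    MvPolynomial (Fin (n + 2)) ℂ →ₐ[ℂ] MvPolynomial (Fin (n + 1)) ℂ) :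
      MvPolynomial (Fin (n + 2)) ℂ →+* MvPolynomial (Fin (n + 1)) ℂ)
  map_mem {i x} hx := by
    have h := MvPolynomial.IsHomogeneous.aeval (n := 1)
      ((MvPolynomial.mem_homogeneousSubmodule i x).1 hx)
      (Fin.cons 0 MvPolynomial.X : Fin (n + 2) → MvPolynomial (Fin (n + 1)) ℂ)
      (fun j => by
        refine Fin.cases ?_ (fun j => ?_) j
        · exact MvPolynomial.isHomogeneous_zero _ _ _
        · exact MvPolynomial.isHomogeneous_X _ _)
    rw [one_mul] at h
    exact h

lemma setZero_rename (n : ℕ) (x : MvPolynomial (Fin (n + 1)) ℂ) :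
    setZero n (MvPolynomial.rename Fin.succ x) = x := by
  change MvPolynomial.aeval (Fin.cons 0 MvPolynomial.X) (MvPolynomial.rename Fin.succ x) = x
  rw [MvPolynomial.aeval_rename]
  exact MvPolynomial.aeval_X_left_apply x

lemma irrelevant_le_map_setZero (n : ℕ) :
    HomogeneousIdeal.irrelevant (grading (n + 1)) ≤
      (HomogeneousIdeal.irrelevant (grading (n + 2))).map (setZero n) :=
  (HomogeneousIdeal.irrelevant_le _).2 fun i hi x hx => by
    have h : setZero n (MvPolynomial.rename Fin.succ x) ∈
        (HomogeneousIdeal.irrelevant (grading (n + 2))).map (setZero n) :=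
      Ideal.mem_map_of_mem _ (HomogeneousIdeal.mem_irrelevant_of_mem (grading (n + 2)) hi
        (MvPolynomial.IsHomogeneous.rename_isHomogeneous hx))
    rw [setZero_rename] at h
    exact h

/-- The inclusion `ℙⁿ ⟶ ℙⁿ⁺¹` of the hyperplane at infinity `z₀ = 0`. -/
def hyperplane (n : ℕ) : PSpace n ⟶ PSpace (n + 1) :=
  Proj.map (setZero n) (irrelevant_le_map_setZero n)

/-- The Chern character on `ℙ³`, with values in `H^{2*}(ℙ³, ℚ) = ℚ[h]/(h⁴)`, where `h` is the
class of a hyperplane: `HasChernCharacter F v` says that `ch F = v₀ + v₁ h + v₂ h² + v₃ h³`. It is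
generated by `ch 𝒪(a) = exp (a h)` and by additivity on short exact sequences. These rules determine
`ch` since every coherent sheaf on `ℙ³` has a finite resolution by sums of line bundles `𝒪(a)`. -/
inductive HasChernCharacter : (PSpace 3).Modules → (Fin 4 → ℚ) → Prop
  | lineBundle (a : ℤ) :
      HasChernCharacter (OO 3 a) (fun i => (a : ℚ) ^ (i : ℕ) / (Nat.factorial (i : ℕ) : ℚ))
  | middle (S : ShortComplex (PSpace 3).Modules) (hS : S.ShortExact) (v w : Fin 4 → ℚ) :
      HasChernCharacter S.X₁ v → HasChernCharacter S.X₃ w → HasChernCharacter S.X₂ (v + w)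
  | left (S : ShortComplex (PSpace 3).Modules) (hS : S.ShortExact) (v w : Fin 4 → ℚ) :
      HasChernCharacter S.X₂ v → HasChernCharacter S.X₃ w → HasChernCharacter S.X₁ (v - w)
  | right (S : ShortComplex (PSpace 3).Modules) (hS : S.ShortExact) (v w : Fin 4 → ℚ) :
      HasChernCharacter S.X₂ v → HasChernCharacter S.X₁ w → HasChernCharacter S.X₃ (v - w)

/-- The sheaves whose isomorphism classes are the points of `𝔐_{N,k}(ℙ³)`: torsion free coherent
sheaves `E` on `ℙ³` of rank `N`, with `c₁(E) = 0`, `ch₂(E) = 0`, `ch₃(E) = -k`, whose restriction to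
the plane at infinity `z₀ = 0` is isomorphic to `𝒪^{⊕ N}`. -/
structure IsInModuli (N : ℕ) (k : ℤ) (E : (PSpace 3).Modules) : Prop where
  coherent : IsCoherent E
  torsionFree : IsTorsionFree E
  rank_eq : rank E = N
  /-- The four entries are `ch₀ = N`, `ch₁ = c₁`, `ch₂` and `ch₃`. -/
  chern : HasChernCharacter E ![(N : ℚ), 0, 0, -(k : ℚ)]
  framing : Nonempty ((Scheme.Modules.pullback (hyperplane 2)).obj E ≅ freeSheaf (PSpace 2) N)

end ProjectiveSpace

end ProjSheaf

end

/-! Everything rests on restriction to the plane at infinity. For every integer `b`, multiplication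
by `z_0` gives a short exact sequence 0 → E(b) → E(b+1) → 𝒪(b+1)^N → 0, the last term living on the
plane: torsion freeness makes multiplication injective, and the framing identifies the cokernel
(`locallyExact_zop_rho`). On the plane one needs only H¹(𝒪) = 0 and H²(𝒪(b)) = 0 for b > -3
(`subsingleton_H_one_planeTwist`, `subsingleton_H_two_planeTwist`). Hence H²(E(-2)) = 0 forces
H²(E(-1)) = 0, multiplication by `z_0` maps H¹(E(-1)) onto H¹(E), and it is injective from H³(E(-3))
to H³(E(-2)).

The sheaves Ω^p(p) enter through the Koszul complex. The Euler sequence 0 → E(-1) ⊗ Ω¹(1) → E(-1)⁴ →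
E → 0 gives the vanishing for p = 1: H² of the middle term is zero, and H¹(E(-1))⁴ → H¹(E) is onto
because one of its four components already is. The sequence 0 → E(-3) → E(-2)⁴ → E(-1) ⊗ Ω²(2) → 0
gives p = 2: H² of the middle term is zero, and H³(E(-3)) → H³(E(-2))⁴ is injective because one
component is. Finally E(-1) ⊗ Ω³(3) is E(-2), and p = 0 is the case of E(-1) itself. These arguments
are `subsingleton_H_two_kosOne`, `subsingleton_H_two_kosTwo` and `subsingleton_H_two_kosThree`; they
concern presheaves of families of sections cut out by Koszul relations.

To pass from these families to differential forms, a p-form is sent to its p × p minors with respect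
to the homogeneous partial derivatives ∂/∂z_k, which take values in 𝒪(-p). Euler's identity shows
that the minors satisfy the Koszul relations; where `z_i` is invertible, the products of the
dz_k/z_i-type differentials are a basis of the forms dual to some of the minors, and the relations
determine the other minors. So the comparison is bijective on a basis of open sets (`bijOn_coefMap`)
and becomes an isomorphism of sheaves (`subsingleton_H_two_tensor_forms`).

Exactness is always checked on presheaves up to shrinking the open set, and transported by
`LocallyExact.shortExact`. Cohomology of the plane is computed from vanishing on affine open sets,
an induction with Mayer-Vietoris sequences (`subsingleton_HU_of_ring`), and explicit division of
polynomials by powers of the coordinates. The pull-back to the plane is accessible only through its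
adjunction; its germs are found by mapping into sheaves of arbitrary families of stalk elements
(`mem_pbSub`, `grm_mem_of_pb_eq_zero`). -/

noncomputable section

namespace ProjSheaf

open Limits Abelian

/-! ### Local exactness of presheaves and exactness after sheafification. -/

section SheafTheory

variable {X : TopCat.{0}}

/-- Abelian presheaves on `X`. -/
abbrev AbPresheaf (X : TopCat.{0}) := (Opens X)ᵒᵖ ⥤ Ab.{0}

/-- Abelian sheaves on `X`. -/
abbrev AbSheaf (X : TopCat.{0}) := Sheaf (Opens.grothendieckTopology X) Ab.{0}

/-- The sheafification of an abelian presheaf. -/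
abbrev aSh (P : AbPresheaf X) : AbSheaf X :=
  (presheafToSheaf (Opens.grothendieckTopology X) Ab.{0}).obj P

/-- The sheafification of a morphism of abelian presheaves. -/
abbrev aShMap {P Q : AbPresheaf X} (f : P ⟶ Q) : aSh P ⟶ aSh Q :=
  (presheafToSheaf (Opens.grothendieckTopology X) Ab.{0}).map f

lemma isLocallyInjective_of_local {P Q : AbPresheaf X} (f : P ⟶ Q)
    (h : ∀ (U : Opens X) (s : P.obj (op U)), f.app _ s = 0 → ∀ x ∈ U, ∃ (V : Opens X) (i : V ⟶ U),
      x ∈ V ∧ P.map i.op s = 0) :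
    Presheaf.IsLocallyInjective (Opens.grothendieckTopology X) f where
  equalizerSieve_mem {U} s t hst := by
    intro x hx
    obtain ⟨V, i, hV, e⟩ := h U.unop (s - t) (by
      rw [map_sub]; exact sub_eq_zero.2 hst) x hx
    refine ⟨V, i, ?_, hV⟩
    rw [map_sub] at e
    exact sub_eq_zero.1 e

lemma isLocallySurjective_of_local {P Q : AbPresheaf X} (f : P ⟶ Q)
    (h : ∀ (U : Opens X) (s : Q.obj (op U)), ∀ x ∈ U, ∃ (V : Opens X) (i : V ⟶ U),
      x ∈ V ∧ ∃ t, f.app _ t = Q.map i.op s) :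
    Presheaf.IsLocallySurjective (Opens.grothendieckTopology X) f where
  imageSieve_mem {U} s := by
    intro x hx
    obtain ⟨V, i, hV, t, e⟩ := h U s x hx
    exact ⟨V, i, ⟨t, e⟩, hV⟩

lemma exists_map_eq_zero {P Q : AbPresheaf X} (f : P ⟶ Q)
    [h : Presheaf.IsLocallyInjective (Opens.grothendieckTopology X) f] {U : Opens X}
    (s : P.obj (op U)) (hs : f.app _ s = 0) {x : X} (hx : x ∈ U) :
    ∃ (V : Opens X) (i : V ⟶ U), x ∈ V ∧ P.map i.op s = 0 := by
  obtain ⟨V, i, e, hV⟩ := h.equalizerSieve_mem (X := op U) s 0 (by rw [hs, map_zero]) x hx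
  refine ⟨V, i, hV, ?_⟩
  have := (show P.map i.op s = P.map i.op 0 from e)
  rwa [map_zero] at this

lemma exists_lift {P Q : AbPresheaf X} (f : P ⟶ Q)
    [h : Presheaf.IsLocallySurjective (Opens.grothendieckTopology X) f] {U : Opens X}
    (s : Q.obj (op U)) {x : X} (hx : x ∈ U) :
    ∃ (V : Opens X) (i : V ⟶ U), x ∈ V ∧ ∃ t, f.app _ t = Q.map i.op s := by
  obtain ⟨V, i, ⟨t, e⟩, hV⟩ := h.imageSieve_mem s x hx
  exact ⟨V, i, hV, t, e⟩

/-- Two morphisms of presheaves which are exact up to restriction to smaller open sets. -/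
structure LocallyExact {P Q R : AbPresheaf X} (f : P ⟶ Q) (g : Q ⟶ R) : Prop where
  zero : f ≫ g = 0
  inj : ∀ (U : Opens X) (s : P.obj (op U)), f.app _ s = 0 → ∀ x ∈ U,
    ∃ (V : Opens X) (i : V ⟶ U), x ∈ V ∧ P.map i.op s = 0
  exact : ∀ (U : Opens X) (s : Q.obj (op U)), g.app _ s = 0 → ∀ x ∈ U,
    ∃ (V : Opens X) (i : V ⟶ U), x ∈ V ∧ ∃ t, f.app _ t = Q.map i.op s
  surj : ∀ (U : Opens X) (s : R.obj (op U)), ∀ x ∈ U, ∃ (V : Opens X) (i : V ⟶ U),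
    x ∈ V ∧ ∃ t, g.app _ t = R.map i.op s

/-- The complex of sheaves associated with a complex of presheaves. -/
abbrev aShComplex {P Q R : AbPresheaf X} (f : P ⟶ Q) (g : Q ⟶ R) (w : f ≫ g = 0) :
    ShortComplex (AbSheaf X) :=
  (ShortComplex.mk f g w).map (presheafToSheaf (Opens.grothendieckTopology X) Ab.{0})

lemma epi_aShMap {P Q : AbPresheaf X} (f : P ⟶ Q)
    [Presheaf.IsLocallySurjective (Opens.grothendieckTopology X) f] : Epi (aShMap f) := by
  have := (Presheaf.isLocallySurjective_presheafToSheaf_map_iff (Opens.grothendieckTopology X)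
    f).2 inferInstance
  infer_instance

lemma mono_aShMap {P Q : AbPresheaf X} (f : P ⟶ Q)
    [Presheaf.IsLocallyInjective (Opens.grothendieckTopology X) f] : Mono (aShMap f) := by
  have := (Presheaf.isLocallyInjective_presheafToSheaf_map_iff (Opens.grothendieckTopology X)
    f).2 inferInstance
  exact Sheaf.mono_of_isLocallyInjective _

lemma isIso_aShMap {P Q : AbPresheaf X} (f : P ⟶ Q)
    [Presheaf.IsLocallyInjective (Opens.grothendieckTopology X) f]
    [Presheaf.IsLocallySurjective (Opens.grothendieckTopology X) f] : IsIso (aShMap f) := by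
  have := epi_aShMap f
  have := mono_aShMap f
  exact isIso_of_mono_of_epi _

/-- Sheafification preserves the presheaf kernel of `g`, and local exactness says precisely that the
map from `P` to this kernel is locally surjective, hence an epimorphism of sheaves. Exactness of the
kernel sequence then passes to the given one. -/
lemma LocallyExact.shortExact {P Q R : AbPresheaf X} {f : P ⟶ Q} {g : Q ⟶ R}
    (h : LocallyExact f g) : (aShComplex f g h.zero).ShortExact := by
  have := isLocallyInjective_of_local f h.inj
  have := isLocallySurjective_of_local g h.surj
  have hm : Mono (aShMap f) := mono_aShMap f
  have he : Epi (aShMap g) := epi_aShMap g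
  let k := kernel.lift g f h.zero
  have hk : Presheaf.IsLocallySurjective (Opens.grothendieckTopology X) k := by
    refine isLocallySurjective_of_local k fun U s x hx => ?_
    obtain ⟨V, i, hV, t, e⟩ := h.exact U ((kernel.ι g).app _ s) (by
      have := congr_app (kernel.condition g) (op U)
      exact congr($this s)) x hx
    refine ⟨V, i, hV, t, ?_⟩
    have hinj : Function.Injective ((kernel.ι g).app (op V)) :=
      (AddCommGrpCat.mono_iff_injective _).1 inferInstance
    apply hinj
    have h1 : k ≫ kernel.ι g = f := kernel.lift_ι _ _ _
    have h2 := congr_app h1 (op V)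
    have h3 : (kernel.ι g).app (op V) (k.app _ t) = f.app _ t := congr($h2 t)
    have h4 := (kernel.ι g).naturality i.op
    exact h3.trans (e.trans congr($h4 s).symm)
  have hk' : Epi (aShMap k) := epi_aShMap k
  refine { exact := ?_, mono_f := hm, epi_g := he }
  let S : ShortComplex (AbPresheaf X) := ShortComplex.mk (kernel.ι g) g (kernel.condition g)
  have hS : S.Exact := S.exact_of_f_is_kernel (kernelIsKernel g)
  have hS' := hS.map_of_mono_of_preservesKernel
    (presheafToSheaf (Opens.grothendieckTopology X) Ab.{0}) (inferInstanceAs (Mono (kernel.ι g)))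
    inferInstance
  let φ : ShortComplex.mk f g h.zero ⟶ S := { τ₁ := k, τ₂ := 𝟙 _, τ₃ := 𝟙 _ }
  let ψ := (presheafToSheaf (Opens.grothendieckTopology X) Ab.{0}).mapShortComplex.map φ
  have : Epi ψ.τ₁ := hk'
  have : IsIso ψ.τ₂ := inferInstanceAs (IsIso (aShMap (𝟙 _)))
  have : Mono ψ.τ₃ := inferInstanceAs (Mono (aShMap (𝟙 _)))
  exact (ShortComplex.exact_iff_of_epi_of_isIso_of_mono ψ).2 hS'

/-- A morphism of presheaves bijective on the members of `B`. -/
def BijOn (B : Set (Opens X)) {P Q : AbPresheaf X} (f : P ⟶ Q) : Prop :=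
  ∀ V ∈ B, Function.Bijective (f.app (op V))

/-- Bijectivity on arbitrarily small open sets is enough for local injectivity and local
surjectivity. All comparisons of explicit presheaves with tensor products pass through this. -/
lemma BijOn.isIso {B : Set (Opens X)} (hB : Opens.IsBasis B) {P Q : AbPresheaf X} {f : P ⟶ Q}
    (h : BijOn B f) : IsIso (aShMap f) := by
  have : Presheaf.IsLocallyInjective (Opens.grothendieckTopology X) f := by
    refine isLocallyInjective_of_local f fun U s hs x hx => ?_
    obtain ⟨V, hV, hxV, hVU⟩ := Opens.isBasis_iff_nbhd.1 hB hx
    refine ⟨V, homOfLE hVU, hxV, (h V hV).1 ?_⟩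
    rw [map_zero]
    have := congr($(f.naturality (homOfLE hVU).op) s)
    refine this.trans ?_
    change Q.map _ (f.app _ s) = 0
    rw [hs, map_zero]
  have : Presheaf.IsLocallySurjective (Opens.grothendieckTopology X) f := by
    refine isLocallySurjective_of_local f fun U s x hx => ?_
    obtain ⟨V, hV, hxV, hVU⟩ := Opens.isBasis_iff_nbhd.1 hB hx
    exact ⟨V, homOfLE hVU, hxV, (h V hV).2 _⟩
  exact isIso_aShMap f

/-- Exactness of the sections over the members of a basis gives local exactness. -/
lemma LocallyExact.of_basis {B : Set (Opens X)} (hB : Opens.IsBasis B) {P Q R : AbPresheaf X}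
    {f : P ⟶ Q} {g : Q ⟶ R} (w : f ≫ g = 0) (h₁ : ∀ V ∈ B, Function.Injective (f.app (op V)))
    (h₂ : ∀ V ∈ B, ∀ s, g.app (op V) s = 0 → ∃ t, f.app (op V) t = s)
    (h₃ : ∀ V ∈ B, Function.Surjective (g.app (op V))) : LocallyExact f g where
  zero := w
  inj U s hs x hx := by
    obtain ⟨V, hV, hxV, hVU⟩ := Opens.isBasis_iff_nbhd.1 hB hx
    refine ⟨V, homOfLE hVU, hxV, h₁ V hV ?_⟩
    rw [map_zero]
    have := congr($(f.naturality (homOfLE hVU).op) s)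
    refine this.trans ?_
    change Q.map _ (f.app _ s) = 0
    rw [hs, map_zero]
  exact U s hs x hx := by
    obtain ⟨V, hV, hxV, hVU⟩ := Opens.isBasis_iff_nbhd.1 hB hx
    refine ⟨V, homOfLE hVU, hxV, h₂ V hV _ ?_⟩
    have := congr($(g.naturality (homOfLE hVU).op) s)
    refine this.trans ?_
    change R.map _ (g.app _ s) = 0
    rw [hs, map_zero]
  surj U s x hx := by
    obtain ⟨V, hV, hxV, hVU⟩ := Opens.isBasis_iff_nbhd.1 hB hx
    exact ⟨V, homOfLE hVU, hxV, h₃ V hV _⟩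

end SheafTheory

/-! ### Cohomology over open sets as Ext groups of free abelian sheaves. -/

section Cohomology

variable {X : TopCat.{0}}

/-- The abelian sheaf freely generated by an open set. -/
abbrev freeSh (X : TopCat.{0}) : Opens X ⥤ AbSheaf X :=
  yoneda ⋙ (Functor.whiskeringRight _ _ _).obj AddCommGrpCat.free ⋙
    presheafToSheaf (Opens.grothendieckTopology X) Ab.{0}

/-- The canonical section of `freeSh X U` over `U`. -/
def freeShSection (U : Opens X) : ((freeSh X).obj U).obj.obj (op U) :=
  (toSheafify (Opens.grothendieckTopology X) (yoneda.obj U ⋙ AddCommGrpCat.free)).app (op U)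
    (FreeAbelianGroup.of (𝟙 U) : FreeAbelianGroup (U ⟶ U))

/-- Morphisms out of `freeSh X U` are sections over `U`. -/
def freeShHom (U : Opens X) (F : AbSheaf X) : ((freeSh X).obj U ⟶ F) →+ F.obj.obj (op U) where
  toFun f := f.hom.app (op U) (freeShSection U)
  map_zero' := rfl
  map_add' _ _ := rfl

/-- Evaluation on the canonical section is the composite of the sheafification adjunction, the free
abelian group adjunction and the Yoneda bijection. -/
lemma freeShHom_bijective (U : Opens X) (F : AbSheaf X) : Function.Bijective (freeShHom U F) := by
  let e := ((sheafificationAdjunction (Opens.grothendieckTopology X) Ab.{0}).homEquiv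
    (yoneda.obj U ⋙ AddCommGrpCat.free) F).trans
    (((AddCommGrpCat.adj.whiskerRight _).homEquiv (yoneda.obj U) F.obj).trans yonedaEquiv)
  have : (freeShHom U F : _ → _) = e := by
    funext f
    simp [e, freeShHom]
    rfl
  rw [this]
  exact e.bijective

lemma freeSh_map_section {U V : Opens X} (i : V ⟶ U) :
    ((freeSh X).map i).hom.app (op V) (freeShSection V) =
      ((freeSh X).obj U).obj.map i.op (freeShSection U) := by
  let J := Opens.grothendieckTopology X
  let P (W : Opens X) : AbPresheaf X := yoneda.obj W ⋙ AddCommGrpCat.free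
  let φ : P V ⟶ P U := Functor.whiskerRight (yoneda.map i) AddCommGrpCat.free
  have h₁ := congr($(congr_app (toSheafify_naturality J φ) (op V))
    (FreeAbelianGroup.of (𝟙 V) : FreeAbelianGroup (V ⟶ V)))
  have h₂ := congr($((toSheafify J (P U)).naturality i.op)
    (FreeAbelianGroup.of (𝟙 U) : FreeAbelianGroup (U ⟶ U)))
  refine h₁.symm.trans (Eq.trans ?_ h₂)
  change (toSheafify J (P U)).app (op V) (FreeAbelianGroup.map _ (FreeAbelianGroup.of (𝟙 V))) =
    (toSheafify J (P U)).app (op V) (FreeAbelianGroup.map _ (FreeAbelianGroup.of (𝟙 U)))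
  rw [FreeAbelianGroup.map_of_apply, FreeAbelianGroup.map_of_apply]
  rfl

lemma freeShHom_comp_map {U V : Opens X} (i : V ⟶ U) {F : AbSheaf X} (f : (freeSh X).obj U ⟶ F) :
    freeShHom V F ((freeSh X).map i ≫ f) = F.obj.map i.op (freeShHom U F f) := by
  have h := congr($(f.hom.naturality i.op) (freeShSection U))
  refine Eq.trans ?_ h
  exact congrArg (f.hom.app (op V)) (freeSh_map_section i)

/-- The cohomology of `F` over an open set `U`. -/
abbrev HU (F : AbSheaf X) (n : ℕ) (U : Opens X) : Type := Ext ((freeSh X).obj U) F n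

/-- Restriction of cohomology classes. -/
def HU.res {F : AbSheaf X} {n : ℕ} {U V : Opens X} (i : V ≤ U) (x : HU F n U) : HU F n V :=
  (Ext.mk₀ ((freeSh X).map (homOfLE i))).comp x (zero_add n)

/-- Sections are classes of degree zero. -/
def HU.sec {F : AbSheaf X} (U : Opens X) : HU F 0 U ≃+ F.obj.obj (op U) :=
  Ext.addEquiv₀.trans (AddEquiv.ofBijective (freeShHom U F) (freeShHom_bijective U F))

lemma HU.sec_mk₀ {F : AbSheaf X} {U : Opens X} (f : (freeSh X).obj U ⟶ F) :
    HU.sec U (Ext.mk₀ f) = freeShHom U F f := by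
  have : Ext.addEquiv₀ (Ext.mk₀ f) = f := Ext.homEquiv₀.apply_symm_apply f
  simp [HU.sec, this]

lemma HU.sec_res {F : AbSheaf X} {U V : Opens X} (i : V ≤ U) (x : HU F 0 U) :
    HU.sec V (HU.res i x) = F.obj.map (homOfLE i).op (HU.sec U x) := by
  obtain ⟨f, rfl⟩ := (Ext.mk₀_bijective _ _).2 x
  rw [HU.res, Ext.mk₀_comp_mk₀, HU.sec_mk₀, HU.sec_mk₀, freeShHom_comp_map]

lemma HU.sec_comp {F G : AbSheaf X} {U : Opens X} (f : F ⟶ G) (x : HU F 0 U) :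
    HU.sec U (x.comp (Ext.mk₀ f) (add_zero 0)) = f.hom.app (op U) (HU.sec U x) := by
  obtain ⟨g, rfl⟩ := (Ext.mk₀_bijective _ _).2 x
  rw [Ext.mk₀_comp_mk₀, HU.sec_mk₀, HU.sec_mk₀]
  rfl

lemma HU.res_res {F : AbSheaf X} {n : ℕ} {U V W : Opens X} (i : V ≤ U) (j : W ≤ V) (x : HU F n U) :
    HU.res j (HU.res i x) = HU.res (j.trans i) x := by
  simp only [HU.res]
  rw [← Ext.comp_assoc_of_second_deg_zero, Ext.mk₀_comp_mk₀, ← Functor.map_comp]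
  rfl

@[simp] lemma HU.res_refl {F : AbSheaf X} {n : ℕ} {U : Opens X} (x : HU F n U) :
    HU.res le_rfl x = x := by
  have : (freeSh X).map (homOfLE (le_refl U)) = 𝟙 _ := (freeSh X).map_id U
  simp only [HU.res, this, Ext.mk₀_id_comp]

@[simp] lemma HU.res_zero {F : AbSheaf X} {n : ℕ} {U V : Opens X} (i : V ≤ U) :
    HU.res i (0 : HU F n U) = 0 := by
  simp [HU.res]

lemma HU.res_comp {F G : AbSheaf X} {n m k : ℕ} {U V : Opens X} (i : V ≤ U) (x : HU F n U)
    (y : Ext F G m) (h : n + m = k) :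
    HU.res i (x.comp y h) = (HU.res i x : HU F n V).comp y h := by
  simp only [HU.res]
  rw [Ext.comp_assoc (a₁₂ := n) (a₂₃ := k) _ _ _ (zero_add n) h (by lia)]

/-- Cohomology classes of positive degree vanish locally. -/
lemma HU.exists_res_eq_zero (n : ℕ) : ∀ (F : AbSheaf X) (U : Opens X) (x : HU F (n + 1) U) (p : X),
    p ∈ U → ∃ (V : Opens X) (i : V ≤ U), p ∈ V ∧ HU.res i x = 0 := by
  induction n with
  | zero =>
    intro F U x p hp
    -- Dimension shift: `F` is embedded in an injective sheaf, so a class of degree one is the image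
    -- of a section of the cokernel under the connecting map.
    let S : ShortComplex (AbSheaf X) :=
      ShortComplex.mk (Injective.ι F) (cokernel.π (Injective.ι F)) (cokernel.condition _)
    have hS : S.ShortExact := { exact := S.exact_of_g_is_cokernel (cokernelIsCokernel _) }
    obtain ⟨y, rfl⟩ := Ext.covariant_sequence_exact₁ _ hS x (Ext.eq_zero_of_injective _)
      (zero_add 1)
    have := (TopCat.Sheaf.isLocallySurjective_iff_epi S.g).2 hS.epi_g
    have : Presheaf.IsLocallySurjective (Opens.grothendieckTopology X) S.g.hom := this
    obtain ⟨V, i, hV, t, ht⟩ := exists_lift S.g.hom (HU.sec U y) hp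
    refine ⟨V, leOfHom i, hV, ?_⟩
    -- On `V` the section of the cokernel lifts to the injective sheaf, so the connecting map kills
    -- it.
    have : HU.res (leOfHom i) y = ((HU.sec V).symm t).comp (Ext.mk₀ S.g) (add_zero 0) := by
      apply (HU.sec V).injective
      rw [HU.sec_comp, HU.sec_res, AddEquiv.apply_symm_apply, ht]
      rfl
    rw [HU.res_comp, this, Ext.comp_assoc _ _ _ (add_zero 0) (zero_add 1) (by lia),
      hS.comp_extClass, Ext.comp_zero]
  | succ n ih =>
    intro F U x p hp
    let S : ShortComplex (AbSheaf X) :=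
      ShortComplex.mk (Injective.ι F) (cokernel.π (Injective.ι F)) (cokernel.condition _)
    have hS : S.ShortExact := { exact := S.exact_of_g_is_cokernel (cokernelIsCokernel _) }
    obtain ⟨y, rfl⟩ := Ext.covariant_sequence_exact₁ _ hS x (Ext.eq_zero_of_injective _)
      (n₀ := n + 1) rfl
    obtain ⟨V, i, hV, h⟩ := ih _ U y p hp
    exact ⟨V, i, hV, by rw [HU.res_comp, h, Ext.zero_comp]⟩

end Cohomology

/-! ### The Mayer-Vietoris sequence and its naturality. -/

section MayerVietoris

variable {X : TopCat.{0}} {F : AbSheaf X}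

lemma mv_zero (U V : Opens X) :
    biprod.lift ((freeSh X).map (homOfLE (inf_le_left (a := U) (b := V))))
      (-(freeSh X).map (homOfLE (inf_le_right (a := U) (b := V)))) ≫
    biprod.desc ((freeSh X).map (homOfLE (le_sup_left (a := U) (b := V))))
      ((freeSh X).map (homOfLE (le_sup_right (a := U) (b := V)))) = 0 :=
  (_root_.Opens.mayerVietorisSquare U V).shortComplex.zero

/-- The Mayer-Vietoris complex of free abelian sheaves. -/
abbrev mvComplex (U V : Opens X) : ShortComplex (AbSheaf X) :=
  ShortComplex.mk (X₁ := (freeSh X).obj (U ⊓ V)) (X₂ := (freeSh X).obj U ⊞ (freeSh X).obj V)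
    (X₃ := (freeSh X).obj (U ⊔ V)) _ _ (mv_zero U V)

lemma mvComplex_shortExact (U V : Opens X) : (mvComplex U V).ShortExact :=
  (_root_.Opens.mayerVietorisSquare U V).shortComplex_shortExact

/-- The connecting homomorphism of the Mayer-Vietoris sequence. -/
def mvδ (U V : Opens X) {n : ℕ} (x : HU F n (U ⊓ V)) : HU F (n + 1) (U ⊔ V) :=
  (mvComplex_shortExact U V).extClass.comp x (by lia)

lemma exists_mvδ_eq {U V : Opens X} {n : ℕ} (x : HU F (n + 1) (U ⊔ V))
    (hU : HU.res le_sup_left x = 0) (hV : HU.res le_sup_right x = 0) :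
    ∃ y : HU F n (U ⊓ V), mvδ U V y = x := by
  refine Ext.contravariant_sequence_exact₃ (mvComplex_shortExact U V) F x ?_ (by lia)
  apply Ext.biprodAddEquiv.injective
  rw [map_zero]
  refine Prod.ext ?_ ?_
  · refine (Ext.mk₀_comp_mk₀_assoc _ _ _).trans ?_
    rw [biprod.inl_desc]
    exact hU
  · refine (Ext.mk₀_comp_mk₀_assoc _ _ _).trans ?_
    rw [biprod.inr_desc]
    exact hV

/-- The minus sign is the one in the first map of `mvComplex`; the two classes are the components of
a class on the direct sum. -/
lemma exists_of_mvδ_eq_zero {U V : Opens X} {n : ℕ} (x : HU F n (U ⊓ V)) (h : mvδ U V x = 0) :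
    ∃ (y : HU F n U) (z : HU F n V), x = HU.res inf_le_left y - HU.res inf_le_right z := by
  obtain ⟨w, hw⟩ := Ext.contravariant_sequence_exact₁ (mvComplex_shortExact U V) F x (by lia) h
  refine ⟨(Ext.mk₀ biprod.inl).comp w (zero_add n), (Ext.mk₀ biprod.inr).comp w (zero_add n), ?_⟩
  rw [← hw]
  obtain ⟨⟨y, z⟩, rfl⟩ := Ext.biprodAddEquiv.symm.surjective w
  simp only [HU.res, Ext.biprodAddEquiv_symm_apply, Ext.comp_add, Ext.mk₀_comp_mk₀_assoc,
    biprod.lift_fst, biprod.lift_snd, biprod.inl_fst, biprod.inr_snd, biprod.inl_snd,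
    biprod.inr_fst, Ext.mk₀_neg, Ext.neg_comp, Ext.mk₀_id_comp, Ext.mk₀_zero, Ext.zero_comp,
    add_zero, zero_add, sub_eq_add_neg]

lemma mvδ_sub {U V : Opens X} {n : ℕ} (x y : HU F n (U ⊓ V)) :
    mvδ U V (x - y) = mvδ U V x - mvδ U V y := by
  simp only [mvδ, sub_eq_add_neg, Ext.comp_add, Ext.comp_neg]

lemma mvδ_res_left {U V : Opens X} {n : ℕ} (x : HU F n U) :
    mvδ U V (HU.res inf_le_left x) = 0 := by
  have h := (mvComplex_shortExact U V).extClass_comp_assoc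
    ((Ext.mk₀ biprod.fst).comp x (zero_add n)) (h := add_comm 1 n)
  rw [Ext.mk₀_comp_mk₀_assoc, biprod.lift_fst] at h
  exact h

lemma mvδ_res_right {U V : Opens X} {n : ℕ} (x : HU F n V) :
    mvδ U V (HU.res inf_le_right x) = 0 := by
  have h := (mvComplex_shortExact U V).extClass_comp_assoc
    ((Ext.mk₀ biprod.snd).comp x (zero_add n)) (h := add_comm 1 n)
  rw [Ext.mk₀_comp_mk₀_assoc, biprod.lift_snd, Ext.mk₀_neg, Ext.neg_comp, Ext.comp_neg,
    neg_eq_zero] at h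
  exact h

/-- The inclusions form a morphism between the two Mayer-Vietoris complexes, and extension classes
are natural for such morphisms. -/
lemma res_mvδ {U V U' V' : Opens X} {n : ℕ} (i : U' ≤ U) (j : V' ≤ V) (x : HU F n (U ⊓ V)) :
    HU.res (sup_le_sup i j) (mvδ U V x) = mvδ U' V' (HU.res (inf_le_inf i j) x) := by
  let φ : mvComplex U' V' ⟶ mvComplex U V :=
    { τ₁ := (freeSh X).map (homOfLE (inf_le_inf i j))
      τ₂ := biprod.map ((freeSh X).map (homOfLE i)) ((freeSh X).map (homOfLE j))
      τ₃ := (freeSh X).map (homOfLE (sup_le_sup i j))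
      comm₁₂ := by
        apply biprod.hom_ext
        · simp only [Category.assoc, biprod.map_fst, biprod.lift_fst, biprod.lift_fst_assoc,
            ← Functor.map_comp]
          rfl
        · simp only [Category.assoc, biprod.map_snd, biprod.lift_snd, biprod.lift_snd_assoc,
            Preadditive.comp_neg, Preadditive.neg_comp, ← Functor.map_comp]
          rfl
      comm₂₃ := by
        apply biprod.hom_ext'
        · simp only [biprod.inl_map_assoc, biprod.inl_desc, biprod.inl_desc_assoc,
            ← Functor.map_comp]
          rfl
        · simp only [biprod.inr_map_assoc, biprod.inr_desc, biprod.inr_desc_assoc,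
            ← Functor.map_comp]
          rfl }
  have h := ShortComplex.ShortExact.extClass_naturality (mvComplex_shortExact U' V')
    (mvComplex_shortExact U V) φ
  unfold HU.res mvδ
  rw [← Ext.comp_assoc (a₁₂ := 1) _ _ _ (zero_add 1) (by lia) (by lia)]
  refine (congrArg (fun z => Ext.comp z x (by lia)) h).symm.trans ?_
  rw [Ext.comp_assoc (a₂₃ := n) _ _ _ (add_zero 1) (zero_add n) (by lia)]

end MayerVietoris

/-! ### Vanishing of higher cohomology on sets that behave like principal open sets. -/

section AffineVanishing

variable {X : TopCat.{0}} {F : AbSheaf X}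

lemma subsingleton_HU_bot (n : ℕ) : Subsingleton (HU F n (⊥ : Opens X)) := by
  have h : IsZero ((freeSh X).obj (⊥ : Opens X)) := by
    rw [IsZero.iff_id_eq_zero]
    apply (freeShHom_bijective _ _).1
    have : Subsingleton (((freeSh X).obj (⊥ : Opens X)).obj.obj (op ⊥)) := by
      refine ⟨fun s t => ?_⟩
      exact TopCat.Sheaf.eq_of_locally_eq' ((freeSh X).obj ⊥) (fun i : PEmpty.{1} => i.elim) ⊥
        (fun i => i.elim) bot_le s t (fun i => i.elim)
    exact Subsingleton.elim _ _
  refine ⟨fun x y => ?_⟩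
  have h0 (z : HU F n (⊥ : Opens X)) : z = 0 := by
    rw [← Ext.mk₀_id_comp z, h.eq_zero_of_src (𝟙 _), Ext.mk₀_zero, Ext.zero_comp]
  rw [h0 x, h0 y]

/-- Vanishing of higher cohomology on a family of open sets `D f`, `f` in a ring, which behaves like
the distinguished open subsets of an affine scheme: it is enough that sections over `D (f * g)` are
sums of sections over `D f` and `D g` as soon as `D f` and `D g` cover some `D h`. -/
theorem subsingleton_HU_of_ring {R : Type*} [CommRing R] (D : R → Opens X)
    (h_zero : D 0 = ⊥) (h_mul : ∀ f g, D (f * g) = D f ⊓ D g) (h_add : ∀ f g, D (f + g) ≤ D f ⊔ D g)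
    (h_nhd : ∀ f (V : Opens X) (x : X), x ∈ D f → x ∈ V → ∃ g, x ∈ D g ∧ D g ≤ V)
    (h_rad : ∀ f (I : Ideal R), (∀ x ∈ D f, ∃ g ∈ I, x ∈ D g) → ∃ n, f ^ n ∈ I)
    (h_pow : ∀ f n, D f ≤ D (f ^ n))
    (h_sec : ∀ f g h, D h = D f ⊔ D g → ∀ s : F.obj.obj (op (D f ⊓ D g)),
      ∃ (a : F.obj.obj (op (D f))) (b : F.obj.obj (op (D g))),
        s = F.obj.map (homOfLE inf_le_left).op a - F.obj.map (homOfLE inf_le_right).op b)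
    (n : ℕ) : ∀ f, Subsingleton (HU F (n + 1) (D f)) := by
  induction n using Nat.strong_induction_on with
  | _ n ih =>
  intro h
  refine subsingleton_of_forall_eq 0 fun x => ?_
  -- The elements `f` for which the class dies on `D (f * h)` are shown to form an ideal. A power of
  -- `h` in it makes the class vanish on `D h`.
  let I : Ideal R :=
    { carrier := {f | HU.res (h_mul f h ▸ inf_le_right : D (f * h) ≤ D h) x = 0}
      zero_mem' := by
        have : D (0 * h) = ⊥ := by rw [zero_mul, h_zero]
        have := (this ▸ subsingleton_HU_bot (n + 1) : Subsingleton (HU F (n + 1) (D (0 * h))))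
        exact Subsingleton.elim _ _
      add_mem' := by
        intro f g hf hg
        have hU : D (f * ((f + g) * h)) ≤ D h := by simp only [h_mul]; exact inf_le_right.trans inf_le_right
        have hV : D (g * ((f + g) * h)) ≤ D h := by simp only [h_mul]; exact inf_le_right.trans inf_le_right
        -- The factor `f + g` is kept in both pieces so that their union is again one of the sets
        -- `D`, as `h_sec` demands.
        have key : D ((f + g) * h) = D (f * ((f + g) * h)) ⊔ D (g * ((f + g) * h)) := by
          rw [h_mul f, h_mul g, ← inf_sup_right, eq_comm, inf_eq_right]
          exact (h_mul _ _ ▸ inf_le_left : D ((f + g) * h) ≤ D (f + g)).trans (h_add f g)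
        have hle : D (f * ((f + g) * h)) ⊔ D (g * ((f + g) * h)) ≤ D h := sup_le hU hV
        have main : HU.res hle x = 0 := by
          obtain ⟨y, hy⟩ := exists_mvδ_eq (HU.res hle x) (by
            rw [HU.res_res]
            have := congrArg (HU.res (show D (f * ((f + g) * h)) ≤ D (f * h) by
              simp only [h_mul]; exact inf_le_inf_left _ inf_le_right)) hf
            rwa [HU.res_res, HU.res_zero] at this) (by
            rw [HU.res_res]
            have := congrArg (HU.res (show D (g * ((f + g) * h)) ≤ D (g * h) by
              simp only [h_mul]; exact inf_le_inf_left _ inf_le_right)) hg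
            rwa [HU.res_res, HU.res_zero] at this)
          rw [← hy]
          -- The class on the union comes from a class `y` of degree one less on the intersection.
          -- In degree zero `y` is a section, which splits by `h_sec`; in positive degree it
          -- vanishes by induction, the intersection being one of the sets `D`.
          cases n with
          | zero =>
            obtain ⟨a, b, hab⟩ := h_sec _ _ _ key (HU.sec _ y)
            have : y = HU.res inf_le_left ((HU.sec _).symm a) -
                HU.res inf_le_right ((HU.sec _).symm b) := by
              apply (HU.sec _).injective
              rw [map_sub, HU.sec_res, HU.sec_res, AddEquiv.apply_symm_apply,
                AddEquiv.apply_symm_apply, hab]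
            rw [this, mvδ_sub, mvδ_res_left, mvδ_res_right, sub_zero]
          | succ n =>
            have e : D (f * ((f + g) * h)) ⊓ D (g * ((f + g) * h)) =
              D (f * ((f + g) * h) * (g * ((f + g) * h))) := (h_mul _ _).symm
            have := ih n (by lia) (f * ((f + g) * h) * (g * ((f + g) * h)))
            rw [← e] at this
            rw [Subsingleton.elim y 0]
            simp [mvδ]
        have := congrArg (HU.res key.le) main
        rwa [HU.res_res, HU.res_zero] at this
      smul_mem' := by
        intro c f hf
        have := congrArg (HU.res (show D (c • f * h) ≤ D (f * h) by
          simp only [h_mul, smul_eq_mul]; exact inf_le_inf_right _ inf_le_right)) hf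
        rwa [HU.res_res, HU.res_zero] at this }
  -- Classes of positive degree vanish locally, so every point of `D h` lies in `D g` for some `g`
  -- in the ideal.
  obtain ⟨m, hm⟩ := h_rad h I (fun p hp => by
    obtain ⟨V, i, hV, hx⟩ := HU.exists_res_eq_zero n F _ x p hp
    obtain ⟨g, hpg, hg⟩ := h_nhd h V p hp hV
    refine ⟨g, ?_, hpg⟩
    have := congrArg (HU.res (show D (g * h) ≤ V by rw [h_mul]; exact inf_le_left.trans hg)) hx
    rwa [HU.res_res, HU.res_zero] at this)
  have hm' : HU.res (h_mul (h ^ m) h ▸ inf_le_right : D (h ^ m * h) ≤ D h) x = 0 := hm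
  have := congrArg (HU.res (show D h ≤ D (h ^ m * h) by
    rw [h_mul]; exact le_inf (h_pow h m) le_rfl)) hm'
  rwa [HU.res_res, HU.res_zero, HU.res_refl] at this

end AffineVanishing

/-! ### Comparison with the cohomology of the whole space. -/

section Global

variable {X : TopCat.{0}}

/-- Sections of an abelian sheaf over the whole space. -/
abbrev globalSections (X : TopCat.{0}) : AbSheaf X ⥤ Type :=
  sheafToPresheaf _ _ ⋙ (evaluation _ _).obj (op ⊤) ⋙ forget Ab

/-- `freeSh X ⊤` corepresents global sections. -/
def freeShCorep : (globalSections X).CorepresentableBy ((freeSh X).obj ⊤) where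
  homEquiv := Equiv.ofBijective _ (freeShHom_bijective ⊤ _)
  homEquiv_comp _ _ := rfl

/-- The constant sheaf `ℤ` corepresents global sections. -/
def constCorep : (globalSections X).CorepresentableBy
    ((constantSheaf (Opens.grothendieckTopology X) Ab.{0}).obj (AddCommGrpCat.of (ULift ℤ))) where
  homEquiv {F} := (((constantSheafAdj (Opens.grothendieckTopology X) AddCommGrpCat.{0}
    (T := (⊤ : Opens X)) isTerminalTop).homAddEquiv _ F).trans
      (AddCommGrpCat.uliftZMultiplesAddEquiv _)).toEquiv
  homEquiv_comp _ _ := rfl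

/-- The constant sheaf `ℤ` is freely generated by the whole space. -/
def constIsoFreeSh : (constantSheaf (Opens.grothendieckTopology X) Ab.{0}).obj
    (AddCommGrpCat.of (ULift ℤ)) ≅ (freeSh X).obj ⊤ :=
  constCorep.uniqueUpToIso freeShCorep

/-- Both groups are Ext groups into `F`, from two sheaves that corepresent global sections and are
therefore isomorphic. -/
lemma subsingleton_H_of_HU (F : AbSheaf X) (n : ℕ) (h : Subsingleton (HU F n ⊤)) :
    Subsingleton (F.H n) := by
  refine subsingleton_of_forall_eq 0 fun x => ?_
  have := Subsingleton.elim ((Ext.mk₀ constIsoFreeSh.inv).comp x (zero_add n)) 0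
  have := congrArg (fun z => (Ext.mk₀ constIsoFreeSh.hom).comp z (zero_add n)) this
  simpa using this

end Global

/-! ### Čech-type criteria for a union of three open sets. -/

section ThreeOpens

variable {X : TopCat.{0}} {F : AbSheaf X}

/-- Restriction of a section of an abelian sheaf. -/
abbrev rs {F : AbPresheaf X} {U V : Opens X} (i : V ≤ U) (s : F.obj (op U)) : F.obj (op V) :=
  F.map (homOfLE i).op s

lemma rs_rs {F : AbPresheaf X} {U V W : Opens X} (i : V ≤ U) (j : W ≤ V) (s : F.obj (op U)) :
    rs j (rs i s) = rs (j.trans i) s := by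
  simp only [rs, ← ConcreteCategory.comp_apply, ← Functor.map_comp]
  rfl

lemma rs_injective_sup {U V : Opens X} {s t : F.obj.obj (op (U ⊔ V))}
    (hU : rs le_sup_left s = rs le_sup_left t) (hV : rs le_sup_right s = rs le_sup_right t) :
    s = t := by
  refine TopCat.Sheaf.eq_of_locally_eq' F (fun b : Bool => cond b U V) _
    (fun b => homOfLE (by cases b; exacts [le_sup_right, le_sup_left])) ?_ s t ?_
  · exact sup_le (le_iSup_of_le true le_rfl) (le_iSup_of_le false le_rfl)
  · rintro (_ | _)
    exacts [hV, hU]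

lemma exists_sec_eq {n : ℕ} {U V : Opens X} [Subsingleton (HU F (n + 1) U)]
    [Subsingleton (HU F (n + 1) V)] (x : HU F (n + 1) (U ⊔ V)) :
    ∃ y : HU F n (U ⊓ V), mvδ U V y = x :=
  exists_mvδ_eq x (Subsingleton.elim _ _) (Subsingleton.elim _ _)

/-- On V₁ ∪ V₂ a class is the boundary of a section `a` on V₁ ∩ V₂. Since the class dies on V₃, `a`
splits on the triple intersection, and `h₁` makes it split before restriction. Then the class is the
boundary of a section on (V₁ ∪ V₂) ∩ V₃, which `h₂` extends to V₃. -/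
lemma subsingleton_HU_one_of_three (V₁ V₂ V₃ : Opens X) [Subsingleton (HU F 1 V₁)]
    [Subsingleton (HU F 1 V₂)] [Subsingleton (HU F 1 V₃)]
    (h₁ : ∀ (a : F.obj.obj (op (V₁ ⊓ V₂))) (b : F.obj.obj (op (V₁ ⊓ V₃)))
      (c : F.obj.obj (op (V₂ ⊓ V₃))),
      rs (inf_le_inf inf_le_left inf_le_left) a =
        rs (V := V₁ ⊓ V₃ ⊓ (V₂ ⊓ V₃)) inf_le_left b - rs inf_le_right c →
      ∃ (s : F.obj.obj (op V₁)) (t : F.obj.obj (op V₂)), a = rs inf_le_left s - rs inf_le_right t)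
    (h₂ : ∀ (b : F.obj.obj (op (V₁ ⊓ V₃))) (c : F.obj.obj (op (V₂ ⊓ V₃))),
      rs (V := V₁ ⊓ V₃ ⊓ (V₂ ⊓ V₃)) inf_le_left b = rs inf_le_right c →
      ∃ (s : F.obj.obj (op V₃)), b = rs inf_le_right s ∧ c = rs inf_le_right s) :
    Subsingleton (HU F 1 (V₁ ⊔ V₂ ⊔ V₃)) := by
  refine subsingleton_of_forall_eq 0 fun x => ?_
  have hW : HU.res le_sup_left x = 0 := by
    obtain ⟨y, hy⟩ := exists_sec_eq (HU.res le_sup_left x : HU F 1 (V₁ ⊔ V₂))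
    have h0 : HU.res (sup_le_sup (inf_le_left : V₁ ⊓ V₃ ≤ V₁) (inf_le_left : V₂ ⊓ V₃ ≤ V₂))
        (mvδ V₁ V₂ y) = 0 := by
      rw [hy, HU.res_res]
      have hle : V₁ ⊓ V₃ ⊔ V₂ ⊓ V₃ ≤ V₃ := sup_le inf_le_right inf_le_right
      have := congrArg (HU.res hle) (Subsingleton.elim (HU.res le_sup_right x) 0)
      rwa [HU.res_res, HU.res_zero] at this
    rw [res_mvδ inf_le_left inf_le_left] at h0
    obtain ⟨b, c, hbc⟩ := exists_of_mvδ_eq_zero _ h0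
    have hbc := congrArg (HU.sec _) hbc
    simp only [map_sub, HU.sec_res] at hbc
    obtain ⟨s, t, hst⟩ := h₁ _ _ _ hbc
    have : y = HU.res inf_le_left ((HU.sec _).symm s) - HU.res inf_le_right ((HU.sec _).symm t) := by
      apply (HU.sec _).injective
      rw [map_sub, HU.sec_res, HU.sec_res, AddEquiv.apply_symm_apply, AddEquiv.apply_symm_apply, hst]
    rw [← hy, this, mvδ_sub, mvδ_res_left, mvδ_res_right, sub_zero]
  obtain ⟨y, hy⟩ := exists_mvδ_eq x hW (Subsingleton.elim _ _)
  have e : V₁ ⊓ V₃ ⊔ V₂ ⊓ V₃ ≤ (V₁ ⊔ V₂) ⊓ V₃ := inf_sup_right _ _ _ |>.ge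
  obtain ⟨s, hs₁, hs₂⟩ := h₂ (rs (inf_le_inf_right _ le_sup_left) (HU.sec _ y))
    (rs (inf_le_inf_right _ le_sup_right) (HU.sec _ y)) (by rw [rs_rs, rs_rs])
  have : y = HU.res inf_le_right ((HU.sec _).symm s) := by
    apply (HU.sec _).injective
    rw [HU.sec_res, AddEquiv.apply_symm_apply]
    have key : rs e (HU.sec _ y) = rs e (rs inf_le_right s) := by
      refine rs_injective_sup ?_ ?_
      · rw [rs_rs, rs_rs, rs_rs, hs₁]
      · rw [rs_rs, rs_rs, rs_rs, hs₂]
    have := congrArg (rs (inf_sup_right V₁ V₂ V₃).le) key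
    rw [rs_rs, rs_rs] at this
    have hid (z : F.obj.obj (op ((V₁ ⊔ V₂) ⊓ V₃))) : rs le_rfl z = z := by
      simp [rs]
    rwa [hid, hid] at this
  rw [← hy, this, mvδ_res_right]

/-- Two connecting maps lead from the class down to a section on the triple intersection. The terms
`b` and `c` of its decomposition die under the inner connecting map; the term `a` leaves a class
restricted from V₁ ∪ V₂, which dies under the outer one. -/
lemma subsingleton_HU_two_of_three (V₁ V₂ V₃ : Opens X) [Subsingleton (HU F 2 V₁)]
    [Subsingleton (HU F 2 V₂)] [Subsingleton (HU F 2 V₃)] [Subsingleton (HU F 1 (V₁ ⊓ V₂))]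
    [Subsingleton (HU F 1 (V₁ ⊓ V₃))] [Subsingleton (HU F 1 (V₂ ⊓ V₃))]
    (h : ∀ s : F.obj.obj (op (V₁ ⊓ V₃ ⊓ (V₂ ⊓ V₃))), ∃ (a : F.obj.obj (op (V₁ ⊓ V₂)))
      (b : F.obj.obj (op (V₁ ⊓ V₃))) (c : F.obj.obj (op (V₂ ⊓ V₃))),
      s = rs (inf_le_inf inf_le_left inf_le_left) a - (rs inf_le_left b - rs inf_le_right c)) :
    Subsingleton (HU F 2 (V₁ ⊔ V₂ ⊔ V₃)) := by
  refine subsingleton_of_forall_eq 0 fun x => ?_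
  have hW : Subsingleton (HU F 2 (V₁ ⊔ V₂)) := by
    refine subsingleton_of_forall_eq 0 fun z => ?_
    obtain ⟨y, rfl⟩ := exists_sec_eq (n := 1) z
    rw [Subsingleton.elim y 0]
    simp [mvδ]
  obtain ⟨y, rfl⟩ := exists_sec_eq (n := 1) x
  have e : V₁ ⊓ V₃ ⊔ V₂ ⊓ V₃ ≤ (V₁ ⊔ V₂) ⊓ V₃ := inf_sup_right _ _ _ |>.ge
  obtain ⟨s, hs⟩ := exists_sec_eq (HU.res e y)
  obtain ⟨a, b, c, habc⟩ := h (HU.sec _ s)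
  have : s = HU.res (inf_le_inf inf_le_left inf_le_left) ((HU.sec _).symm a) -
      (HU.res inf_le_left ((HU.sec _).symm b) - HU.res inf_le_right ((HU.sec _).symm c)) := by
    apply (HU.sec _).injective
    simp only [map_sub, HU.sec_res, AddEquiv.apply_symm_apply]
    exact habc
  rw [this, mvδ_sub, mvδ_sub, mvδ_res_left, mvδ_res_right, sub_zero, sub_zero, ← res_mvδ inf_le_left inf_le_left] at hs
  have hy := congrArg (HU.res (inf_sup_right V₁ V₂ V₃).le) hs
  rw [HU.res_res, HU.res_res, HU.res_refl] at hy
  rw [← hy]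
  exact mvδ_res_left (U := V₁ ⊔ V₂) (V := V₃) _

/-- A cohomology class on `W ⊔ V` vanishes if it does on `W` and if `F` vanishes on `V`, where `W` is
covered by three open sets. -/
lemma subsingleton_HU_one_of_sup (W V : Opens X) [Subsingleton (HU F 1 W)]
    [Subsingleton (HU F 1 V)] [Subsingleton (F.obj.obj (op (W ⊓ V)))] :
    Subsingleton (HU F 1 (W ⊔ V)) := by
  refine subsingleton_of_forall_eq 0 fun x => ?_
  obtain ⟨y, rfl⟩ := exists_sec_eq x
  have : y = 0 := (HU.sec _).injective (Subsingleton.elim _ _)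
  simp [this, mvδ]

lemma subsingleton_HU_two_of_sup (W V : Opens X) [Subsingleton (HU F 2 W)]
    [Subsingleton (HU F 2 V)] [Subsingleton (HU F 1 (W ⊓ V))] :
    Subsingleton (HU F 2 (W ⊔ V)) := by
  refine subsingleton_of_forall_eq 0 fun x => ?_
  obtain ⟨y, rfl⟩ := exists_sec_eq (n := 1) x
  simp [Subsingleton.elim y 0, mvδ]

end ThreeOpens

/-! ### When a presheaf already has the sections of its sheafification. -/

section Unit

variable {X : TopCat.{0}}

lemma rs_rfl {F : AbPresheaf X} {U : Opens X} (h : U ≤ U) (s : F.obj (op U)) : rs h s = s := by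
  simp [rs]

lemma rs_app {P Q : AbPresheaf X} (f : P ⟶ Q) {U V : Opens X} (i : V ≤ U) (s : P.obj (op U)) :
    rs i (f.app _ s) = f.app _ (rs i s) :=
  congr($(f.naturality (homOfLE i).op) s).symm

/-- The canonical morphism from a presheaf to its associated sheaf. -/
abbrev toSh (Q : AbPresheaf X) : Q ⟶ (aSh Q).obj :=
  toSheafify (Opens.grothendieckTopology X) Q

/-- If `Q` is, below `V`, compared to a sheaf by maps which are bijective on a basis containing `V`,
then `Q` has the same sections over `V` as its associated sheaf. -/
lemma bijective_toSh {B : Set (Opens X)} (hB : Opens.IsBasis B) (P : AbSheaf X) (Q : AbPresheaf X)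
    (V : Opens X) (hV : V ∈ B)
    (e : ∀ W : Opens X, W ≤ V → (P.obj.obj (op W) →+ Q.obj (op W)))
    (he : ∀ (W W' : Opens X) (h : W ≤ V) (i : W' ≤ W) (s : P.obj.obj (op W)),
      e W' (i.trans h) (rs i s) = rs i (e W h s))
    (hbij : ∀ (W : Opens X) (h : W ≤ V), W ∈ B → Function.Bijective (e W h)) :
    Function.Bijective ((toSh Q).app (op V)) := by
  -- Injectivity is needed for every open `W` below `V`, since the overlaps in the gluing argument
  -- need not belong to the basis.
  have key : ∀ (W : Opens X) (h : W ≤ V) (s : P.obj.obj (op W)),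
      (toSh Q).app _ (e W h s) = 0 → s = 0 := by
    intro W h s hs
    choose W' i hx hW' using fun x : W => exists_map_eq_zero (toSh Q) (e W h s) hs x.2
    choose W'' hB'' hx'' hi'' using fun x : W => Opens.isBasis_iff_nbhd.1 hB (hx x)
    refine TopCat.Sheaf.eq_of_locally_eq' P W'' W (fun x => homOfLE ((hi'' x).trans (i x).le))
      (fun x hx => Opens.mem_iSup.2 ⟨⟨x, hx⟩, hx'' ⟨x, hx⟩⟩) s 0 fun x => ?_
    have hle := (hi'' x).trans (i x).le
    apply (hbij (W'' x) (hle.trans h) (hB'' x)).1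
    refine (he W (W'' x) h hle s).trans ?_
    rw [← rs_rs (i x).le (hi'' x)]
    have : rs (i x).le (e W h s) = 0 := hW' x
    rw [this]
    simp
  refine ⟨(injective_iff_map_eq_zero _).2 fun q hq => ?_, fun t => ?_⟩
  · obtain ⟨s, rfl⟩ := (hbij V le_rfl hV).2 q
    rw [key V le_rfl s hq, map_zero]
  · choose W i hx q hq using fun x : V => exists_lift (toSh Q) t x.2
    choose W' hB' hx' hi' using fun x : V => Opens.isBasis_iff_nbhd.1 hB (hx x)
    have hle (x : V) : W' x ≤ V := (hi' x).trans (i x).le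
    choose s hs using fun x : V => (hbij (W' x) (hle x) (hB' x)).2 (rs (hi' x) (q x))
    have hts (x : V) : (toSh Q).app _ (e _ (hle x) (s x)) = rs (hle x) t := by
      rw [hs, ← rs_app, hq]
      exact rs_rs (i x).le (hi' x) t
    -- Local preimages are carried back to the sheaf `P`, where they can be glued; their images in
    -- the sheafification agree on overlaps, and `key` makes the preimages agree.
    have hcompat : TopCat.Presheaf.IsCompatible P.obj W' s := by
      intro x y
      rw [← sub_eq_zero]
      refine key (W' x ⊓ W' y) (inf_le_left.trans (hle x)) _ ?_
      rw [map_sub, map_sub, sub_eq_zero]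
      have h1 := he (W' x) (W' x ⊓ W' y) (hle x) inf_le_left (s x)
      have h2 := he (W' y) (W' x ⊓ W' y) (hle y) inf_le_right (s y)
      refine (congrArg _ h1).trans (Eq.trans ?_ (congrArg _ h2).symm)
      rw [← rs_app, ← rs_app, hts, hts, rs_rs, rs_rs]
    have hcov : V ≤ ⨆ x, W' x := fun x hx => Opens.mem_iSup.2 ⟨⟨x, hx⟩, hx' ⟨x, hx⟩⟩
    obtain ⟨p, hp, -⟩ := TopCat.Sheaf.existsUnique_gluing' P W' V
      (fun x => homOfLE (hle x)) hcov s hcompat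
    refine ⟨e V le_rfl p, ?_⟩
    refine TopCat.Sheaf.eq_of_locally_eq' (aSh Q) W' V (fun x => homOfLE (hle x)) hcov _ _ fun x => ?_
    change rs (hle x) _ = rs (hle x) _
    rw [rs_app, ← he, ← hts]
    exact congrArg (fun z => (toSh Q).app _ (e _ (hle x) z)) (hp x)

end Unit

/-! ### Sections of presheaves of modules and their tensor products. -/

section ModuleLayer

variable {X : Scheme.{0}}

/-- Presheaves of modules over the structure sheaf. -/
abbrev PMod (X : Scheme.{0}) := PresheafOfModules.{0} (X.presheaf ⋙ forget₂ CommRingCat RingCat)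

/-- The presheaf of modules underlying a sheaf of modules. -/
def pm (F : X.Modules) : PMod X := F.val

instance (M : PMod X) (V : X.Opens) : Module Γ(X, V) (M.presheaf.obj (op V)) :=
  (M.obj (op V)).isModule

/-- Restriction of regular functions. -/
abbrev rr {U V : X.Opens} (i : V ≤ U) : Γ(X, U) →+* Γ(X, V) := (X.presheaf.map (homOfLE i).op).hom

lemma rr_rr {U V W : X.Opens} (i : V ≤ U) (j : W ≤ V) (f : Γ(X, U)) :
    rr j (rr i f) = rr (j.trans i) f := by
  simp only [rr, ← CommRingCat.comp_apply, ← Functor.map_comp]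
  rfl

lemma rs_smul (M : PMod X) {U V : X.Opens} (i : V ≤ U) (r : Γ(X, U)) (m : M.presheaf.obj (op U)) :
    rs i (r • m) = rr i r • rs i m :=
  M.map_smul _ _ _

/-- The tensor product presheaf. -/
abbrev tens (M N : PMod X) : PMod X := PresheafOfModules.Monoidal.tensorObj (R := X.presheaf) M N

/-- The tensor `m ⊗ n` of two sections. -/
def tm (M N : PMod X) (V : X.Opens) : M.presheaf.obj (op V) →ₗ[Γ(X, V)] N.presheaf.obj (op V) →ₗ[Γ(X, V)]
    (tens M N).presheaf.obj (op V) :=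
  TensorProduct.mk (X.presheaf.obj (op V)) (M.obj (op V)) (N.obj (op V))

variable {M N : PMod X}

lemma rs_tm {U V : X.Opens} (i : V ≤ U) (m : M.presheaf.obj (op U)) (n : N.presheaf.obj (op U)) :
    rs i (tm M N U m n) = tm M N V (rs i m) (rs i n) := rfl

lemma tm_induction {V : X.Opens} {p : (tens M N).presheaf.obj (op V) → Prop} (z)
    (zero : p 0) (tmul : ∀ m n, p (tm M N V m n)) (add : ∀ x y, p x → p y → p (x + y)) : p z :=
  TensorProduct.induction_on (R := X.presheaf.obj (op V)) (M := M.obj (op V)) (N := N.obj (op V))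
    z zero tmul add

/-- Balanced biadditive maps. -/
structure Balanced {V : X.Opens} {G : Type} [AddCommGroup G]
    (f : M.presheaf.obj (op V) → N.presheaf.obj (op V) → G) : Prop where
  add_left (m m' n) : f (m + m') n = f m n + f m' n
  add_right (m n n') : f m (n + n') = f m n + f m n'
  smul (r : Γ(X, V)) (m n) : f (r • m) n = f m (r • n)

/-- The additive map on sections of a tensor product given by a balanced biadditive map. -/
def tmLift {V : X.Opens} {G : Type} [AddCommGroup G]
    {f : M.presheaf.obj (op V) → N.presheaf.obj (op V) → G} (hf : Balanced f) :
    (tens M N).presheaf.obj (op V) →+ G :=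
  TensorProduct.liftAddHom (R := X.presheaf.obj (op V)) (M := M.obj (op V)) (N := N.obj (op V))
    (AddMonoidHom.mk' (fun m => AddMonoidHom.mk' (f m) (hf.add_right m))
      (fun a b => AddMonoidHom.ext (hf.add_left a b)))
    (fun r m n => hf.smul r m n)

@[simp]
lemma tmLift_tm {V : X.Opens} {G : Type} [AddCommGroup G]
    {f : M.presheaf.obj (op V) → N.presheaf.obj (op V) → G} (hf : Balanced f) (m n) :
    tmLift hf (tm M N V m n) = f m n :=
  TensorProduct.liftAddHom_tmul _ _ _ _

/-- The morphism from a tensor product given by balanced biadditive maps. -/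
def tmHom {G : AbPresheaf X}
    {f : ∀ V : X.Opens, M.presheaf.obj (op V) → N.presheaf.obj (op V) → G.obj (op V)}
    (hf : ∀ V, Balanced (f V))
    (hn : ∀ (U V : X.Opens) (i : V ≤ U) m n, rs i (f U m n) = f V (rs i m) (rs i n)) :
    (tens M N).presheaf ⟶ G where
  app V := AddCommGrpCat.ofHom (tmLift (hf V.unop))
  naturality U V i := by
    ext z
    induction z using tm_induction with
    | zero => exact (map_zero _).trans (map_zero _).symm
    | add x y hx hy => exact (map_add _ _ _).trans ((congrArg₂ _ hx hy).trans (map_add _ _ _).symm)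
    | tmul m n =>
      refine (tmLift_tm (hf V.unop) _ _).trans ((hn _ _ i.unop.le m n).symm.trans ?_)
      exact congrArg (rs (F := G) i.unop.le) (tmLift_tm (hf U.unop) _ _).symm

lemma tmHom_tm {G : AbPresheaf X}
    {f : ∀ V : X.Opens, M.presheaf.obj (op V) → N.presheaf.obj (op V) → G.obj (op V)}
    (hf : ∀ V, Balanced (f V))
    (hn : ∀ (U V : X.Opens) (i : V ≤ U) m n, rs i (f U m n) = f V (rs i m) (rs i n))
    (V : X.Opens) (m n) : (tmHom hf hn).app (op V) (tm M N V m n) = f V m n :=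
  tmLift_tm (hf V) _ _

/-- Families of linear maps compatible with restriction. -/
structure ModMap (M N : PMod X) where
  /-- The map on sections. -/
  app (V : X.Opens) : M.presheaf.obj (op V) →ₗ[Γ(X, V)] N.presheaf.obj (op V)
  rs_app {U V : X.Opens} (i : V ≤ U) (m : M.presheaf.obj (op U)) : rs i (app U m) = app V (rs i m)

/-- The tensor product of two families of linear maps. -/
def ModMap.tensor {M' N' : PMod X} (f : ModMap M M') (g : ModMap N N') :
    (tens M N).presheaf ⟶ (tens M' N').presheaf :=
  tmHom (f := fun V m n => tm M' N' V (f.app V m) (g.app V n))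
    (fun V => ⟨fun m m' n => by rw [(f.app V).map_add, (tm M' N' V).map_add, LinearMap.add_apply],
      fun m n n' => by rw [(g.app V).map_add, map_add],
      fun r m n => by rw [(f.app V).map_smul, (tm M' N' V).map_smul, LinearMap.smul_apply, (g.app V).map_smul, LinearMap.map_smul]⟩)
    (fun U V i m n => by rw [rs_tm, f.rs_app, g.rs_app])

/-- Tensor product of linear bijections. -/
lemma ModMap.tensor_bijective {M' N' : PMod X} (f : ModMap M M') (g : ModMap N N') (V : X.Opens)
    (hf : Function.Bijective (f.app V)) (hg : Function.Bijective (g.app V)) :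
    Function.Bijective ((f.tensor g).app (op V)) := by
  let e₁ : M.obj (op V) ≃ₗ[X.presheaf.obj (op V)] M'.obj (op V) :=
    LinearEquiv.ofBijective (f.app V) hf
  let e₂ : N.obj (op V) ≃ₗ[X.presheaf.obj (op V)] N'.obj (op V) :=
    LinearEquiv.ofBijective (g.app V) hg
  let e := TensorProduct.congr e₁ e₂
  have : ((f.tensor g).app (op V) : _ → _) = e := by
    funext z
    induction z using tm_induction with
    | zero => exact (map_zero _).trans (map_zero _).symm
    | add x y hx hy => exact (map_add _ _ _).trans ((congrArg₂ _ hx hy).trans (map_add _ _ _).symm)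
    | tmul m n => exact tmHom_tm _ _ V m n
  rw [this]
  exact e.bijective

/-- The canonical map to the associated sheaf of modules. -/
def toSheafifyMap (M : PMod X) : ModMap M (pm (sheafify M)) where
  app V := ((PresheafOfModules.sheafificationAdjunction (𝟙 X.ringCatSheaf.obj)).unit.app M).app (op V)|>.hom
  rs_app i m := rs_app (toSh M.presheaf) i m

end ModuleLayer

/-! ### Sections of the twisting sheaves as functions into the local rings of the cone. -/

section TwistSections

variable {A σ : Type} [CommRing A] [SetLike σ A] [AddSubgroupClass σ A] {𝒜 : ℕ → σ} [GradedRing 𝒜]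

/-- The localization map at a point of `Proj A`. -/
abbrev al (x : ProjectiveSpectrum 𝒜) : A →+* Loc 𝒜 x := algebraMap A (Loc 𝒜 x)

lemma isUnit_al {x : ProjectiveSpectrum 𝒜} {s : A} (hs : s ∉ x.asHomogeneousIdeal) :
    IsUnit (al x s) :=
  IsLocalization.map_units (M := x.asHomogeneousIdeal.toIdeal.primeCompl) _ ⟨s, hs⟩

/-- Fractions of every degree live in the same local ring, so all later identities are stated with
denominators cleared and proved by ring arithmetic. -/
lemma eq_mk_iff {x : ProjectiveSpectrum 𝒜} {r s : A} (hs : s ∉ x.asHomogeneousIdeal) (f : Loc 𝒜 x) :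
    f = Localization.mk r ⟨s, hs⟩ ↔ f * al x s = al x r := by
  rw [Localization.mk_eq_mk', IsLocalization.eq_mk'_iff_mul_eq]

lemma mem_twistSections_iff {n : ℤ} {V : Opens (ProjectiveSpectrum.top 𝒜)}
    {f : ∀ x : V, Loc 𝒜 x.1} :
    f ∈ twistSections 𝒜 n V ↔ ∀ x : V, ∃ (W : Opens (ProjectiveSpectrum.top 𝒜)) (h : W ≤ V),
      x.1 ∈ W ∧ ∃ (i j : ℕ) (r s : A), (i : ℤ) = j + n ∧ r ∈ 𝒜 i ∧ s ∈ 𝒜 j ∧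
        ∀ y : W, s ∉ y.1.asHomogeneousIdeal ∧ f ⟨y.1, h y.2⟩ * al y.1 s = al y.1 r := by
  refine isLocallyTwistedFraction_iff.trans (forall_congr' fun x => ⟨?_, ?_⟩)
  · rintro ⟨W, hx, i, a, b, hab, r, s, hs, h⟩
    exact ⟨W, i.le, hx, a, b, r, s, hab, r.2, s.2, fun y => ⟨hs y, (eq_mk_iff (hs y) _).1 (h y)⟩⟩
  · rintro ⟨W, i, hx, a, b, r, s, hab, hr, hs, h⟩
    exact ⟨W, hx, homOfLE i, a, b, hab, ⟨r, hr⟩, ⟨s, hs⟩, fun y => (h y).1,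
      fun y => (eq_mk_iff (h y).1 _).2 (h y).2⟩

variable {V : Opens (ProjectiveSpectrum.top 𝒜)}

/-- A section of `𝒪(b)` given by a fraction. -/
def twFrac {i j : ℕ} {b : ℤ} (hb : (i : ℤ) = j + b) {r s : A} (hr : r ∈ 𝒜 i) (hs : s ∈ 𝒜 j)
    (h : ∀ x ∈ V, s ∉ x.asHomogeneousIdeal) : twistSections 𝒜 b V :=
  ⟨fun x => Localization.mk r ⟨s, h x.1 x.2⟩, mem_twistSections_iff.2 fun x =>
    ⟨V, le_rfl, x.2, i, j, r, s, hb, hr, hs, fun y => ⟨h y.1 y.2, (eq_mk_iff (h y.1 y.2) _).1 rfl⟩⟩⟩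

lemma twFrac_mul_al {i j : ℕ} {b : ℤ} (hb : (i : ℤ) = j + b) {r s : A} (hr : r ∈ 𝒜 i) (hs : s ∈ 𝒜 j)
    (h : ∀ x ∈ V, s ∉ x.asHomogeneousIdeal) (x : V) :
    (twFrac hb hr hs h).1 x * al x.1 s = al x.1 r :=
  (eq_mk_iff (h x.1 x.2) _).1 rfl

/-- The product of sections of `𝒪(a)` and `𝒪(b)`. -/
def twMul {a b c : ℤ} (h : a + b = c) (f : twistSections 𝒜 a V) (g : twistSections 𝒜 b V) :
    twistSections 𝒜 c V :=
  ⟨fun x => f.1 x * g.1 x, mem_twistSections_iff.2 fun x => by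
    obtain ⟨W, i, hx, m, n, r, s, hab, hr, hs, H⟩ := mem_twistSections_iff.1 f.2 x
    obtain ⟨W', i', hx', m', n', r', s', hab', hr', hs', H'⟩ := mem_twistSections_iff.1 g.2 x
    refine ⟨W ⊓ W', inf_le_left.trans i, ⟨hx, hx'⟩, m + m', n + n', r * r', s * s', by
      push_cast; omega, SetLike.mul_mem_graded hr hr', SetLike.mul_mem_graded hs hs',
      fun y => ⟨mul_notMem _ (H ⟨y.1, y.2.1⟩).1 (H' ⟨y.1, y.2.2⟩).1, ?_⟩⟩
    rw [map_mul, map_mul, ← (H ⟨y.1, y.2.1⟩).2, ← (H' ⟨y.1, y.2.2⟩).2]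
    ring⟩

@[simp]
lemma twMul_apply {a b c : ℤ} (h : a + b = c) (f : twistSections 𝒜 a V) (g : twistSections 𝒜 b V)
    (x : V) : (twMul h f g).1 x = f.1 x * g.1 x := rfl

lemma tw_ext {b : ℤ} {f g : twistSections 𝒜 b V} (h : ∀ x, f.1 x = g.1 x) : f = g :=
  Subtype.ext (funext h)

variable (𝒜) in
/-- The ring of regular functions on an open set. -/
abbrev Reg (V : Opens (ProjectiveSpectrum.top 𝒜)) : Type :=
  (ProjectiveSpectrum.Proj.structureSheaf 𝒜).1.obj (op V)

/-- The module structure on sections of twisting sheaves. -/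
abbrev twModule (U : (Proj 𝒜).Opens) (b : ℤ) : Module Γ(Proj 𝒜, U) (twistSections 𝒜 b U) :=
  inferInstance

instance (b : ℤ) : Module (Reg 𝒜 V) (twistSections 𝒜 b V) := twModule V b

variable (𝒜) in
/-- The homogeneous localization at a point. -/
abbrev HLoc (x : ProjectiveSpectrum 𝒜) : Type :=
  HomogeneousLocalization.AtPrime 𝒜 x.asHomogeneousIdeal.toIdeal

/-- A fraction in the homogeneous localization. -/
abbrev hmk (x : ProjectiveSpectrum 𝒜) {n : ℕ} (r s : 𝒜 n) (hs : s.1 ∉ x.asHomogeneousIdeal) : HLoc 𝒜 x :=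
  HomogeneousLocalization.mk ⟨n, r, s, hs⟩

lemma val_hmk (x : ProjectiveSpectrum 𝒜) {n : ℕ} (r s : 𝒜 n) (hs : s.1 ∉ x.asHomogeneousIdeal) :
    (hmk x r s hs).val = Localization.mk r.1 ⟨s.1, hs⟩ := rfl

/-- The value of a regular function at a point, as an element of the local ring. -/
abbrev fval (a : Reg 𝒜 V) (x : V) : Loc 𝒜 x.1 := (a.1 x).val

lemma smul_apply {b : ℤ} (a : Reg 𝒜 V) (f : twistSections 𝒜 b V) (x : V) :
    (a • f).1 x = fval a x * f.1 x := rfl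

lemma fval_ext {a a' : Reg 𝒜 V} (h : ∀ x, fval a x = fval a' x) : a = a' :=
  Subtype.ext (funext fun x => HomogeneousLocalization.val_injective _ (h x))

lemma fval_mul (a a' : Reg 𝒜 V) (x : V) :
    fval (a * a') x = fval a x * fval a' x := HomogeneousLocalization.val_mul _ _

lemma fval_add (a a' : Reg 𝒜 V) (x : V) :
    fval (a + a') x = fval a x + fval a' x := HomogeneousLocalization.val_add _ _

lemma fval_one (x : V) :
    fval (1 : Reg 𝒜 V) x = 1 := HomogeneousLocalization.val_one

lemma fval_zero (x : V) :
    fval (0 : Reg 𝒜 V) x = 0 := HomogeneousLocalization.val_zero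

/-- Regular functions are sections of `𝒪(0)`. -/
def toTw (a : Reg 𝒜 V) : twistSections 𝒜 0 V :=
  ⟨fun x => fval a x, isLocallyTwistedFraction_iff.2 fun x => by
    obtain ⟨W, hx, i, n, r, s, hs, h⟩ := a.2 x
    exact ⟨W, hx, i, n, n, by simp, r, s, hs,
      fun y => (congrArg HomogeneousLocalization.val (h y)).trans (HomogeneousLocalization.val_mk _)⟩⟩

lemma exists_fval (f : twistSections 𝒜 0 V) :
    ∃ a : Reg 𝒜 V, ∀ x, fval a x = f.1 x := by
  have H := isLocallyTwistedFraction_iff.1 f.2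
  have h0 : ∀ x : V, ∃ h : HLoc 𝒜 x.1,
      h.val = f.1 x := by
    intro x
    obtain ⟨W, hx, i, m, n, hmn, r, s, hs, h⟩ := H x
    obtain rfl : m = n := by omega
    exact ⟨hmk x.1 r s (hs ⟨x, hx⟩), (val_hmk _ _ _ _).trans (h ⟨x, hx⟩).symm⟩
  choose v hv using h0
  refine ⟨⟨v, fun x => ?_⟩, hv⟩
  obtain ⟨W, hx, i, m, n, hmn, r, s, hs, h⟩ := H x
  obtain rfl : m = n := by omega
  exact ⟨W, hx, i, m, r, s, hs, fun y => HomogeneousLocalization.val_injective _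
    ((hv (i y)).trans ((h y).trans (val_hmk y.1 r s (hs y)).symm))⟩

/-- The section `t ^ m` of `𝒪(m)`, where `t` is a form of degree one which vanishes nowhere. -/
def twPow {t : A} (ht : t ∈ 𝒜 1) (m : ℤ) (h : ∀ x ∈ V, t ∉ x.asHomogeneousIdeal) :
    twistSections 𝒜 m V :=
  twFrac (i := m.toNat) (j := (-m).toNat) (by omega)
    (by simpa using SetLike.pow_mem_graded m.toNat ht)
    (by simpa using SetLike.pow_mem_graded (-m).toNat ht)
    fun x hx h' => h x hx (x.isPrime.mem_of_pow_mem _ h')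

lemma twPow_mul_twPow {t : A} (ht : t ∈ 𝒜 1) {a b c : ℤ} (hc : a + b = c)
    (h : ∀ x ∈ V, t ∉ x.asHomogeneousIdeal) :
    twMul hc (twPow ht a h) (twPow ht b h) = twPow ht c h := by
  refine tw_ext fun x => ?_
  have hu (n : ℕ) : IsUnit (al x.1 (t ^ n)) := by
    rw [map_pow]; exact (isUnit_al (h x.1 x.2)).pow n
  have h₁ : (twPow ht a h).1 x * al x.1 (t ^ (-a).toNat) = al x.1 (t ^ a.toNat) := twFrac_mul_al _ _ _ _ x
  have h₂ : (twPow ht b h).1 x * al x.1 (t ^ (-b).toNat) = al x.1 (t ^ b.toNat) := twFrac_mul_al _ _ _ _ x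
  have h₃ : (twPow ht c h).1 x * al x.1 (t ^ (-c).toNat) = al x.1 (t ^ c.toNat) := twFrac_mul_al _ _ _ _ x
  apply (hu ((-a).toNat + (-b).toNat + (-c).toNat)).mul_left_injective
  -- An integer is the difference of its positive and negative parts; this is a + b = c with all
  -- terms moved to the side where they are natural numbers.
  have e : c.toNat + (-a).toNat + (-b).toNat = a.toNat + b.toNat + (-c).toNat := by omega
  have e' := congrArg (fun n => al x.1 (t ^ n)) e
  simp only [pow_add, map_mul, twMul_apply] at e' ⊢
  linear_combination al x.1 (t ^ (-c).toNat) * ((twPow ht b h).1 x * al x.1 (t ^ (-b).toNat) * h₁ +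
    al x.1 (t ^ a.toNat) * h₂) - al x.1 (t ^ (-a).toNat) * al x.1 (t ^ (-b).toNat) * h₃ - e'

lemma twPow_zero {t : A} (ht : t ∈ 𝒜 1) (h : ∀ x ∈ V, t ∉ x.asHomogeneousIdeal) (x : V) :
    (twPow ht 0 h).1 x = 1 := by
  have : (twPow ht 0 h).1 x * al x.1 (t ^ 0) = al x.1 (t ^ 0) := twFrac_mul_al _ _ _ _ x
  rwa [pow_zero, map_one, mul_one] at this

lemma twPow_one {t : A} (ht : t ∈ 𝒜 1) (h : ∀ x ∈ V, t ∉ x.asHomogeneousIdeal) (x : V) :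
    (twPow ht 1 h).1 x = al x.1 t := by
  have : (twPow ht 1 h).1 x * al x.1 (t ^ 0) = al x.1 (t ^ 1) := twFrac_mul_al _ _ _ _ x
  simpa using this

lemma twPow_mul_cancel {t : A} (ht : t ∈ 𝒜 1) {a b : ℤ} (hc : a + b = 0)
    (h : ∀ x ∈ V, t ∉ x.asHomogeneousIdeal) (x : V) :
    (twPow ht a h).1 x * (twPow ht b h).1 x = 1 := by
  rw [← twPow_zero ht h x, ← twPow_mul_twPow ht hc h, twMul_apply]

/-- Trivialization of `𝒪(b)` where a linear form does not vanish. -/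
lemma exists_smul_twPow {t : A} (ht : t ∈ 𝒜 1) {b : ℤ}
    (h : ∀ x ∈ V, t ∉ x.asHomogeneousIdeal) (f : twistSections 𝒜 b V) :
    ∃! a : Reg 𝒜 V, a • twPow ht b h = f := by
  obtain ⟨a, ha⟩ := exists_fval (twMul (by omega : b + -b = 0) f (twPow ht (-b) h))
  refine ⟨a, tw_ext fun x => ?_, fun a' ha' => fval_ext fun x => ?_⟩
  · rw [smul_apply, ha, twMul_apply, mul_assoc, twPow_mul_cancel ht (by omega) h, mul_one]
  · rw [ha, twMul_apply, ← ha', smul_apply, mul_assoc, twPow_mul_cancel ht (by omega) h, mul_one]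

/-- Sections of the structure sheaf over a principal open set are fractions. -/
lemma exists_fval_mul_pow {f : A} {m : ℕ} (hf : f ∈ 𝒜 m) (hm : 0 < m)
    (a : Reg 𝒜 (ProjectiveSpectrum.basicOpen 𝒜 f)) :
    ∃ (n : ℕ) (r : A), r ∈ 𝒜 (n * m) ∧ ∀ x, fval a x * al x.1 (f ^ n) = al x.1 r := by
  have hbij : Function.Bijective (Proj.awayToSection 𝒜 f) :=
    ConcreteCategory.bijective_of_isIso (Proj.basicOpenIsoAway 𝒜 f hf hm).hom
  obtain ⟨z, rfl⟩ := hbij.2 a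
  obtain ⟨n, r, hr, rfl⟩ := HomogeneousLocalization.Away.mk_surjective 𝒜 hf z
  refine ⟨n, r, by simpa using hr, fun x => ?_⟩
  have hx : f ∉ x.1.asHomogeneousIdeal := x.2
  have hx' : f ^ n ∉ x.1.asHomogeneousIdeal := fun h' => hx (x.1.isPrime.mem_of_pow_mem _ h')
  refine (eq_mk_iff hx' _).1 ?_
  refine (ProjectiveSpectrum.Proj.awayToSection_apply 𝒜 f _ x).trans ?_
  rw [HomogeneousLocalization.Away.val_mk, Localization.mk_eq_mk', IsLocalization.map_mk',
    Localization.mk_eq_mk']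
  rfl

end TwistSections

/-! ### Sheaves of modules on affine open sets. -/

section AffineVanishing

variable {X : Scheme.{0}}

/-- The underlying abelian sheaf of a sheaf of modules. -/
abbrev abSh (F : X.Modules) : AbSheaf X := (SheafOfModules.toSheaf X.ringCatSheaf).obj F

/-- Sections over distinguished open subsets of `U` extend to `U` after multiplication with a power
of the function. -/
def Extends (F : PMod X) (U : X.Opens) : Prop :=
  ∀ (f : Γ(X, U)) (s : F.presheaf.obj (op (X.basicOpen f))), ∃ (n : ℕ) (t : F.presheaf.obj (op U)),
    rs (X.basicOpen_le f) t = rr (X.basicOpen_le f) (f ^ n) • s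

/-- A prime containing `I` but not `f` would be a point of `D(f)` that lies in no `D(g)` with `g` in
`I`; so `f` lies in every prime containing `I`. -/
lemma exists_pow_mem_of_basicOpen {U : X.Opens} (hU : IsAffineOpen U) (f : Γ(X, U))
    (I : Ideal Γ(X, U)) (h : ∀ x ∈ X.basicOpen f, ∃ g ∈ I, x ∈ X.basicOpen g) : ∃ n, f ^ n ∈ I := by
  have : f ∈ I.radical := by
    rw [Ideal.radical_eq_sInf, Ideal.mem_sInf]
    rintro p ⟨hp, hprime⟩
    by_contra hf
    have key (g : Γ(X, U)) : hU.fromSpec ⟨p, hprime⟩ ∈ X.basicOpen g ↔ g ∉ p := by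
      change (⟨p, hprime⟩ : PrimeSpectrum _) ∈ hU.fromSpec ⁻¹ᵁ X.basicOpen g ↔ _
      rw [hU.fromSpec_preimage_basicOpen]
      rfl
    obtain ⟨g, hg, hx⟩ := h _ ((key f).2 hf)
    exact (key g).1 hx (hp hg)
  exact this

lemma isUnit_rr {U V : X.Opens} (f : Γ(X, U)) (i : V ≤ U) (h : V ≤ X.basicOpen f) :
    IsUnit (rr i f) := by
  have h1 : IsUnit (rr (X.basicOpen_le f) f) := X.toRingedSpace.isUnit_res_basicOpen f
  have h2 := h1.map (rr h)
  rwa [rr_rr] at h2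

/-- A partition of unity: (fg)^n s extends to some t over U, and h^m = α f^n + β g^n. Then s is the
sum of βt / (h^m f^n), defined on D(f), and αt / (h^m g^n), defined on D(g), because `h` is
invertible on both sets. -/
lemma exists_eq_sub_of_extends {F : PMod X} {U : X.Opens} (hU : IsAffineOpen U) (hF : Extends F U)
    (f g h : Γ(X, U)) (hfg : X.basicOpen h = X.basicOpen f ⊔ X.basicOpen g)
    (s : F.presheaf.obj (op (X.basicOpen f ⊓ X.basicOpen g))) :
    ∃ (a : F.presheaf.obj (op (X.basicOpen f))) (b : F.presheaf.obj (op (X.basicOpen g))),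
        s = rs inf_le_left a - rs inf_le_right b := by
  have hle : X.basicOpen f ⊓ X.basicOpen g ≤ U := inf_le_left.trans (X.basicOpen_le f)
  obtain ⟨n, hn, t, ht⟩ : ∃ (n : ℕ) (_ : 0 < n) (t : F.presheaf.obj (op U)),
      rs hle t = rr hle ((f * g) ^ n) • s := by
    have e := X.basicOpen_mul f g
    obtain ⟨n, t, ht⟩ := hF (f * g) (rs e.le s)
    -- The exponent is made positive so that f^n and g^n have the same principal open sets as f and
    -- g.
    refine ⟨n + 1, by omega, (f * g) • t, ?_⟩
    have := congrArg (rs e.ge) ht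
    rw [rs_rs, rs_smul, rs_rs, rs_rfl] at this
    rw [rs_smul, this, smul_smul, rr_rr, ← map_mul, pow_succ']
  obtain ⟨m, hm⟩ := exists_pow_mem_of_basicOpen hU h (Ideal.span {f ^ n, g ^ n}) (by
    intro x hx
    rw [hfg] at hx
    rcases hx with hx | hx
    · exact ⟨f ^ n, Ideal.subset_span (by simp), by rwa [X.basicOpen_pow f hn]⟩
    · exact ⟨g ^ n, Ideal.subset_span (by simp), by rwa [X.basicOpen_pow g hn]⟩)
  obtain ⟨α, β, hαβ⟩ := Ideal.mem_span_pair.1 hm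
  obtain ⟨p, hp⟩ := (((isUnit_rr h (X.basicOpen_le f) (hfg ▸ le_sup_left)).pow m).mul
    ((isUnit_rr f (X.basicOpen_le f) le_rfl).pow n)).exists_left_inv
  obtain ⟨q, hq⟩ := (((isUnit_rr h (X.basicOpen_le g) (hfg ▸ le_sup_right)).pow m).mul
    ((isUnit_rr g (X.basicOpen_le g) le_rfl).pow n)).exists_left_inv
  refine ⟨p • rs (X.basicOpen_le f) (β • t), (-q) • rs (X.basicOpen_le g) (α • t), ?_⟩
  have hp' := congrArg (rr (inf_le_left : X.basicOpen f ⊓ X.basicOpen g ≤ _)) hp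
  have hq' := congrArg (rr (inf_le_right : X.basicOpen f ⊓ X.basicOpen g ≤ _)) hq
  have hαβ' := congrArg (rr hle) hαβ
  simp only [map_mul, map_pow, rr_rr, map_one, map_add] at hp' hq' hαβ'
  simp only [rs_smul, rs_rs, ht, smul_smul, ← sub_smul]
  refine (one_smul Γ(X, X.basicOpen f ⊓ X.basicOpen g) s).symm.trans (congrArg (· • s) ?_)
  simp only [map_mul, map_pow, map_neg, rr_rr]
  linear_combination -(rr inf_le_left p * rr hle f ^ n) * hαβ' - hp' -
    rr hle α * rr hle f ^ n * (- (rr inf_le_right q * rr hle g ^ n) * hp' +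
      rr inf_le_left p * rr hle f ^ n * hq')

/-- The coefficient `a` is a fraction with denominator a power of `f`, and that power also clears
the denominator of the section. -/
lemma Extends.of_generated {M : PMod X} {U : X.Opens} (hU : IsAffineOpen U)
    (h : ∀ (f : Γ(X, U)) (s : M.presheaf.obj (op (X.basicOpen f))),
      ∃ (a : Γ(X, X.basicOpen f)) (e : M.presheaf.obj (op U)), s = a • rs (X.basicOpen_le f) e) :
    Extends M U := by
  intro f s
  obtain ⟨a, e, rfl⟩ := h f s
  have := hU.isLocalization_basicOpen f
  obtain ⟨⟨a', ⟨_, n, rfl⟩⟩, ha'⟩ :=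
    IsLocalization.surj (Submonoid.powers f) (S := Γ(X, X.basicOpen f)) a
  refine ⟨n, a' • e, ?_⟩
  have ha'' : rr (X.basicOpen_le f) a' = a * rr (X.basicOpen_le f) (f ^ n) := ha'.symm
  rw [rs_smul, ha'', mul_comm, mul_smul]

lemma Extends.pushforward {Y : Scheme.{0}} (i : Y ⟶ X) {G : Y.Modules} {U : X.Opens}
    (h : Extends (pm G) (i ⁻¹ᵁ U)) : Extends (pm ((Scheme.Modules.pushforward i).obj G)) U := by
  intro f s
  have e : i ⁻¹ᵁ (X.basicOpen f) = Y.basicOpen (i.app U f) := Scheme.preimage_basicOpen i f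
  let s' : (pm G).presheaf.obj (op (i ⁻¹ᵁ X.basicOpen f)) := s
  obtain ⟨n, t, ht⟩ := h (i.app U f) (rs (F := (pm G).presheaf) e.ge s')
  refine ⟨n, t, ?_⟩
  have := congrArg (rs (F := (pm G).presheaf) e.le) ht
  rw [rs_rs, rs_smul, rs_rs, rs_rfl, rr_rr] at this
  refine Eq.trans this ?_
  change _ = (i.app _ (rr (X.basicOpen_le f) (f ^ n))) • s'
  congr 1
  rw [← map_pow]
  exact (congr($(i.naturality (homOfLE (X.basicOpen_le f)).op) (f ^ n))).symm

/-- The principal open subsets of `U` satisfy the axioms of `subsingleton_HU_of_ring`; the extension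
property supplies the splitting of sections. -/
theorem subsingleton_HU_of_extends {F : X.Modules} {U : X.Opens} (hU : IsAffineOpen U)
    (hF : Extends (pm F) U) (n : ℕ) : Subsingleton (HU (abSh F) (n + 1) U) := by
  have := subsingleton_HU_of_ring (F := abSh F) (fun f : Γ(X, U) => X.basicOpen f)
    (X.basicOpen_zero U) (X.basicOpen_mul) (fun f g => X.basicOpen_add_le f g) ?_
    (fun f I => exists_pow_mem_of_basicOpen hU f I) ?_
    (fun f g h hfg s => exists_eq_sub_of_extends hU hF f g h hfg s) n 1
  · rwa [X.basicOpen_one] at this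
  · intro f V x hx hV
    obtain ⟨g, hg, hxg⟩ := hU.exists_basicOpen_le ⟨x, hV⟩ (X.basicOpen_le f hx)
    exact ⟨g, hxg, hg⟩
  · intro f n
    rcases Nat.eq_zero_or_pos n with rfl | h
    · rw [pow_zero, X.basicOpen_one]; exact X.basicOpen_le f
    · rw [X.basicOpen_pow f h]

end AffineVanishing

section TwistVanishing

variable {A σ : Type} [CommRing A] [SetLike σ A] [AddSubgroupClass σ A] {𝒜 : ℕ → σ} [GradedRing 𝒜]

lemma extends_twist {t : A} (ht : t ∈ 𝒜 1) (b : ℤ) {U : (Proj 𝒜).Opens} (hU : IsAffineOpen U)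
    (h : ∀ x : ProjectiveSpectrum 𝒜, x ∈ (show Opens (ProjectiveSpectrum.top 𝒜) from U) → t ∉ x.asHomogeneousIdeal) :
    Extends (pm (twist 𝒜 b)) U := by
  refine Extends.of_generated hU fun f s => ?_
  obtain ⟨a, ha, -⟩ := exists_smul_twPow (V := (show Opens (ProjectiveSpectrum.top 𝒜) from
    (Proj 𝒜).basicOpen f)) ht (b := b) (fun x hx => h x ((Proj 𝒜).basicOpen_le f hx)) s
  exact ⟨a, twPow (V := (show Opens (ProjectiveSpectrum.top 𝒜) from U)) ht b h, ha.symm⟩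

end TwistVanishing

/-! ### Division of forms by powers of the variables. -/

section Polynomials

open MvPolynomial

variable {σ : Type} {R : Type} [CommRing R]

lemma isHomogeneous_divMonomial {p : MvPolynomial σ R} {i j k : ℕ} (hp : p.IsHomogeneous i)
    (a : σ) (h : k + j = i) : (p.divMonomial (Finsupp.single a k)).IsHomogeneous j := by
  intro m hm
  rw [coeff_divMonomial] at hm
  have := hp hm
  rw [map_add, Finsupp.weight_single] at this
  simp at this
  omega

lemma isHomogeneous_modMonomial {p : MvPolynomial σ R} {i : ℕ} (hp : p.IsHomogeneous i)
    (s : σ →₀ ℕ) : (p.modMonomial s).IsHomogeneous i := by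
  intro m hm
  by_cases h : s ≤ m
  · exact absurd (coeff_modMonomial_of_le _ h) hm
  · rw [coeff_modMonomial_of_not_le _ h] at hm
    exact hp hm

/-- A form none of whose monomials survives modulo `a ^ n` and `b ^ n`. -/
lemma exists_eq_add_mul_pow {p : MvPolynomial σ R} {n i j : ℕ} (hp : p.IsHomogeneous i)
    (hij : n + j = i) (a b : σ) (h : ∀ m, m a < n → m b < n → coeff m p = 0) :
    ∃ u v : MvPolynomial σ R, u.IsHomogeneous j ∧ v.IsHomogeneous j ∧
      p = X a ^ n * u + X b ^ n * v := by
  refine ⟨p.divMonomial (Finsupp.single a n),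
    (p.modMonomial (Finsupp.single a n)).divMonomial (Finsupp.single b n),
    isHomogeneous_divMonomial hp a hij,
    isHomogeneous_divMonomial (isHomogeneous_modMonomial hp _) b hij, ?_⟩
  have h1 := divMonomial_add_modMonomial p (Finsupp.single a n)
  have h2 := divMonomial_add_modMonomial (p.modMonomial (Finsupp.single a n)) (Finsupp.single b n)
  have h3 : (p.modMonomial (Finsupp.single a n)).modMonomial (Finsupp.single b n) = 0 := by
    ext m
    rw [coeff_zero]
    by_cases hb : Finsupp.single b n ≤ m
    · exact coeff_modMonomial_of_le _ hb
    rw [coeff_modMonomial_of_not_le _ hb]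
    by_cases ha : Finsupp.single a n ≤ m
    · exact coeff_modMonomial_of_le _ ha
    rw [coeff_modMonomial_of_not_le _ ha]
    rw [Finsupp.single_le_iff] at ha hb
    exact h m (by omega) (by omega)
  rw [h3, add_zero] at h2
  rw [X_pow_eq_monomial, X_pow_eq_monomial, h2, h1]

lemma coeff_mul_X_pow_eq_zero (p : MvPolynomial σ R) {n : ℕ} {a : σ} {m : σ →₀ ℕ} (h : m a < n) :
    coeff m (p * X a ^ n) = 0 := by
  rw [X_pow_eq_monomial, coeff_mul_monomial', if_neg]
  rw [Finsupp.single_le_iff]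
  omega

/-- A monomial of `p` with both exponents at `a` and `b` below `n` would survive in p X_c^n with
these exponents unchanged, but no such monomial occurs on the right-hand side. -/
lemma exists_eq_add_of_cocycle {p q r : MvPolynomial σ R} {n i j : ℕ} (hp : p.IsHomogeneous i)
    (hij : n + j = i) {a b c : σ} (hac : a ≠ c) (hbc : b ≠ c)
    (h : p * X c ^ n = q * X b ^ n - r * X a ^ n) :
    ∃ u v : MvPolynomial σ R, u.IsHomogeneous j ∧ v.IsHomogeneous j ∧
      p = X a ^ n * u + X b ^ n * v := by
  refine exists_eq_add_mul_pow hp hij a b fun m ha hb => ?_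
  have h1 : coeff (m + Finsupp.single c n) (p * X c ^ n) = coeff m p := by
    rw [X_pow_eq_monomial, coeff_mul_monomial, mul_one]
  rw [← h1, h, coeff_sub, coeff_mul_X_pow_eq_zero, coeff_mul_X_pow_eq_zero, sub_zero]
  · simpa [Finsupp.single_apply, hac.symm] using ha
  · simpa [Finsupp.single_apply, hbc.symm] using hb

lemma exists_eq_mul_of_mul_eq {q r : MvPolynomial σ R} {n i j : ℕ} (hq : q.IsHomogeneous i)
    (hij : n + j = i) {a b : σ} (hab : a ≠ b) (h : q * X b ^ n = r * X a ^ n) :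
    ∃ u : MvPolynomial σ R, u.IsHomogeneous j ∧ q = X a ^ n * u := by
  obtain ⟨u, v, hu, hv, e⟩ := exists_eq_add_mul_pow (p := q) hq hij a a (fun m ha _ => by
    have h1 : coeff (m + Finsupp.single b n) (q * X b ^ n) = coeff m q := by
      rw [X_pow_eq_monomial, coeff_mul_monomial, mul_one]
    rw [← h1, h, coeff_mul_X_pow_eq_zero]
    simpa [Finsupp.single_apply, hab.symm] using ha)
  exact ⟨u + v, hu.add hv, by rw [e]; ring⟩

/-- A monomial with all three exponents at most n - 1 has degree at most 3n - 3, which is less than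
i; hence some exponent is at least n. This bound is the source of b > -3 in the vanishing of H². -/
lemma exists_eq_add_three {p : MvPolynomial (Fin 3) R} {n i j : ℕ} (hp : p.IsHomogeneous i)
    (hij : n + j = i) (hi : 3 * n < i + 3) :
    ∃ u v w : MvPolynomial (Fin 3) R, u.IsHomogeneous j ∧ v.IsHomogeneous j ∧ w.IsHomogeneous j ∧
      p = X 0 ^ n * u + X 1 ^ n * v + X 2 ^ n * w := by
  have h1 := divMonomial_add_modMonomial p (Finsupp.single 2 n)
  obtain ⟨u, v, hu, hv, e⟩ := exists_eq_add_mul_pow (p := p.modMonomial (Finsupp.single 2 n))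
    (isHomogeneous_modMonomial hp _) hij 0 1 (fun m h0 h1 => by
      by_cases h2 : Finsupp.single 2 n ≤ m
      · exact coeff_modMonomial_of_le _ h2
      rw [coeff_modMonomial_of_not_le _ h2]
      rw [Finsupp.single_le_iff] at h2
      by_contra hne
      have := hp hne
      rw [Finsupp.weight_apply, Finsupp.sum_fintype _ _ (by simp)] at this
      simp [Fin.sum_univ_three] at this
      omega)
  refine ⟨u, v, _, hu, hv, isHomogeneous_divMonomial hp 2 hij, ?_⟩
  rw [← e, X_pow_eq_monomial, add_comm, h1]

end Polynomials

/-! ### Sections over principal open sets with a prescribed power as denominator. -/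

section Sections

variable {A σ : Type} [CommRing A] [SetLike σ A] [AddSubgroupClass σ A] {𝒜 : ℕ → σ} [GradedRing 𝒜]

/-- Sections of `𝒪(b)` over a principal open set are fractions. -/
lemma exists_mul_pow_eq {t c : A} {k : ℕ} (ht : t ∈ 𝒜 1) (hc : c ∈ 𝒜 k) {b : ℤ}
    {W : Opens (ProjectiveSpectrum.top 𝒜)} (hW : W = ProjectiveSpectrum.basicOpen 𝒜 (t * c))
    (s : twistSections 𝒜 b W) :
    ∃ n₀ : ℕ, ∀ n ≥ n₀, ∃ (i : ℕ) (r : A), (i : ℤ) = n * (k + 1) + b ∧ r ∈ 𝒜 i ∧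
      ∀ x : W, s.1 x * al x.1 ((t * c) ^ n) = al x.1 r := by
  have htc : t * c ∈ 𝒜 (1 + k) := SetLike.mul_mem_graded ht hc
  have hx (x : W) : t ∉ x.1.asHomogeneousIdeal :=
    fun h => (show x.1 ∈ ProjectiveSpectrum.basicOpen 𝒜 (t * c) from hW ▸ x.2) (x.1.asHomogeneousIdeal.toIdeal.mul_mem_right _ h)
  obtain ⟨a, rfl, -⟩ := exists_smul_twPow ht (b := b) (fun x h => hx ⟨x, h⟩) s
  obtain ⟨n, r, hr, H⟩ : ∃ (n : ℕ) (r : A), r ∈ 𝒜 (n * (1 + k)) ∧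
      ∀ x, fval a x * al x.1 ((t * c) ^ n) = al x.1 r := by
    clear hx
    subst hW
    exact exists_fval_mul_pow htc (by omega) a
  -- The extra |b| factors of the denominator make t^b polynomial. Allowing every larger exponent
  -- lets several sections share one denominator.
  refine ⟨n + b.natAbs, fun N hN => ?_⟩
  obtain ⟨d, rfl⟩ := Nat.exists_eq_add_of_le hN
  refine ⟨n * (1 + k) + ((b + b.natAbs).toNat * 1 + b.natAbs * k) + d * (1 + k),
    r * (t ^ (b + b.natAbs).toNat * c ^ b.natAbs) * (t * c) ^ d, ?_, ?_, fun x => ?_⟩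
  · have e : ((b + b.natAbs).toNat : ℤ) = b + b.natAbs := Int.toNat_of_nonneg (by omega)
    push_cast [-Int.natCast_natAbs]
    rw [e]
    ring
  · exact SetLike.mul_mem_graded (SetLike.mul_mem_graded hr (SetLike.mul_mem_graded
      (SetLike.pow_mem_graded _ ht) (SetLike.pow_mem_graded _ hc))) (SetLike.pow_mem_graded _ htc)
  · have h₁ : (twPow ht b (fun x h => hx ⟨x, h⟩)).1 x * al x.1 (t ^ (-b).toNat) = al x.1 (t ^ b.toNat) :=
      twFrac_mul_al _ _ _ _ x
    have h₂ : (twPow ht b (fun x h => hx ⟨x, h⟩)).1 x * al x.1 (t ^ b.natAbs) =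
        al x.1 (t ^ (b + b.natAbs).toNat) := by
      have e₁ : b.natAbs = (-b).toNat + b.toNat := by omega
      have e₂ : (b + b.natAbs).toNat = b.toNat + b.toNat := by omega
      rw [e₂, e₁, pow_add, pow_add, map_mul, map_mul, ← mul_assoc, h₁]
    rw [smul_apply]
    have h₃ := H x
    rw [pow_add, pow_add, map_mul, map_mul, mul_pow t c b.natAbs, map_mul, map_mul, map_mul, map_mul, ← h₂, ← h₃]
    ring

end Sections

open MvPolynomial

section Domain

variable {n : ℕ}

lemma al_injective (x : ProjectiveSpectrum (grading n)) : Function.Injective (al x) :=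
  IsLocalization.injective (Loc (grading n) x)
    (Ideal.primeCompl_le_nonZeroDivisors x.asHomogeneousIdeal.toIdeal)

lemma notMem_genericPt {f : MvPolynomial (Fin (n + 1)) ℂ} (hf : f ≠ 0) :
    f ∉ ProjectiveSpectrum.asHomogeneousIdeal (𝒜 := grading (n + 1)) (genericPt n) := hf

lemma X_mem_grading (j : Fin n) : (X j : MvPolynomial (Fin n) ℂ) ∈ grading n 1 :=
  isHomogeneous_X _ _

end Domain

/-! ### Čech cocycles of twisting sheaves on the plane. -/

section Plane

variable {b : ℤ} {W₁ W₂ W₃ : Opens (ProjectiveSpectrum.top (grading 3))}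

lemma inf_eq_basicOpen {W W' : Opens (ProjectiveSpectrum.top (grading 3))}
    {f g : MvPolynomial (Fin 3) ℂ} (h : W = ProjectiveSpectrum.basicOpen (grading 3) f)
    (h' : W' = ProjectiveSpectrum.basicOpen (grading 3) g) :
    W ⊓ W' = ProjectiveSpectrum.basicOpen (grading 3) (f * g) := by
  subst h h'
  exact (ProjectiveSpectrum.basicOpen_mul _ _ _).symm

/-- A presentation of a section over the intersection of two standard open sets. -/
lemma exists_mul_pow_eq_two {i j : Fin 3} {W : Opens (ProjectiveSpectrum.top (grading 3))}
    (hW : W = ProjectiveSpectrum.basicOpen (grading 3) (X i * X j)) (s : twistSections (grading 3) b W) :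
    ∃ n₀ : ℕ, ∀ n ≥ n₀, ∃ (m : ℕ) (r : MvPolynomial (Fin 3) ℂ), (m : ℤ) = 2 * n + b ∧
      r.IsHomogeneous m ∧ ∀ x : W, s.1 x * al x.1 ((X i * X j) ^ n) = al x.1 r := by
  obtain ⟨n₀, h⟩ := exists_mul_pow_eq (X_mem_grading i) (X_mem_grading j) hW s
  refine ⟨n₀, fun n hn => ?_⟩
  obtain ⟨m, r, hm, hr, H⟩ := h n hn
  exact ⟨m, r, by rw [hm]; push_cast; ring, hr, H⟩

/-- With a common exponent, α = p / (z_0 z_1)^n and the cocycle condition reads p z_2^n = q z_1^n -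
r z_0^n. Then p = z_0^n u + z_1^n v, so α is the difference of v / z_0^n and -u / z_1^n. -/
lemma exists_splitting (h₁ : W₁ = ProjectiveSpectrum.basicOpen (grading 3) (X 0))
    (h₂ : W₂ = ProjectiveSpectrum.basicOpen (grading 3) (X 1))
    (h₃ : W₃ = ProjectiveSpectrum.basicOpen (grading 3) (X 2))
    (α : twistSections (grading 3) b (W₁ ⊓ W₂)) (β : twistSections (grading 3) b (W₁ ⊓ W₃))
    (γ : twistSections (grading 3) b (W₂ ⊓ W₃))
    (h : ∀ x (m₁ : x ∈ W₁) (m₂ : x ∈ W₂) (m₃ : x ∈ W₃),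
      α.1 ⟨x, m₁, m₂⟩ = β.1 ⟨x, m₁, m₃⟩ - γ.1 ⟨x, m₂, m₃⟩) :
    ∃ (s : twistSections (grading 3) b W₁) (t : twistSections (grading 3) b W₂),
      ∀ x (m₁ : x ∈ W₁) (m₂ : x ∈ W₂), α.1 ⟨x, m₁, m₂⟩ = s.1 ⟨x, m₁⟩ - t.1 ⟨x, m₂⟩ := by
  obtain ⟨n₁, H₁⟩ := exists_mul_pow_eq_two (i := 0) (j := 1)
    (inf_eq_basicOpen h₁ h₂) α
  obtain ⟨n₂, H₂⟩ := exists_mul_pow_eq_two (i := 0) (j := 2)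
    (inf_eq_basicOpen h₁ h₃) β
  obtain ⟨n₃, H₃⟩ := exists_mul_pow_eq_two (i := 1) (j := 2)
    (inf_eq_basicOpen h₂ h₃) γ
  -- The summand |b| ensures n ≤ 2n + b, so that `u` and `v` have the honest degree m - n.
  set n := n₁ + n₂ + n₃ + b.natAbs
  obtain ⟨m, p, hm, hp, Hp⟩ := H₁ n (by omega)
  obtain ⟨-, q, -, -, Hq⟩ := H₂ n (by omega)
  obtain ⟨-, r, -, -, Hr⟩ := H₃ n (by omega)
  -- The identity is read at the generic point: it lies in all three open sets, and the polynomial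
  -- ring embeds in its local ring.
  have hpoly : p * X 2 ^ n = q * X 1 ^ n - r * X 0 ^ n := by
    let η : ProjectiveSpectrum (grading 3) := genericPt 2
    have e₁ : η ∈ W₁ := by rw [h₁]; exact notMem_genericPt (X_ne_zero 0)
    have e₂ : η ∈ W₂ := by rw [h₂]; exact notMem_genericPt (X_ne_zero 1)
    have e₃ : η ∈ W₃ := by rw [h₃]; exact notMem_genericPt (X_ne_zero 2)
    apply al_injective η
    have a₁ := Hp ⟨η, e₁, e₂⟩
    have a₂ := Hq ⟨η, e₁, e₃⟩
    have a₃ := Hr ⟨η, e₂, e₃⟩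
    have a₄ := h η e₁ e₂ e₃
    simp only [map_sub, map_mul, mul_pow] at a₁ a₂ a₃ ⊢
    rw [← a₁, ← a₂, ← a₃, a₄]
    ring
  obtain ⟨u, v, hu, hv, e⟩ := exists_eq_add_of_cocycle (j := m - n) hp (by omega)
    (by decide : (0 : Fin 3) ≠ 2) (by decide : (1 : Fin 3) ≠ 2) hpoly
  have k₁ : ∀ x ∈ W₁, (X 0 : MvPolynomial (Fin 3) ℂ) ^ n ∉ x.asHomogeneousIdeal := fun x hx hx' =>
    (show x ∈ ProjectiveSpectrum.basicOpen (grading 3) (X 0) from h₁ ▸ hx) (x.isPrime.mem_of_pow_mem _ hx')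
  have k₂ : ∀ x ∈ W₂, (X 1 : MvPolynomial (Fin 3) ℂ) ^ n ∉ x.asHomogeneousIdeal := fun x hx hx' =>
    (show x ∈ ProjectiveSpectrum.basicOpen (grading 3) (X 1) from h₂ ▸ hx) (x.isPrime.mem_of_pow_mem _ hx')
  have hd : ((m - n : ℕ) : ℤ) = n + b := by omega
  refine ⟨twFrac (i := m - n) (j := n) hd hv (isHomogeneous_X_pow 0 n) k₁,
    twFrac (i := m - n) (j := n) hd hu.neg (isHomogeneous_X_pow 1 n) k₂, fun x m₁ m₂ => ?_⟩
  have b₁ := twFrac_mul_al (i := m - n) (j := n) hd hv (isHomogeneous_X_pow 0 n) k₁ ⟨x, m₁⟩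
  have b₂ := twFrac_mul_al (i := m - n) (j := n) hd hu.neg (isHomogeneous_X_pow 1 n) k₂ ⟨x, m₂⟩
  have b₃ := Hp ⟨x, m₁, m₂⟩
  apply (isUnit_al (mul_notMem x (k₁ x m₁) (k₂ x m₂))).mul_left_injective
  rw [e] at b₃
  simp only [map_add, map_mul, mul_pow, map_neg] at b₁ b₂ b₃ ⊢
  linear_combination b₃ - al x (X 1 ^ n) * b₁ + al x (X 0 ^ n) * b₂

/-- Writing β = q / (z_0 z_2)^n and γ = r / (z_1 z_2)^n, the agreement is q z_1^n = r z_0^n. So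
z_0^n divides q and z_1^n divides r with the same quotient u, and u / z_2^n extends both sections.
-/
lemma exists_extension (h₁ : W₁ = ProjectiveSpectrum.basicOpen (grading 3) (X 0))
    (h₂ : W₂ = ProjectiveSpectrum.basicOpen (grading 3) (X 1))
    (h₃ : W₃ = ProjectiveSpectrum.basicOpen (grading 3) (X 2))
    (β : twistSections (grading 3) b (W₁ ⊓ W₃)) (γ : twistSections (grading 3) b (W₂ ⊓ W₃))
    (h : ∀ x (m₁ : x ∈ W₁) (m₂ : x ∈ W₂) (m₃ : x ∈ W₃), β.1 ⟨x, m₁, m₃⟩ = γ.1 ⟨x, m₂, m₃⟩) :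
    ∃ s : twistSections (grading 3) b W₃,
      (∀ x (m₁ : x ∈ W₁) (m₃ : x ∈ W₃), β.1 ⟨x, m₁, m₃⟩ = s.1 ⟨x, m₃⟩) ∧
      ∀ x (m₂ : x ∈ W₂) (m₃ : x ∈ W₃), γ.1 ⟨x, m₂, m₃⟩ = s.1 ⟨x, m₃⟩ := by
  obtain ⟨n₂, H₂⟩ := exists_mul_pow_eq_two (i := 0) (j := 2)
    (inf_eq_basicOpen h₁ h₃) β
  obtain ⟨n₃, H₃⟩ := exists_mul_pow_eq_two (i := 1) (j := 2)
    (inf_eq_basicOpen h₂ h₃) γ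
  set n := n₂ + n₃ + b.natAbs
  obtain ⟨m, q, hm, hq, Hq⟩ := H₂ n (by omega)
  obtain ⟨-, r, -, -, Hr⟩ := H₃ n (by omega)
  have hpoly : q * X 1 ^ n = r * X 0 ^ n := by
    let η : ProjectiveSpectrum (grading 3) := genericPt 2
    have e₁ : η ∈ W₁ := by rw [h₁]; exact notMem_genericPt (X_ne_zero 0)
    have e₂ : η ∈ W₂ := by rw [h₂]; exact notMem_genericPt (X_ne_zero 1)
    have e₃ : η ∈ W₃ := by rw [h₃]; exact notMem_genericPt (X_ne_zero 2)
    apply al_injective η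
    have a₂ := Hq ⟨η, e₁, e₃⟩
    have a₃ := Hr ⟨η, e₂, e₃⟩
    have a₄ := h η e₁ e₂ e₃
    simp only [map_mul, mul_pow] at a₂ a₃ ⊢
    rw [← a₂, ← a₃, a₄]
    ring
  obtain ⟨u, hu, e⟩ := exists_eq_mul_of_mul_eq (j := m - n) hq (by omega)
    (by decide : (0 : Fin 3) ≠ 1) hpoly
  have e' : r = X 1 ^ n * u := by
    have hX : (X 0 ^ n : MvPolynomial (Fin 3) ℂ) ≠ 0 := pow_ne_zero _ (X_ne_zero 0)
    apply mul_right_cancel₀ hX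
    rw [← hpoly, e]
    ring
  have k₁ : ∀ x ∈ W₁, (X 0 : MvPolynomial (Fin 3) ℂ) ^ n ∉ x.asHomogeneousIdeal := fun x hx hx' =>
    (show x ∈ ProjectiveSpectrum.basicOpen (grading 3) (X 0) from h₁ ▸ hx) (x.isPrime.mem_of_pow_mem _ hx')
  have k₂ : ∀ x ∈ W₂, (X 1 : MvPolynomial (Fin 3) ℂ) ^ n ∉ x.asHomogeneousIdeal := fun x hx hx' =>
    (show x ∈ ProjectiveSpectrum.basicOpen (grading 3) (X 1) from h₂ ▸ hx) (x.isPrime.mem_of_pow_mem _ hx')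
  have k₃ : ∀ x ∈ W₃, (X 2 : MvPolynomial (Fin 3) ℂ) ^ n ∉ x.asHomogeneousIdeal := fun x hx hx' =>
    (show x ∈ ProjectiveSpectrum.basicOpen (grading 3) (X 2) from h₃ ▸ hx) (x.isPrime.mem_of_pow_mem _ hx')
  have hd : ((m - n : ℕ) : ℤ) = n + b := by omega
  refine ⟨twFrac (i := m - n) (j := n) hd hu (isHomogeneous_X_pow 2 n) k₃,
    fun x m₁ m₃ => ?_, fun x m₂ m₃ => ?_⟩
  · have b₁ := twFrac_mul_al (i := m - n) (j := n) hd hu (isHomogeneous_X_pow 2 n) k₃ ⟨x, m₃⟩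
    have b₃ := Hq ⟨x, m₁, m₃⟩
    apply (isUnit_al (mul_notMem x (k₁ x m₁) (k₃ x m₃))).mul_left_injective
    rw [e] at b₃
    simp only [map_mul, mul_pow] at b₁ b₃ ⊢
    linear_combination b₃ - al x (X 0 ^ n) * b₁
  · have b₁ := twFrac_mul_al (i := m - n) (j := n) hd hu (isHomogeneous_X_pow 2 n) k₃ ⟨x, m₃⟩
    have b₃ := Hr ⟨x, m₂, m₃⟩
    apply (isUnit_al (mul_notMem x (k₂ x m₂) (k₃ x m₃))).mul_left_injective
    rw [e'] at b₃
    simp only [map_mul, mul_pow] at b₁ b₃ ⊢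
    linear_combination b₃ - al x (X 1 ^ n) * b₁

/-- The numerator over (z_0 z_1 z_2)^n has degree 3n + b > 3n - 3, so each of its monomials is
divisible by some z_k^n. Cancelling that power leaves fractions over the three double intersections.
-/
lemma exists_sum (hb : -3 < b) (h₁ : W₁ = ProjectiveSpectrum.basicOpen (grading 3) (X 0))
    (h₂ : W₂ = ProjectiveSpectrum.basicOpen (grading 3) (X 1))
    (h₃ : W₃ = ProjectiveSpectrum.basicOpen (grading 3) (X 2))
    (σ : twistSections (grading 3) b (W₁ ⊓ W₃ ⊓ (W₂ ⊓ W₃))) :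
    ∃ (α : twistSections (grading 3) b (W₁ ⊓ W₂)) (β : twistSections (grading 3) b (W₁ ⊓ W₃))
      (γ : twistSections (grading 3) b (W₂ ⊓ W₃)),
      ∀ x (m₁ : x ∈ W₁) (m₂ : x ∈ W₂) (m₃ : x ∈ W₃), σ.1 ⟨x, ⟨m₁, m₃⟩, m₂, m₃⟩ =
        α.1 ⟨x, m₁, m₂⟩ - (β.1 ⟨x, m₁, m₃⟩ - γ.1 ⟨x, m₂, m₃⟩) := by
  obtain ⟨n₀, H₀⟩ := exists_mul_pow_eq (c := X 1 * X 2) (X_mem_grading (0 : Fin 3))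
    (SetLike.mul_mem_graded (X_mem_grading 1) (X_mem_grading 2)) (by
      rw [← inf_inf_distrib_right, inf_assoc]
      exact inf_eq_basicOpen h₁ (inf_eq_basicOpen h₂ h₃)) σ
  set n := n₀ + b.natAbs
  obtain ⟨m, p, hm, hp, Hp⟩ := H₀ n (by omega)
  push_cast at hm
  obtain ⟨u, v, w, hu, hv, hw, e⟩ := exists_eq_add_three (n := n) (j := m - n) hp
    (by omega) (by omega)
  have k₁ : ∀ x ∈ W₁, (X 0 : MvPolynomial (Fin 3) ℂ) ^ n ∉ x.asHomogeneousIdeal := fun x hx hx' =>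
    (show x ∈ ProjectiveSpectrum.basicOpen (grading 3) (X 0) from h₁ ▸ hx) (x.isPrime.mem_of_pow_mem _ hx')
  have k₂ : ∀ x ∈ W₂, (X 1 : MvPolynomial (Fin 3) ℂ) ^ n ∉ x.asHomogeneousIdeal := fun x hx hx' =>
    (show x ∈ ProjectiveSpectrum.basicOpen (grading 3) (X 1) from h₂ ▸ hx) (x.isPrime.mem_of_pow_mem _ hx')
  have k₃ : ∀ x ∈ W₃, (X 2 : MvPolynomial (Fin 3) ℂ) ^ n ∉ x.asHomogeneousIdeal := fun x hx hx' =>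
    (show x ∈ ProjectiveSpectrum.basicOpen (grading 3) (X 2) from h₃ ▸ hx) (x.isPrime.mem_of_pow_mem _ hx')
  have hd : ((m - n : ℕ) : ℤ) = (n + n : ℕ) + b := by omega
  have d (i j : Fin 3) : (X i ^ n * X j ^ n : MvPolynomial (Fin 3) ℂ) ∈ grading 3 (n + n) :=
    (isHomogeneous_X_pow i n).mul (isHomogeneous_X_pow j n)
  have k₁₂ : ∀ x ∈ W₁ ⊓ W₂, (X 0 ^ n * X 1 ^ n : MvPolynomial (Fin 3) ℂ) ∉ x.asHomogeneousIdeal :=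
    fun x hx => mul_notMem x (k₁ x hx.1) (k₂ x hx.2)
  have k₁₃ : ∀ x ∈ W₁ ⊓ W₃, (X 0 ^ n * X 2 ^ n : MvPolynomial (Fin 3) ℂ) ∉ x.asHomogeneousIdeal :=
    fun x hx => mul_notMem x (k₁ x hx.1) (k₃ x hx.2)
  have k₂₃ : ∀ x ∈ W₂ ⊓ W₃, (X 1 ^ n * X 2 ^ n : MvPolynomial (Fin 3) ℂ) ∉ x.asHomogeneousIdeal :=
    fun x hx => mul_notMem x (k₂ x hx.1) (k₃ x hx.2)
  refine ⟨twFrac hd hw (d 0 1) k₁₂, twFrac hd hv.neg (d 0 2) k₁₃, twFrac hd hu (d 1 2) k₂₃,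
    fun x m₁ m₂ m₃ => ?_⟩
  have b₁ := twFrac_mul_al hd hw (d 0 1) k₁₂ ⟨x, m₁, m₂⟩
  have b₂ := twFrac_mul_al hd hv.neg (d 0 2) k₁₃ ⟨x, m₁, m₃⟩
  have b₃ := twFrac_mul_al hd hu (d 1 2) k₂₃ ⟨x, m₂, m₃⟩
  have b₄ := Hp ⟨x, ⟨m₁, m₃⟩, m₂, m₃⟩
  apply (isUnit_al (mul_notMem x (k₁ x m₁) (mul_notMem x (k₂ x m₂) (k₃ x m₃)))).mul_left_injective
  rw [e] at b₄
  simp only [map_add, map_mul, mul_pow, map_neg] at b₁ b₂ b₃ b₄ ⊢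
  linear_combination b₄ - al x (X 2 ^ n) * b₁ + al x (X 1 ^ n) * b₂ - al x (X 0 ^ n) * b₃

end Plane

/-! ### Cohomology of twisting sheaves of the plane, pushed forward to space. -/

section Hyperplane

/-- The sheaf `𝒪(b)` of the plane at infinity, as a sheaf of modules on `ℙ³`. -/
def planeTwist (b : ℤ) : (PSpace 3).Modules :=
  (Scheme.Modules.pushforward (hyperplane 2)).obj (OO 2 b)

/-- The standard open sets of `ℙ³`. -/
abbrev UU (j : Fin 4) : (PSpace 3).Opens := Proj.basicOpen (grading 4) (X j)

lemma setZero_X_zero : setZero 2 (X 0) = 0 := by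
  change aeval _ (X 0) = 0
  simp

lemma setZero_X_succ (j : Fin 3) : setZero 2 (X j.succ) = X j := by
  change aeval _ (X j.succ) = _
  simp

/-- The trace of D(g) on the plane is the principal open set of the restricted form, contained in
D(z_j) by divisibility; there 𝒪(b) is trivial. The case of a form vanishing on the plane is
included, zero being divisible by everything. -/
lemma subsingleton_HU_planeTwist (b : ℤ) (n : ℕ) {g : MvPolynomial (Fin 4) ℂ} {m : ℕ}
    (hg : g ∈ grading 4 m) (hm : 0 < m) (j : Fin 3) (h : X j ∣ setZero 2 g) :
    Subsingleton (HU (abSh (planeTwist b)) (n + 1) (Proj.basicOpen (grading 4) g)) := by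
  refine subsingleton_HU_of_extends (Proj.isAffineOpen_basicOpen _ g hg hm) ?_ n
  refine Extends.pushforward _ (extends_twist (X_mem_grading j) b ?_ fun x hx hx' => ?_)
  · exact Proj.isAffineOpen_basicOpen _ (setZero 2 g) ((setZero 2).map_mem hg) hm
  · obtain ⟨c, hc⟩ := h
    have : setZero 2 g ∉ x.asHomogeneousIdeal := hx
    rw [hc] at this
    exact this (x.asHomogeneousIdeal.toIdeal.mul_mem_right _ hx')

lemma subsingleton_planeTwist (b : ℤ) {V : (PSpace 3).Opens} (hV : V ≤ UU 0) :
    Subsingleton ((abSh (planeTwist b)).obj.obj (op V)) := by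
  refine ⟨fun s t => tw_ext (V := (hyperplane 2) ⁻¹ᵁ V) (𝒜 := grading 3) fun x => ?_⟩
  exfalso
  have : setZero 2 (X 0) ∉ ProjectiveSpectrum.asHomogeneousIdeal (𝒜 := grading 3) x.1 := hV x.2
  rw [setZero_X_zero] at this
  exact this (zero_mem _)

instance (b : ℤ) (n : ℕ) (j : Fin 4) : Subsingleton (HU (abSh (planeTwist b)) (n + 1) (UU j)) := by
  refine Fin.cases ?_ (fun j => ?_) j
  · exact subsingleton_HU_planeTwist b n (X_mem_grading _) one_pos 0 (by rw [setZero_X_zero]; exact dvd_zero _)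
  · exact subsingleton_HU_planeTwist b n (X_mem_grading _) one_pos j (by rw [setZero_X_succ])

instance (b : ℤ) (n : ℕ) (j k : Fin 4) :
    Subsingleton (HU (abSh (planeTwist b)) (n + 1) (UU j ⊓ UU k)) := by
  rw [← Proj.basicOpen_mul]
  have h := SetLike.mul_mem_graded (X_mem_grading j) (X_mem_grading k)
  revert h
  refine Fin.cases (fun h => ?_) (fun j h => ?_) j
  · exact subsingleton_HU_planeTwist b n h (by simp) 0
      (by rw [map_mul, setZero_X_zero, zero_mul]; exact dvd_zero _)
  · exact subsingleton_HU_planeTwist b n h (by simp) j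
      (by rw [map_mul, setZero_X_succ]; exact dvd_mul_right _ _)

/-- A homogeneous prime containing all variables contains the irrelevant ideal. The index 0 comes
last because the plane misses `UU 0`, so that the other three sets carry the computation. -/
lemma UU_sup : UU 1 ⊔ UU 2 ⊔ UU 3 ⊔ UU 0 = ⊤ := by
  rw [eq_top_iff]
  intro x _
  by_contra h
  have h' : ∀ j, (X j : MvPolynomial (Fin 4) ℂ) ∈ ProjectiveSpectrum.asHomogeneousIdeal (𝒜 := grading 4) x := by
    intro j
    by_contra hj
    apply h
    fin_cases j
    · exact Or.inr hj
    · exact Or.inl (Or.inl (Or.inl hj))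
    · exact Or.inl (Or.inl (Or.inr hj))
    · exact Or.inl (Or.inr hj)
  apply ProjectiveSpectrum.not_irrelevant_le (𝒜 := grading 4) x
  refine (HomogeneousIdeal.irrelevant_le _).2 fun i hi p hp => ?_
  rw [p.as_sum]
  refine sum_mem fun m hm => ?_
  have hne : m ≠ 0 := by
    rintro rfl
    have := hp (mem_support_iff.1 hm)
    simp at this
    omega
  obtain ⟨j, hj⟩ := Finsupp.ne_iff.1 hne
  have : X j ∣ monomial m (coeff m p) := by
    rw [X_dvd_monomial]
    exact Or.inr hj
  exact Ideal.mem_of_dvd (HomogeneousIdeal.toIdeal _) this (h' j)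

lemma preimage_UU_succ (j : Fin 3) : (hyperplane 2) ⁻¹ᵁ (UU j.succ) =
    ProjectiveSpectrum.basicOpen (grading 3) (X j) := by
  change ProjectiveSpectrum.basicOpen (grading 3) (setZero 2 (X j.succ)) = _
  rw [setZero_X_succ]

theorem subsingleton_H_one_planeTwist : Subsingleton ((abSh (planeTwist 0)).H 1) := by
  refine subsingleton_H_of_HU _ _ ?_
  rw [← UU_sup]
  have : Subsingleton (HU (abSh (planeTwist 0)) 1 (UU 1 ⊔ UU 2 ⊔ UU 3)) := by
    refine subsingleton_HU_one_of_three _ _ _ (fun α β γ h => ?_) (fun β γ h => ?_)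
    · obtain ⟨s, t, hst⟩ := exists_splitting (preimage_UU_succ 0) (preimage_UU_succ 1)
        (preimage_UU_succ 2) α β γ (fun x m₁ m₂ m₃ => congrFun (congrArg Subtype.val h) ⟨x, ⟨m₁, m₃⟩, m₂, m₃⟩)
      exact ⟨s, t, tw_ext (𝒜 := grading 3) fun x => hst x.1 x.2.1 x.2.2⟩
    · obtain ⟨s, hs, ht⟩ := exists_extension (preimage_UU_succ 0) (preimage_UU_succ 1)
        (preimage_UU_succ 2) β γ (fun x m₁ m₂ m₃ => congrFun (congrArg Subtype.val h) ⟨x, ⟨m₁, m₃⟩, m₂, m₃⟩)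
      exact ⟨s, tw_ext (𝒜 := grading 3) fun x => hs x.1 x.2.1 x.2.2,
        tw_ext (𝒜 := grading 3) fun x => ht x.1 x.2.1 x.2.2⟩
  have := subsingleton_planeTwist 0 (V := (UU 1 ⊔ UU 2 ⊔ UU 3) ⊓ UU 0) inf_le_right
  exact subsingleton_HU_one_of_sup _ _

/-- The fourth chart misses the plane: every group of sections below `UU 0` is trivial, so the
criterion for H¹ on the intersection with that chart holds vacuously. -/
theorem subsingleton_H_two_planeTwist {b : ℤ} (hb : -3 < b) :
    Subsingleton ((abSh (planeTwist b)).H 2) := by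
  refine subsingleton_H_of_HU _ _ ?_
  rw [← UU_sup]
  have : Subsingleton (HU (abSh (planeTwist b)) 2 (UU 1 ⊔ UU 2 ⊔ UU 3)) := by
    refine subsingleton_HU_two_of_three _ _ _ fun s => ?_
    obtain ⟨α, β, γ, h⟩ := exists_sum hb (preimage_UU_succ 0) (preimage_UU_succ 1)
      (preimage_UU_succ 2) s
    exact ⟨α, β, γ, tw_ext (𝒜 := grading 3) fun x => h x.1 x.2.1.1 x.2.2.1 x.2.1.2⟩
  have : Subsingleton (HU (abSh (planeTwist b)) 1 ((UU 1 ⊔ UU 2 ⊔ UU 3) ⊓ UU 0)) := by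
    rw [inf_sup_right, inf_sup_right]
    have h (V : (PSpace 3).Opens) (hV : V ≤ UU 0) := subsingleton_planeTwist b hV
    refine subsingleton_HU_one_of_three _ _ _ (fun α β γ _ => ⟨0, 0, ?_⟩) (fun β γ _ => ⟨0, ?_, ?_⟩)
    · exact (h _ (inf_le_left.trans inf_le_right)).elim _ _
    · exact (h _ (inf_le_left.trans inf_le_right)).elim _ _
    · exact (h _ (inf_le_left.trans inf_le_right)).elim _ _
  exact subsingleton_HU_two_of_sup _ _

end Hyperplane

/-! ### Twists of E by 𝒪(b) and multiplication with twisted functions. -/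

section Twisted

variable (E : (PSpace 3).Modules) {V : (PSpace 3).Opens}

/-- Sections of a twisting sheaf on projective space. -/
abbrev TW (b : ℤ) (V : (PSpace 3).Opens) : Type := twistSections (grading 4) b V

/-- The presheaf `U ↦ E(U) ⊗ 𝒪(b)(U)`. -/
def EE (b : ℤ) : AbPresheaf (PSpace 3) := (tens (pm E) (pm (OO 3 b))).presheaf

variable {E} {a b c d e : ℤ}

/-- The tensor `m ⊗ f` of a section and a twisted function. -/
def etm (m : (pm E).presheaf.obj (op V)) (f : TW b V) : (EE E b).obj (op V) :=
  tm (pm E) (pm (OO 3 b)) V m f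

lemma etm_add_left (m m' : (pm E).presheaf.obj (op V)) (f : TW b V) :
    etm (m + m') f = etm m f + etm m' f := by
  rw [etm, (tm _ _ V).map_add]; rfl

lemma etm_add_right (m : (pm E).presheaf.obj (op V)) (f f' : TW b V) :
    etm m (f + f') = etm m f + etm m f' :=
  (tm _ _ V m).map_add _ _

lemma etm_smul (r : Γ(PSpace 3, V)) (m : (pm E).presheaf.obj (op V)) (f : TW b V) :
    etm (r • m) f = etm m (r • f) := by
  rw [etm, (tm _ _ V).map_smul]
  exact ((tm _ _ V m).map_smul _ _).symm

lemma etm_induction {p : (EE E b).obj (op V) → Prop} (z) (zero : p 0)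
    (tmul : ∀ m f, p (etm m f)) (add : ∀ x y, p x → p y → p (x + y)) : p z :=
  tm_induction z zero tmul add

lemma rs_etm {U : (PSpace 3).Opens} (i : V ≤ U) (m : (pm E).presheaf.obj (op U)) (f : TW b U) :
    rs i (etm m f) = etm (rs i m) (rs (F := twistPresheaf (grading 4) b) i f) := rfl

lemma twMul_add (h : a + b = c) (f : TW a V) (g g' : TW b V) :
    twMul h f (g + g') = twMul h f g + twMul h f g' :=
  tw_ext fun _ => mul_add _ _ _

lemma add_twMul (h : a + b = c) (f f' : TW a V) (g : TW b V) :
    twMul h (f + f') g = twMul h f g + twMul h f' g :=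
  tw_ext fun _ => add_mul _ _ _

lemma balanced_mul (h : b + a = c) (s : TW a V) :
    Balanced (M := pm E) (N := pm (OO 3 b)) (V := V) (G := (EE E c).obj (op V))
      (fun m f => etm m (twMul h f s)) where
  add_left _ _ _ := etm_add_left _ _ _
  add_right m n n' := (congrArg (etm m) (add_twMul h n n' s)).trans (etm_add_right _ _ _)
  smul r m _ := (etm_smul r m _).trans
    (congrArg (etm m) (tw_ext fun _ => (mul_assoc _ _ _).symm))

/-- Multiplication with a twisted function. -/
def act (h : b + a = c) (s : TW a V) : (EE E b).obj (op V) →+ (EE E c).obj (op V) :=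
  tmLift (balanced_mul h s)

lemma act_etm (h : b + a = c) (s : TW a V) (m : (pm E).presheaf.obj (op V)) (f : TW b V) :
    act h s (etm m f) = etm m (twMul h f s) :=
  tmLift_tm (balanced_mul h s) m f

lemma act_ext {φ ψ : (EE E b).obj (op V) →+ (EE E c).obj (op V)}
    (h : ∀ m (f : TW b V), φ (etm m f) = ψ (etm m f)) : φ = ψ := by
  ext z
  induction z using etm_induction with
  | zero => rw [map_zero, map_zero]
  | tmul m f => exact h m f
  | add x y hx hy => rw [map_add, map_add, hx, hy]

lemma act_add (h : b + a = c) (s t : TW a V) (z : (EE E b).obj (op V)) :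
    act h (s + t) z = act h s z + act h t z := by
  have : act h (s + t) = act (E := E) h s + act h t := act_ext fun m f => by
    rw [AddMonoidHom.add_apply, act_etm, act_etm, act_etm, twMul_add, etm_add_right]
  rw [this]
  rfl

/-- Multiplication as a biadditive map. -/
def actHom (h : b + a = c) (z : (EE E b).obj (op V)) : TW a V →+ (EE E c).obj (op V) :=
  AddMonoidHom.mk' (fun s => act h s z) (fun s t => act_add h s t z)

lemma act_zero (h : b + a = c) (z : (EE E b).obj (op V)) : act h (0 : TW a V) z = 0 :=
  (actHom h z).map_zero

lemma act_neg (h : b + a = c) (s : TW a V) (z : (EE E b).obj (op V)) :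
    act h (-s) z = -act h s z :=
  (actHom h z).map_neg s

/-- The degrees are independent variables linked by equations, so that twists by equal integers need
not be identified by transport. -/
lemma act_act (h : b + a = c) (h' : c + d = e) {f : ℤ} (k : a + d = f) (s : TW a V) (t : TW d V)
    (z : (EE E b).obj (op V)) :
    act h' t (act h s z) = act (by omega : b + f = e) (twMul k s t) z := by
  have : (act (E := E) h' t).comp (act h s) = act (by omega : b + f = e) (twMul k s t) :=
    act_ext fun m g => by
      rw [AddMonoidHom.comp_apply, act_etm, act_etm, act_etm]
      exact congrArg (etm m) (tw_ext fun _ => mul_assoc _ _ _)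
  exact congr($this z)

lemma act_one (s : TW 0 V) (hs : ∀ x, s.1 x = 1) (h : b + 0 = b) (z : (EE E b).obj (op V)) :
    act h s z = z := by
  have : act (E := E) h s = AddMonoidHom.id _ := act_ext fun m g => by
      rw [act_etm]
      exact congrArg (etm m) (tw_ext fun x => (congrArg (g.1 x * ·) (hs x)).trans (mul_one _))
  exact congr($this z)

lemma rs_act (h : b + a = c) (s : TW a V) {W : (PSpace 3).Opens} (i : W ≤ V)
    (z : (EE E b).obj (op V)) :
    rs i (act h s z) = act h (rs (F := twistPresheaf (grading 4) a) i s) (rs i z) := by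
  induction z using etm_induction with
  | zero => simp only [map_zero, rs]
  | tmul m f =>
    rw [act_etm, rs_etm, rs_etm]
    exact (act_etm h (rs (F := twistPresheaf (grading 4) a) i s) (rs i m)
      (rs (F := twistPresheaf (grading 4) b) i f)).symm
  | add x y hx hy =>
    simp only [rs, map_add] at hx hy ⊢
    rw [hx, hy]

/-- The homogeneous coordinate `z_k`. -/
def zs (k : Fin 4) (V : (PSpace 3).Opens) : TW 1 V :=
  twFrac (𝒜 := grading 4) (i := 1) (j := 0) (by simp) (X_mem_grading k) (s := 1) SetLike.GradedOne.one_mem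
    fun x _ h => x.isPrime.ne_top ((Ideal.eq_top_iff_one _).2 h)

lemma zs_apply (k : Fin 4) (x : V) : (zs k V).1 x = al (𝒜 := grading 4) x.1 (X k) := by
  have : (zs k V).1 x * al (𝒜 := grading 4) x.1 1 = al x.1 (X k) := twFrac_mul_al _ _ _ _ _
  rwa [map_one, mul_one] at this

/-- The power `z_i ^ m` where `z_i` does not vanish. -/
def zpw {i : Fin 4} (hV : V ≤ UU i) (m : ℤ) : TW m V :=
  twPow (V := V) (X_mem_grading i) m fun _ hx => hV hx

lemma zpw_one {i : Fin 4} (hV : V ≤ UU i) : zpw hV 1 = zs i V :=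
  tw_ext fun x => (twPow_one _ _ x).trans (zs_apply _ _).symm

lemma zpw_mul {i : Fin 4} (hV : V ≤ UU i) (h : a + b = c) :
    twMul h (zpw hV a) (zpw hV b) = zpw hV c :=
  twPow_mul_twPow _ _ _

lemma zpw_zero {i : Fin 4} (hV : V ≤ UU i) (x) : (zpw hV 0).1 x = 1 :=
  twPow_zero _ _ x

lemma twMul_comm' (h : a + b = c) (h' : b + a = c) (f : TW a V) (g : TW b V) :
    twMul h f g = twMul h' g f :=
  tw_ext fun _ => mul_comm _ _

lemma act_comm (h : b + a = c) (h' : c + d = e) {f : ℤ} (k : b + d = f) (k' : f + a = e)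
    (s : TW a V) (t : TW d V) (z : (EE E b).obj (op V)) :
    act h' t (act h s z) = act k' s (act k t z) := by
  rw [act_act h h' (add_comm a d), act_act k k' rfl, twMul_comm' (add_comm a d) rfl]

lemma act_zpw_zpw {i : Fin 4} (hV : V ≤ UU i) (h : b + a = c) (h' : c + d = b)
    (z : (EE E b).obj (op V)) : act h' (zpw hV d) (act h (zpw hV a) z) = z := by
  obtain rfl : d = -a := by omega
  rw [act_act h h' (add_neg_cancel a), zpw_mul]
  exact act_one _ (zpw_zero hV) _ z

/-- Multiplication with `z_k`. -/
def zop (k : Fin 4) (h : b + 1 = c) : EE E b ⟶ EE E c where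
  app V := AddCommGrpCat.ofHom (act h (zs k V.unop))
  naturality V W i := by
    ext z
    exact (rs_act h (zs k V.unop) i.unop.le z).symm

/-- The identification of `E` with a twist where a coordinate does not vanish. -/
def ezpw (E : (PSpace 3).Modules) {i : Fin 4} (hV : V ≤ UU i) (b : ℤ) :
    (pm E).presheaf.obj (op V) →+ (EE E b).obj (op V) :=
  AddMonoidHom.mk' (fun m => etm m (zpw hV b)) (fun m m' => etm_add_left m m' _)

/-- On such `V` the sections of 𝒪(b) are free on z_i^b, and tensoring with a free module of rank one
changes nothing. -/
lemma ezpw_bijective {i : Fin 4} (hV : V ≤ UU i) (b : ℤ) : Function.Bijective (ezpw E hV b) := by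
  let φ : Γ(PSpace 3, V) →ₗ[Γ(PSpace 3, V)] TW b V :=
    LinearMap.toSpanSingleton _ _ (zpw hV b)
  have hφ : Function.Bijective φ := by
    rw [Function.bijective_iff_existsUnique]
    exact fun f => exists_smul_twPow (V := V) (X_mem_grading i) (fun _ hx => hV hx) f
  let e := LinearEquiv.ofBijective φ hφ
  let M : Type := (pm E).presheaf.obj (op V)
  let A : TensorProduct Γ(PSpace 3, V) M Γ(PSpace 3, V) ≃ₗ[Γ(PSpace 3, V)]
    TensorProduct Γ(PSpace 3, V) M (TW b V) := LinearEquiv.lTensor M e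
  let B : M ≃ₗ[Γ(PSpace 3, V)] TensorProduct Γ(PSpace 3, V) M Γ(PSpace 3, V) :=
    (TensorProduct.rid Γ(PSpace 3, V) M).symm
  have : (ezpw E hV b : _ → _) = A ∘ B := by
    funext m
    refine congrArg (etm m) ?_
    exact (one_smul Γ(PSpace 3, V) (zpw hV b)).symm
  rw [this]
  exact A.bijective.comp B.bijective

end Twisted

/-! ### Finite powers, subpresheaves and long exact sequences. -/

section Powers

variable {X : TopCat.{0}}

/-- The presheaf of families of sections. -/
def pw (ι : Type) (P : AbPresheaf X) : AbPresheaf X where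
  obj U := AddCommGrpCat.of (ι → P.obj U)
  map i := AddCommGrpCat.ofHom (AddMonoidHom.mk' (fun s k => P.map i (s k))
    fun s t => funext fun k => map_add _ _ _)

/-- A coordinate of a family. -/
def pwProj {ι : Type} (P : AbPresheaf X) (k : ι) : pw ι P ⟶ P where
  app U := AddCommGrpCat.ofHom (Pi.evalAddMonoidHom _ k)

/-- The inclusion of a summand. -/
def pwSingle {ι : Type} [DecidableEq ι] (P : AbPresheaf X) (k : ι) : P ⟶ pw ι P where
  app U := AddCommGrpCat.ofHom (AddMonoidHom.single (fun _ => P.obj U) k)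
  naturality U V i := by
    ext s
    funext j
    change Pi.single (M := fun _ => P.obj V) k (P.map i s) j =
      P.map i (Pi.single (M := fun _ => P.obj U) k s j)
    rcases eq_or_ne j k with rfl | h
    · simp
    · simp [h]

/-- The morphism given by coordinates. -/
def pwLift {ι : Type} {P Q : AbPresheaf X} (f : ι → (Q ⟶ P)) : Q ⟶ pw ι P where
  app U := AddCommGrpCat.ofHom (AddMonoidHom.mk' (fun s k => (f k).app U s)
    fun s t => funext fun k => map_add _ _ _)
  naturality U V i := by
    ext s
    funext k
    exact congr($((f k).naturality i) s)

lemma pw_id {ι : Type} [Fintype ι] [DecidableEq ι] (P : AbPresheaf X) :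
    ∑ k : ι, pwProj P k ≫ pwSingle P k = 𝟙 (pw ι P) := by
  ext U s
  rw [NatTrans.app_sum]
  have : ∀ (S : Finset ι), (∑ k ∈ S, (pwProj P k ≫ pwSingle P k).app U) s =
      ∑ k ∈ S, Pi.single (M := fun _ => P.obj U) k (s k) := by
    intro S
    induction S using Finset.induction_on with
    | empty => rfl
    | insert a S ha ih =>
      rw [Finset.sum_insert ha, Finset.sum_insert ha, ← ih]
      rfl
  refine (this _).trans ?_
  exact Finset.univ_sum_single s

lemma pwLift_proj {ι : Type} {P Q : AbPresheaf X} (f : ι → (Q ⟶ P)) (k : ι) :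
    pwLift f ≫ pwProj P k = f k := rfl

/-- The constant sheaf with stalks `ℤ`. -/
abbrev cst (X : TopCat.{0}) : AbSheaf X :=
  (constantSheaf (Opens.grothendieckTopology X) AddCommGrpCat.{0}).obj (AddCommGrpCat.of (ULift ℤ))

/-- The map induced on cohomology. -/
def Hmap {F G : AbSheaf X} (f : F ⟶ G) (n : ℕ) : F.H n →+ G.H n :=
  AddMonoidHom.mk' (fun x => Ext.comp (X := cst X) x (Ext.mk₀ f) (add_zero n))
    fun _ _ => Ext.add_comp _ _ _ _

lemma Hmap_comp {F G K : AbSheaf X} (f : F ⟶ G) (g : G ⟶ K) (n : ℕ) (x : F.H n) :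
    Hmap (f ≫ g) n x = Hmap g n (Hmap f n x) := by
  change Ext.comp (X := cst X) x (Ext.mk₀ (f ≫ g)) (add_zero n) =
    Ext.comp (X := cst X) (Ext.comp (X := cst X) x (Ext.mk₀ f) (add_zero n)) (Ext.mk₀ g) (add_zero n)
  rw [← Ext.mk₀_comp_mk₀, Ext.comp_assoc_of_second_deg_zero]

lemma Hmap_id {F : AbSheaf X} (n : ℕ) (x : F.H n) : Hmap (𝟙 F) n x = x := Ext.comp_mk₀_id _

lemma Hmap_sum {ι : Type} (S : Finset ι) {F G : AbSheaf X} (f : ι → (F ⟶ G)) (n : ℕ) (x : F.H n) :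
    Hmap (∑ k ∈ S, f k) n x = ∑ k ∈ S, Hmap (f k) n x := by
  let φ : (F ⟶ G) →+ G.H n := AddMonoidHom.mk' (fun f => Hmap f n x) fun f g => by
    change Ext.comp (X := cst X) x (Ext.mk₀ (f + g)) (add_zero n) = _
    rw [Ext.mk₀_add, Ext.comp_add]
    rfl
  exact map_sum φ f S

/-- The identity of the power is a sum of endomorphisms factoring through `P`, whose cohomology
vanishes. -/
lemma subsingleton_H_pw {ι : Type} [Fintype ι] [DecidableEq ι] (P : AbPresheaf X) (n : ℕ)
    (h : Subsingleton ((aSh P).H n)) : Subsingleton ((aSh (pw ι P)).H n) := by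
  refine subsingleton_of_forall_eq 0 fun x => ?_
  have h1 : Hmap (aShMap (∑ k : ι, pwProj P k ≫ pwSingle P k)) n x = x := by
    rw [pw_id]
    refine Eq.trans ?_ (Hmap_id n x)
    exact congrArg (fun f => Hmap f n x) (CategoryTheory.Functor.map_id _ _)
  rw [← h1]
  simp only [aShMap, Functor.map_sum, Hmap_sum, Functor.map_comp, Hmap_comp]
  refine Finset.sum_eq_zero fun k _ => ?_
  rw [Subsingleton.elim (Hmap _ n x) 0, map_zero]

/-- A presheaf of subgroups. -/
def subP (P : AbPresheaf X) (S : ∀ U : Opens X, AddSubgroup (P.obj (op U)))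
    (hS : ∀ (U V : Opens X) (i : V ≤ U), ∀ s ∈ S U, rs i s ∈ S V) : AbPresheaf X where
  obj U := AddCommGrpCat.of (S U.unop)
  map {U V} i := AddCommGrpCat.ofHom (AddMonoidHom.mk' (fun s => ⟨P.map i s.1, hS _ _ i.unop.le _ s.2⟩)
    fun s t => Subtype.ext (map_add _ _ _))

/-- The inclusion of a presheaf of subgroups. -/
def subPι (P : AbPresheaf X) (S : ∀ U : Opens X, AddSubgroup (P.obj (op U)))
    (hS : ∀ (U V : Opens X) (i : V ≤ U), ∀ s ∈ S U, rs i s ∈ S V) : subP P S hS ⟶ P where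
  app U := AddCommGrpCat.ofHom (S U.unop).subtype

/-- Factorization through a presheaf of subgroups. -/
def subPLift {P Q : AbPresheaf X} (S : ∀ U : Opens X, AddSubgroup (P.obj (op U)))
    (hS : ∀ (U V : Opens X) (i : V ≤ U), ∀ s ∈ S U, rs i s ∈ S V) (f : Q ⟶ P)
    (hf : ∀ (U : Opens X) s, f.app (op U) s ∈ S U) : Q ⟶ subP P S hS where
  app U := AddCommGrpCat.ofHom (AddMonoidHom.mk' (fun s => ⟨f.app U s, hf U.unop s⟩)
    fun s t => Subtype.ext (map_add _ _ _))
  naturality U V i := by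
    ext s
    exact Subtype.ext congr($(f.naturality i) s)

section Sequences

variable {S : ShortComplex (AbSheaf X)} (hS : S.ShortExact)
include hS

lemma H_middle (n : ℕ) (h₁ : Subsingleton (S.X₁.H n)) (h₃ : Subsingleton (S.X₃.H n)) :
    Subsingleton (S.X₂.H n) := by
  refine subsingleton_of_forall_eq 0 fun x => ?_
  obtain ⟨y, hy⟩ := Ext.covariant_sequence_exact₂ (cst X) hS x (h₃.elim _ _)
  rw [← hy, h₁.elim y 0]
  exact Ext.zero_comp _ _ _ _ _

lemma H_left (n : ℕ) (h₂ : Subsingleton (S.X₂.H (n + 1)))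
    (h₃ : ∀ y : S.X₃.H n, ∃ x : S.X₂.H n, Hmap S.g n x = y) : Subsingleton (S.X₁.H (n + 1)) := by
  refine subsingleton_of_forall_eq 0 fun x => ?_
  obtain ⟨y, hy⟩ := Ext.covariant_sequence_exact₁ (cst X) hS x (h₂.elim _ _) rfl
  obtain ⟨z, rfl⟩ := h₃ y
  rw [← hy]
  change Ext.comp (X := cst X) (Ext.comp (X := cst X) z (Ext.mk₀ S.g) (add_zero n)) _ _ = 0
  rw [Ext.comp_assoc_of_second_deg_zero, hS.comp_extClass]
  exact Ext.comp_zero _ _ _ _ _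

lemma H_right (n : ℕ) (h₂ : Subsingleton (S.X₂.H n))
    (h₁ : ∀ x : S.X₁.H (n + 1), Hmap S.f (n + 1) x = 0 → x = 0) : Subsingleton (S.X₃.H n) := by
  refine subsingleton_of_forall_eq 0 fun x => ?_
  have h0 : Ext.comp (X := cst X) x hS.extClass rfl = 0 := by
    refine h₁ _ ?_
    change Ext.comp (X := cst X) (Ext.comp (X := cst X) x _ _) (Ext.mk₀ S.f) (add_zero (n + 1)) = 0
    rw [Ext.comp_assoc_of_third_deg_zero, hS.extClass_comp]
    exact Ext.comp_zero _ _ _ _ _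
  obtain ⟨y, hy⟩ := Ext.covariant_sequence_exact₃ (cst X) hS x rfl h0
  rw [← hy, h₂.elim y 0]
  exact Ext.zero_comp _ _ _ _ _

lemma H_surj (n : ℕ) (h₃ : Subsingleton (S.X₃.H n)) (y : S.X₂.H n) :
    ∃ x : S.X₁.H n, Hmap S.f n x = y :=
  Ext.covariant_sequence_exact₂ (cst X) hS y (h₃.elim _ _)

lemma H_inj (n : ℕ) (h₃ : Subsingleton (S.X₃.H n)) (x : S.X₁.H (n + 1))
    (hx : Hmap S.f (n + 1) x = 0) : x = 0 := by
  obtain ⟨y, hy⟩ := Ext.covariant_sequence_exact₁ (cst X) hS x hx rfl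
  rw [← hy, h₃.elim y 0]
  exact Ext.zero_comp _ _ _ _ _

end Sequences

section LocallyExact

variable {P Q R : AbPresheaf X} {f : P ⟶ Q} {g : Q ⟶ R} (h : LocallyExact f g)
include h

lemma LocallyExact.H_middle (n : ℕ) (h₁ : Subsingleton ((aSh P).H n))
    (h₃ : Subsingleton ((aSh R).H n)) : Subsingleton ((aSh Q).H n) :=
  ProjSheaf.H_middle h.shortExact n h₁ h₃

lemma LocallyExact.H_left (n : ℕ) (h₂ : Subsingleton ((aSh Q).H (n + 1)))
    (h₃ : ∀ y : (aSh R).H n, ∃ x : (aSh Q).H n, Hmap (aShMap g) n x = y) :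
    Subsingleton ((aSh P).H (n + 1)) :=
  ProjSheaf.H_left h.shortExact n h₂ h₃

lemma LocallyExact.H_right (n : ℕ) (h₂ : Subsingleton ((aSh Q).H n))
    (h₁ : ∀ x : (aSh P).H (n + 1), Hmap (aShMap f) (n + 1) x = 0 → x = 0) :
    Subsingleton ((aSh R).H n) :=
  ProjSheaf.H_right h.shortExact n h₂ h₁

lemma LocallyExact.H_surj (n : ℕ) (h₃ : Subsingleton ((aSh R).H n)) (y : (aSh Q).H n) :
    ∃ x : (aSh P).H n, Hmap (aShMap f) n x = y :=
  ProjSheaf.H_surj h.shortExact n h₃ y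

lemma LocallyExact.H_inj (n : ℕ) (h₃ : Subsingleton ((aSh R).H n)) (x : (aSh P).H (n + 1))
    (hx : Hmap (aShMap f) (n + 1) x = 0) : x = 0 :=
  ProjSheaf.H_inj h.shortExact n h₃ x hx

end LocallyExact

lemma subsingleton_H_of_isIso {F G : AbSheaf X} (f : F ⟶ G) [IsIso f] (n : ℕ)
    (h : Subsingleton (F.H n)) : Subsingleton (G.H n) := by
  refine subsingleton_of_forall_eq 0 fun x => ?_
  have : Hmap f n (Hmap (inv f) n x) = x := by
    rw [← Hmap_comp, IsIso.inv_hom_id, Hmap_id]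
  rw [← this, Subsingleton.elim (Hmap (inv f) n x) 0, map_zero]

lemma subsingleton_H_of_isIso' {F G : AbSheaf X} (f : F ⟶ G) [IsIso f] (n : ℕ)
    (h : Subsingleton (G.H n)) : Subsingleton (F.H n) :=
  subsingleton_H_of_isIso (inv f) n h

end Powers

/-! ### Koszul presheaves and the vanishing of their second cohomology. -/

section Koszul

variable {E : (PSpace 3).Modules} {V : (PSpace 3).Opens} {b c d : ℤ}

/-- The open sets on which a coordinate does not vanish. -/
def coordBasis : Set (PSpace 3).Opens := {V | ∃ i, V ≤ UU i}

lemma exists_mem_UU (x : PSpace 3) : ∃ i, x ∈ UU i := by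
  have : x ∈ (⊤ : (PSpace 3).Opens) := trivial
  rw [← UU_sup] at this
  obtain ((h | h) | h) | h := this
  exacts [⟨_, h⟩, ⟨_, h⟩, ⟨_, h⟩, ⟨_, h⟩]

lemma isBasis_coordBasis : Opens.IsBasis coordBasis := by
  refine Opens.isBasis_iff_nbhd.2 fun {U x} hx => ?_
  obtain ⟨i, hi⟩ := exists_mem_UU x
  exact ⟨U ⊓ UU i, ⟨i, inf_le_right⟩, ⟨hx, hi⟩, inf_le_left⟩

lemma act_zs_injective (h : b + 1 = c) {i : Fin 4} (hV : V ≤ UU i) :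
    Function.Injective (act (E := E) h (zs i V)) := by
  rw [← zpw_one hV]
  exact Function.LeftInverse.injective (act_zpw_zpw hV h (by omega : c + -1 = b))

/-- Division by a coordinate. -/
def zdiv (h : b + 1 = c) {i : Fin 4} (hV : V ≤ UU i) : (EE E c).obj (op V) →+ (EE E b).obj (op V) :=
  act (by omega : c + -1 = b) (zpw hV (-1))

lemma zdiv_act (h : b + 1 = c) {i : Fin 4} (hV : V ≤ UU i) (z : (EE E b).obj (op V)) :
    zdiv h hV (act h (zs i V) z) = z := by
  rw [← zpw_one hV]
  exact act_zpw_zpw hV _ _ z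

lemma act_zdiv (h : b + 1 = c) {i : Fin 4} (hV : V ≤ UU i) (z : (EE E c).obj (op V)) :
    act h (zs i V) (zdiv h hV z) = z := by
  rw [← zpw_one hV]
  exact act_zpw_zpw hV _ _ z

lemma act_zdiv_comm (h : b + 1 = c) (h' : c + 1 = d) {i : Fin 4} (hV : V ≤ UU i) (k : Fin 4)
    (z : (EE E c).obj (op V)) :
    act h (zs k V) (zdiv h hV z) = zdiv h' hV (act h' (zs k V) z) :=
  act_comm _ _ _ _ _ _ _

lemma act_zs_comm (h : b + 1 = c) (h' : c + 1 = d) (k l : Fin 4) (z : (EE E b).obj (op V)) :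
    act h' (zs k V) (act h (zs l V) z) = act h' (zs l V) (act h (zs k V) z) :=
  act_comm _ _ _ _ _ _ _

variable (E)

/-- The morphism `(g_k) ↦ ∑ z_k g_k`. -/
def zsum (h : b + 1 = c) : pw (Fin 4) (EE E b) ⟶ EE E c :=
  ∑ k : Fin 4, pwProj (EE E b) k ≫ zop k h

/-- The morphism `e ↦ (z_k e)`. -/
def zdiag (h : b + 1 = c) : EE E b ⟶ pw (Fin 4) (EE E c) := pwLift fun k => zop k h

/-- The morphism `(h_k) ↦ (z_m h_n - z_n h_m)`. -/
def zwedge (h : b + 1 = c) : pw (Fin 4) (EE E b) ⟶ pw (Fin 4 × Fin 4) (EE E c) :=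
  pwLift fun p => pwProj (EE E b) p.2 ≫ zop p.1 h - pwProj (EE E b) p.1 ≫ zop p.2 h

variable {E}

lemma zsum_apply (h : b + 1 = c) (g : Fin 4 → (EE E b).obj (op V)) :
    (zsum E h).app (op V) g = ∑ k, act h (zs k V) (g k) := by
  rw [zsum, Fin.sum_univ_four, Fin.sum_univ_four]
  rfl

lemma rs_act_zs (h : b + 1 = c) (k : Fin 4) {W : (PSpace 3).Opens} (i : W ≤ V)
    (z : (EE E b).obj (op V)) : act h (zs k W) (rs i z) = rs i (act h (zs k V) z) :=
  (rs_act h (zs k V) i z).symm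

variable (E) in
/-- Families `(g_k)` with `∑ z_k g_k = 0`. -/
def kosOneSub (V : (PSpace 3).Opens) : AddSubgroup (Fin 4 → (EE E (-1)).obj (op V)) where
  carrier := {g | ∑ k, act (by rfl : (-1 : ℤ) + 1 = 0) (zs k V) (g k) = 0}
  zero_mem' := by simp
  add_mem' {f g} hf hg := by
    rw [Set.mem_ofPred_eq] at *
    simp only [Pi.add_apply, map_add, Finset.sum_add_distrib, hf, hg, add_zero]
  neg_mem' {f} hf := by
    rw [Set.mem_ofPred_eq] at *
    simp only [Pi.neg_apply, map_neg, Finset.sum_neg_distrib, hf, neg_zero]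

variable (E) in
/-- Alternating families `(w_mn)` with `z_l w_mn + z_m w_nl + z_n w_lm = 0`. -/
def kosTwoSub (V : (PSpace 3).Opens) : AddSubgroup (Fin 4 × Fin 4 → (EE E (-1)).obj (op V)) where
  carrier := {w | (∀ m, w (m, m) = 0) ∧ (∀ m n, w (m, n) = -w (n, m)) ∧
    ∀ l m n, act (by rfl : (-1 : ℤ) + 1 = 0) (zs l V) (w (m, n)) +
      act (by rfl : (-1 : ℤ) + 1 = 0) (zs m V) (w (n, l)) +
      act (by rfl : (-1 : ℤ) + 1 = 0) (zs n V) (w (l, m)) = 0}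
  zero_mem' := by simp
  add_mem' {f g} hf hg := by
    obtain ⟨h₁, h₂, h₃⟩ := hf
    obtain ⟨k₁, k₂, k₃⟩ := hg
    refine ⟨fun m => ?_, fun m n => ?_, fun l m n => ?_⟩
    · rw [Pi.add_apply, h₁, k₁, add_zero]
    · rw [Pi.add_apply, h₂, k₂, Pi.add_apply, neg_add]
    · have := congrArg₂ (· + ·) (h₃ l m n) (k₃ l m n)
      simp only [Pi.add_apply, map_add]
      rw [add_zero] at this
      rw [← this]
      abel
  neg_mem' {f} hf := by
    obtain ⟨h₁, h₂, h₃⟩ := hf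
    refine ⟨fun m => ?_, fun m n => ?_, fun l m n => ?_⟩
    · rw [Pi.neg_apply, h₁, neg_zero]
    · rw [Pi.neg_apply, h₂, Pi.neg_apply]
    · simp only [Pi.neg_apply, map_neg]
      rw [← neg_add, ← neg_add, h₃, neg_zero]

variable (E) in
/-- Families `(c_k)` with `z_m c_n = z_n c_m`. -/
def kosThreeSub (V : (PSpace 3).Opens) : AddSubgroup (Fin 4 → (EE E (-1)).obj (op V)) where
  carrier := {g | ∀ m n, act (by rfl : (-1 : ℤ) + 1 = 0) (zs m V) (g n) =
    act (by rfl : (-1 : ℤ) + 1 = 0) (zs n V) (g m)}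
  zero_mem' := by simp
  add_mem' {f g} hf hg m n := by
    simp only [Pi.add_apply, map_add, hf m n, hg m n]
  neg_mem' {f} hf m n := by
    simp only [Pi.neg_apply, map_neg, hf m n]

lemma kosOneSub_rs (U V : (PSpace 3).Opens) (i : V ≤ U) :
    ∀ g ∈ kosOneSub E U, (fun k => rs i (g k)) ∈ kosOneSub E V := by
  intro g (hg : ∑ k, _ = _)
  change ∑ k, _ = _
  simp only [rs_act_zs]
  have := congrArg (rs i) hg
  simp only [rs, map_sum, map_zero] at this ⊢
  exact this

lemma kosTwoSub_rs (U V : (PSpace 3).Opens) (i : V ≤ U) :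
    ∀ w ∈ kosTwoSub E U, (fun p => rs i (w p)) ∈ kosTwoSub E V := by
  rintro w ⟨h₁, h₂, h₃⟩
  refine ⟨fun m => ?_, fun m n => ?_, fun l m n => ?_⟩
  · exact (congrArg (rs i) (h₁ m)).trans (map_zero _)
  · exact (congrArg (rs i) (h₂ m n)).trans (map_neg _ _)
  · have := congrArg (rs i) (h₃ l m n)
    simp only [rs_act_zs]
    simp only [rs, map_add, map_zero] at this ⊢
    exact this

lemma kosThreeSub_rs (U V : (PSpace 3).Opens) (i : V ≤ U) :
    ∀ g ∈ kosThreeSub E U, (fun k => rs i (g k)) ∈ kosThreeSub E V := by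
  intro g hg m n
  simp only [rs_act_zs]
  rw [hg m n]

variable (E)

/-- The presheaf which will turn out to be `E(-1) ⊗ Ω¹(1)`. -/
def kosOne : AbPresheaf (PSpace 3) :=
  subP (pw (Fin 4) (EE E (-1))) (kosOneSub E) kosOneSub_rs

/-- The presheaf which will turn out to be `E(-1) ⊗ Ω²(2)`. -/
def kosTwo : AbPresheaf (PSpace 3) :=
  subP (pw (Fin 4 × Fin 4) (EE E (-1))) (kosTwoSub E) kosTwoSub_rs

/-- The presheaf which will turn out to be `E(-1) ⊗ Ω³(3)`. -/
def kosThree : AbPresheaf (PSpace 3) :=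
  subP (pw (Fin 4) (EE E (-1))) (kosThreeSub E) kosThreeSub_rs

/-- The Euler sequence tensored with E(-1). Only surjectivity needs an argument: where z_i is
invertible, s is the image of the family with z_i⁻¹ s in place i. -/
lemma locallyExact_kosOne :
    LocallyExact (subPι (pw (Fin 4) (EE E (-1))) (kosOneSub E) kosOneSub_rs)
      (zsum E (by rfl : (-1 : ℤ) + 1 = 0)) := by
  refine LocallyExact.of_basis isBasis_coordBasis ?_ ?_ ?_ ?_
  · ext U g
    exact (zsum_apply _ _).trans g.2
  · rintro V - s t h
    exact Subtype.ext h
  · rintro V - s hs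
    exact ⟨⟨s, (zsum_apply _ _).symm.trans hs⟩, rfl⟩
  · rintro V ⟨i, hV⟩ s
    refine ⟨Pi.single (M := fun _ => (EE E (-1)).obj (op V)) i (zdiv rfl hV s), ?_⟩
    refine (zsum_apply _ _).trans ?_
    rw [Finset.sum_eq_single i]
    · rw [Pi.single_eq_same, act_zdiv]
    · intro k _ hk
      rw [Pi.single_eq_of_ne hk, map_zero]
    · simp

/-- The map `(h_k) ↦ (z_m h_n - z_n h_m)` onto the presheaf of alternating families. -/
def kosTwoMap : pw (Fin 4) (EE E (-2)) ⟶ kosTwo E :=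
  subPLift (P := pw (Fin 4 × Fin 4) (EE E (-1))) (kosTwoSub E) kosTwoSub_rs
    (zwedge E (by rfl : (-2 : ℤ) + 1 = -1)) fun V (g : Fin 4 → (EE E (-2)).obj (op V)) => by
      change (fun p : Fin 4 × Fin 4 => act (by rfl : (-2 : ℤ) + 1 = -1) (zs p.1 V) (g p.2) -
        act (by rfl : (-2 : ℤ) + 1 = -1) (zs p.2 V) (g p.1)) ∈ kosTwoSub E V
      refine ⟨fun m => sub_self _, fun m n => (neg_sub _ _).symm, fun l m n => ?_⟩
      simp only [map_sub]
      rw [act_zs_comm _ _ m l, act_zs_comm _ _ n l, act_zs_comm _ _ n m]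
      abel

/-- The Koszul complex is contracted where z_i is invertible: contract with the i-th basis vector
and divide by z_i. This gives both exactness in the middle and the preimage of an alternating
family. -/
lemma locallyExact_kosTwo :
    LocallyExact (zdiag E (by rfl : (-3 : ℤ) + 1 = -2)) (kosTwoMap E) := by
  refine LocallyExact.of_basis isBasis_coordBasis ?_ ?_ ?_ ?_
  · ext U g
    refine Subtype.ext (funext fun p => ?_)
    change act _ (zs p.1 U.unop) (act _ (zs p.2 U.unop) g) -
      act _ (zs p.2 U.unop) (act _ (zs p.1 U.unop) g) = 0
    rw [act_zs_comm, sub_self]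
  · rintro V ⟨i, hV⟩ s t h
    exact act_zs_injective rfl hV (congrFun h i)
  · rintro V ⟨i, hV⟩ (s : Fin 4 → (EE E (-2)).obj (op V)) hs
    have hs' (m n : Fin 4) : act (c := -1) rfl (zs m V) (s n) = act rfl (zs n V) (s m) :=
      sub_eq_zero.1 (congrFun (congrArg Subtype.val hs) (m, n))
    refine ⟨zdiv rfl hV (s i), funext fun k => ?_⟩
    change act _ (zs k V) _ = _
    rw [act_zdiv_comm (d := -1) rfl rfl, hs' k i, zdiv_act]
  · rintro V ⟨i, hV⟩ ⟨w, h₁, h₂, h₃⟩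
    -- The Koszul relation for the indices i, m, n reads z_i w_mn = z_m w_in - z_n w_im, so the
    -- family w_ik / z_i is mapped to w.
    refine ⟨fun k => zdiv rfl hV (w (i, k)), Subtype.ext (funext fun p => ?_)⟩
    change act (b := -2) rfl (zs p.1 V) (zdiv rfl hV (w (i, p.2))) -
      act (b := -2) rfl (zs p.2 V) (zdiv rfl hV (w (i, p.1))) = w p
    rw [act_zdiv_comm (d := 0) rfl rfl, act_zdiv_comm (d := 0) rfl rfl, ← map_sub]
    have h₄ : act (c := 0) rfl (zs i V) (w (p.1, p.2)) + act (c := 0) rfl (zs p.1 V) (w (p.2, i)) +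
      act (c := 0) rfl (zs p.2 V) (w (i, p.1)) = 0 := h₃ i p.1 p.2
    rw [h₂ p.2 i, map_neg] at h₄
    have h : act (c := 0) rfl (zs p.1 V) (w (i, p.2)) - act (c := 0) rfl (zs p.2 V) (w (i, p.1)) =
        act (c := 0) rfl (zs i V) (w (p.1, p.2)) := by
      rw [← sub_eq_zero, ← neg_eq_zero, ← h₄]
      abel
    rw [h, zdiv_act]

/-- The map `e ↦ (z_k e)`. -/
def kosThreeMap : EE E (-2) ⟶ kosThree E :=
  subPLift (P := pw (Fin 4) (EE E (-1))) (kosThreeSub E) kosThreeSub_rs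
    (zdiag E (by rfl : (-2 : ℤ) + 1 = -1)) fun V g m n => act_zs_comm _ _ _ _ _

lemma bijOn_kosThreeMap : BijOn coordBasis (kosThreeMap E) := by
  rintro V ⟨i, hV⟩
  refine ⟨fun s t h => act_zs_injective rfl hV (congrFun (congrArg Subtype.val h) i), ?_⟩
  rintro ⟨g, hg⟩
  refine ⟨zdiv rfl hV (g i), Subtype.ext (funext fun k => ?_)⟩
  change act _ (zs k V) _ = _
  rw [act_zdiv_comm (d := 0) rfl rfl, hg k i, zdiv_act]

omit E in
lemma subsingleton_H_pw_planeTwist {N : ℕ} (c : ℤ) (n : ℕ)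
    (h : Subsingleton ((abSh (planeTwist c)).H n)) :
    Subsingleton ((aSh (pw (Fin N) (abSh (planeTwist c)).obj)).H n) := by
  refine subsingleton_H_pw _ _ ?_
  exact subsingleton_H_of_isIso' (F := aSh (abSh (planeTwist c)).obj)
    ((sheafificationAdjunction (Opens.grothendieckTopology (PSpace 3)) Ab).counit.app
      (abSh (planeTwist c))) n h

omit E in
lemma aShMap_comp {X : TopCat.{0}} {P Q R : AbPresheaf X} (f : P ⟶ Q) (g : Q ⟶ R) :
    aShMap (f ≫ g) = aShMap f ≫ aShMap g :=
  CategoryTheory.Functor.map_comp _ _ _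

section Vanishing

variable {E} (hE : ∀ b c (h : b + 1 = c), ∃ (N : ℕ)
  (ρ : EE E c ⟶ pw (Fin N) (abSh (planeTwist c)).obj), LocallyExact (zop (E := E) 0 h) ρ)
  (h₂ : Subsingleton ((aSh (EE E (-2))).H 2))
include hE h₂

/-- In the restriction sequence E(-1) lies between E(-2), where the vanishing is assumed, and a
power of 𝒪(-1) of the plane, where -1 > -3. -/
lemma subsingleton_H_two_neg_one : Subsingleton ((aSh (EE E (-1))).H 2) := by
  obtain ⟨N, ρ, hρ⟩ := hE (-2) (-1) rfl
  exact hρ.H_middle 2 h₂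
    (subsingleton_H_pw_planeTwist _ _ (subsingleton_H_two_planeTwist (by norm_num)))

/-- By the Euler sequence it suffices that H¹(E(-1))⁴ → H¹(E) be onto. Multiplication by z_0 factors
through this map and is onto in degree one, since H¹(𝒪) of the plane vanishes. -/
lemma subsingleton_H_two_kosOne : Subsingleton ((aSh (kosOne E)).H 2) := by
  obtain ⟨N, ρ, hρ⟩ := hE (-1) 0 rfl
  refine (locallyExact_kosOne E).H_left 1
    (subsingleton_H_pw _ _ (subsingleton_H_two_neg_one hE h₂)) fun y => ?_
  obtain ⟨x, rfl⟩ := hρ.H_surj 1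
    (subsingleton_H_pw_planeTwist _ _ subsingleton_H_one_planeTwist) y
  refine ⟨Hmap (aShMap (pwSingle (EE E (-1)) 0)) 1 x, ?_⟩
  have e : zop (E := E) 0 (by rfl : (-1 : ℤ) + 1 = 0) = pwSingle (EE E (-1)) 0 ≫ zsum E rfl := by
    ext V g
    symm
    refine (zsum_apply _ _).trans ?_
    rw [Finset.sum_eq_single 0]
    · change act _ _ (Pi.single (M := fun _ => (EE E (-1)).obj V) 0 g 0) = act _ _ g
      rw [Pi.single_eq_same]
    · intro k _ hk
      change act _ _ (Pi.single (M := fun _ => (EE E (-1)).obj V) 0 g k) = 0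
      rw [Pi.single_eq_of_ne hk, map_zero]
    · simp
  rw [e, aShMap_comp, Hmap_comp]

/-- It suffices that H³(E(-3)) → H³(E(-2))⁴ be injective. Its component at index 0 is multiplication
by z_0, which is injective because H²(𝒪(-2)) of the plane vanishes. -/
lemma subsingleton_H_two_kosTwo : Subsingleton ((aSh (kosTwo E)).H 2) := by
  obtain ⟨N, ρ, hρ⟩ := hE (-3) (-2) rfl
  refine (locallyExact_kosTwo E).H_right 2 (subsingleton_H_pw _ _ h₂) fun x hx => ?_
  refine hρ.H_inj 2
    (subsingleton_H_pw_planeTwist _ _ (subsingleton_H_two_planeTwist (by norm_num))) x ?_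
  rw [← pwLift_proj (fun k => zop (E := E) k (by rfl : (-3 : ℤ) + 1 = -2)) 0, aShMap_comp, Hmap_comp]
  exact (congrArg _ hx).trans (map_zero _)

omit hE in
lemma subsingleton_H_two_kosThree : Subsingleton ((aSh (kosThree E)).H 2) := by
  have := (bijOn_kosThreeMap E).isIso isBasis_coordBasis
  exact subsingleton_H_of_isIso (aShMap (kosThreeMap E)) 2 h₂

end Vanishing

end Koszul

/-! ### Germs of a pull-back of modules along a morphism surjective on stalks. -/

section Stalks

variable {X Y : Scheme.{0}}

/-- The stalk of a presheaf of modules. -/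
abbrev stk (M : PMod X) (x : X) : Type := TopCat.Presheaf.stalk (C := Ab) M.presheaf x

/-- The germ of a section. -/
def grm (M : PMod X) {U : X.Opens} {x : X} (hx : x ∈ U) : M.presheaf.obj (op U) →+ stk M x :=
  (TopCat.Presheaf.germ (C := Ab) M.presheaf U x hx).hom

/-- The germ of a regular function. -/
abbrev gr {U : X.Opens} {x : X} (hx : x ∈ U) : Γ(X, U) →+* X.presheaf.stalk x :=
  (X.presheaf.germ U x hx).hom

lemma grm_smul (M : PMod X) {U : X.Opens} {x : X} (hx : x ∈ U) (r : Γ(X, U))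
    (m : M.presheaf.obj (op U)) : grm M hx (r • m) = gr hx r • grm M hx m :=
  PresheafOfModules.germ_smul M x U hx r m

lemma grm_rs (M : PMod X) {U V : X.Opens} (i : V ≤ U) {x : X} (hx : x ∈ V)
    (m : M.presheaf.obj (op U)) : grm M hx (rs i m) = grm M (i hx) m :=
  TopCat.Presheaf.germ_res_apply (C := Ab) M.presheaf (homOfLE i) x hx m

lemma gr_rr {U V : X.Opens} (i : V ≤ U) {x : X} (hx : x ∈ V) (r : Γ(X, U)) :
    gr hx (rr i r) = gr (i hx) r :=
  TopCat.Presheaf.germ_res_apply X.presheaf (homOfLE i) x hx r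

lemma exists_grm (M : PMod X) {x : X} (s : stk M x) :
    ∃ (U : X.Opens) (hx : x ∈ U) (m : M.presheaf.obj (op U)), grm M hx m = s :=
  TopCat.Presheaf.exists_germ_eq (C := Ab) M.presheaf s

lemma grm_eq (M : PMod X) {x : X} {U V : X.Opens} (hU : x ∈ U) (hV : x ∈ V)
    (s : M.presheaf.obj (op U)) (t : M.presheaf.obj (op V)) (h : grm M hU s = grm M hV t) :
    ∃ (W : X.Opens) (_ : x ∈ W) (i : W ≤ U) (j : W ≤ V), rs i s = rs j t := by
  obtain ⟨W, hW, i, j, e⟩ := TopCat.Presheaf.germ_eq (C := Ab) M.presheaf x hU hV s t h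
  exact ⟨W, hW, i.le, j.le, e⟩

section Family

variable (M : X → Type) [∀ x, AddCommGroup (M x)]

/-- The presheaf of all families of elements of given groups. -/
def familyPresheaf : TopCat.Presheaf Ab.{0} X where
  obj U := AddCommGrpCat.of (∀ x : U.unop, M x.1)
  map i := AddCommGrpCat.ofHom (AddMonoidHom.mk' (fun s x => s (i.unop x)) fun _ _ => rfl)

lemma familyPresheaf_isSheaf : (familyPresheaf M).IsSheaf :=
  (TopCat.Presheaf.isSheaf_iff_isSheaf_comp (forget Ab) (familyPresheaf M)).mpr
    (TopCat.Presheaf.isSheaf_of_iso (NatIso.ofComponents (fun _ => Iso.refl _) (by cat_disch))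
      (TopCat.Presheaf.toTypes_isSheaf X M))

variable [∀ x, Module (X.presheaf.stalk x) (M x)]

instance (U : (Opens X)ᵒᵖ) : Module (X.ringCatSheaf.obj.obj U) ((familyPresheaf M).obj U) :=
  show Module Γ(X, U.unop) (∀ x : U.unop, M x.1) from
  { smul r s x := gr x.2 r • s x
    one_smul s := funext fun x => by
      change gr x.2 1 • s x = s x
      rw [map_one, one_smul]
    mul_smul r r' s := funext fun x => by
      change gr x.2 (r * r') • s x = gr x.2 r • gr x.2 r' • s x
      rw [map_mul, mul_smul]
    smul_zero r := funext fun x => smul_zero _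
    smul_add r s t := funext fun x => smul_add _ _ _
    add_smul r r' s := funext fun x => by
      change gr x.2 (r + r') • s x = gr x.2 r • s x + gr x.2 r' • s x
      rw [map_add, add_smul]
    zero_smul s := funext fun x => by
      change gr x.2 0 • s x = 0
      rw [map_zero, zero_smul] }

/-- The sheaf of modules of all families of elements of given modules over the local rings. -/
def familySheaf : X.Modules where
  val := PresheafOfModules.ofPresheaf (R := X.ringCatSheaf.obj) (familyPresheaf M)
    (fun _ _ i r s => funext fun x => congrArg (· • s (i.unop x)) (gr_rr i.unop.le x.2 r).symm)
  isSheaf := familyPresheaf_isSheaf M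

/-- The sections of a sheaf of families. -/
abbrev fam (U : X.Opens) : Type := ∀ x : U, M x.1

end Family

/-- Construction of morphisms of sheaves of modules. -/
def modHom {F G : X.Modules} (a : (pm F).presheaf ⟶ (pm G).presheaf)
    (h : ∀ (V : X.Opens) (r : Γ(X, V)) (m : (pm F).presheaf.obj (op V)),
      a.app (op V) (r • m) = r • a.app (op V) m) : F ⟶ G :=
  SheafOfModules.Hom.mk (PresheafOfModules.homMk a fun V r m => h V.unop r m)

/-- The morphism of presheaves underlying a morphism of sheaves of modules. -/
def pmMap {F G : X.Modules} (φ : F ⟶ G) : (pm F).presheaf ⟶ (pm G).presheaf :=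
  (Scheme.Modules.toPresheaf X).map φ

lemma pmMap_smul {F G : X.Modules} (φ : F ⟶ G) {V : X.Opens} (r : Γ(X, V))
    (m : (pm F).presheaf.obj (op V)) :
    (pmMap φ).app (op V) (r • m) = r • (pmMap φ).app (op V) m :=
  (φ.val.app (op V)).hom.map_smul r m

variable (f : X ⟶ Y) (E : Y.Modules)

/-- The unit `E ⟶ f_* f^* E`. -/
def unitMap : (pm E).presheaf ⟶ (pm ((Scheme.Modules.pushforward f).obj
    ((Scheme.Modules.pullback f).obj E))).presheaf :=
  pmMap ((Scheme.Modules.pullbackPushforwardAdjunction f).unit.app E)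

/-- The pull-back of a section. -/
def pb (V : Y.Opens) : (pm E).presheaf.obj (op V) →+
    (pm ((Scheme.Modules.pullback f).obj E)).presheaf.obj (op (f ⁻¹ᵁ V)) :=
  ((unitMap f E).app (op V)).hom

variable {f E}

lemma preimage_le {U V : Y.Opens} (i : V ≤ U) : f ⁻¹ᵁ V ≤ f ⁻¹ᵁ U := fun _ hx => i hx

lemma rs_pb {U V : Y.Opens} (i : V ≤ U) (e : (pm E).presheaf.obj (op U)) :
    rs (preimage_le i) (pb f E U e) = pb f E V (rs i e) :=
  rs_app (unitMap f E) i e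

lemma grm_pb_rs {U V : Y.Opens} (i : V ≤ U) {x : X} (hx : x ∈ f ⁻¹ᵁ V)
    (e : (pm E).presheaf.obj (op U)) :
    grm _ hx (pb f E V (rs i e)) = grm _ (preimage_le i hx) (pb f E U e) := by
  rw [← rs_pb, grm_rs]

lemma pb_smul {V : Y.Opens} (r : Γ(Y, V)) (e : (pm E).presheaf.obj (op V)) :
    pb f E V (r • e) = (f.app V).hom r • pb f E V e :=
  pmMap_smul ((Scheme.Modules.pullbackPushforwardAdjunction f).unit.app E) r e

lemma gr_app {V : Y.Opens} {x : X} (hx : f x ∈ V) (r : Γ(Y, V)) :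
    gr (U := f ⁻¹ᵁ V) hx ((f.app V).hom r) = (f.stalkMap x).hom (gr hx r) :=
  (f.germ_stalkMap_apply V x hx r).symm

section Surjective

variable [SurjectiveOnStalks f]

variable (f E) in
/-- The germs of pull-backs of sections. -/
def pbSub (x : X) : Submodule (X.presheaf.stalk x) (stk (pm ((Scheme.Modules.pullback f).obj E)) x) where
  carrier := {t | ∃ (U : Y.Opens) (hx : f x ∈ U) (e : (pm E).presheaf.obj (op U)),
    grm _ (U := f ⁻¹ᵁ U) hx (pb f E U e) = t}
  zero_mem' := ⟨⊤, trivial, 0, by rw [map_zero, map_zero]⟩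
  add_mem' := by
    rintro _ _ ⟨U, hU, e, rfl⟩ ⟨V, hV, e', rfl⟩
    refine ⟨U ⊓ V, ⟨hU, hV⟩, rs inf_le_left e + rs inf_le_right e', ?_⟩
    rw [map_add, map_add]
    exact congrArg₂ (· + ·) (grm_pb_rs inf_le_left _ e) (grm_pb_rs inf_le_right _ e')
  smul_mem' := by
    rintro r _ ⟨U, hU, e, rfl⟩
    obtain ⟨r', rfl⟩ := f.stalkMap_surjective x r
    obtain ⟨V, hV, s, rfl⟩ := Y.presheaf.exists_germ_eq r'
    refine ⟨U ⊓ V, ⟨hU, hV⟩, rr (inf_le_right : U ⊓ V ≤ V) s • rs (inf_le_left : U ⊓ V ≤ U) e, ?_⟩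
    refine (congrArg _ (pb_smul _ _)).trans ((grm_smul _ _ _ _).trans ?_)
    refine congrArg₂ (· • ·) ?_ (grm_pb_rs inf_le_left _ e)
    exact (gr_app _ _).trans (congrArg _ (gr_rr _ _ _))

omit [SurjectiveOnStalks f] in
variable (E) in
/-- Two morphisms out of a pull-back agree if they agree on pull-backs of sections. -/
lemma pullback_hom_ext {G : X.Modules} (φ ψ : (Scheme.Modules.pullback f).obj E ⟶ G)
    (h : ∀ (V : Y.Opens) (e : (pm E).presheaf.obj (op V)),
      (pmMap φ).app (op (f ⁻¹ᵁ V)) (pb f E V e) = (pmMap ψ).app (op (f ⁻¹ᵁ V)) (pb f E V e)) :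
    φ = ψ := by
  apply ((Scheme.Modules.pullbackPushforwardAdjunction f).homEquiv E G).injective
  rw [Adjunction.homEquiv_unit, Adjunction.homEquiv_unit]
  refine Scheme.Modules.hom_ext _ _ fun V => ?_
  ext e
  exact h V e

omit [SurjectiveOnStalks f] in
variable (f) in
/-- Morphisms into a direct image factor through the unit. -/
lemma exists_pullback_desc {G : X.Modules} (φ : E ⟶ (Scheme.Modules.pushforward f).obj G) :
    ∃ ψ : (Scheme.Modules.pullback f).obj E ⟶ G, ∀ (V : Y.Opens) (e : (pm E).presheaf.obj (op V)),
      (pmMap ψ).app (op (f ⁻¹ᵁ V)) (pb f E V e) = (pmMap φ).app (op V) e := by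
  obtain ⟨ψ, rfl⟩ := ((Scheme.Modules.pullbackPushforwardAdjunction f).homEquiv E G).surjective φ
  refine ⟨ψ, fun V e => ?_⟩
  rw [Adjunction.homEquiv_unit]
  rfl

/-- Every germ of `f^* E` is the germ of the pull-back of a section. -/
lemma mem_pbSub {W : X.Opens} {x : X} (hx : x ∈ W)
    (s : (pm ((Scheme.Modules.pullback f).obj E)).presheaf.obj (op W)) :
    grm _ hx s ∈ pbSub f E x := by
  let F := (Scheme.Modules.pullback f).obj E
  -- The map to the stalks modulo germs of pulled-back sections kills every pulled-back section, so
  -- it is zero by the uniqueness in the adjunction. The target consists of arbitrary families and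
  -- is a sheaf for free.
  let G : X.Modules := familySheaf fun y => stk (pm F) y ⧸ pbSub f E y
  let a : (pm F).presheaf ⟶ (pm G).presheaf :=
    { app V := AddCommGrpCat.ofHom (AddMonoidHom.mk'
        (fun s => (fun y => (pbSub f E y.1).mkQ (grm (pm F) y.2 s) :
          fam (fun y => stk (pm F) y ⧸ pbSub f E y) V.unop))
        fun s t => funext fun y => congrArg (pbSub f E y.1).mkQ (map_add (grm (pm F) y.2) s t))
      naturality U V i := by
        ext s
        refine funext fun y => ?_
        exact congrArg (pbSub f E y.1).mkQ (grm_rs (pm F) i.unop.le y.2 s) }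
  let q : F ⟶ G := modHom a fun V r s => funext fun y =>
    (congrArg (pbSub f E y.1).mkQ (grm_smul (pm F) y.2 r s)).trans (map_smul _ _ _)
  have hq : q = 0 := by
    refine pullback_hom_ext E _ _ fun V e => funext fun y => ?_
    exact (Submodule.Quotient.mk_eq_zero _).2 ⟨V, y.2, e, rfl⟩
  have h : (pmMap q).app (op W) s = 0 := by rw [hq]; rfl
  exact (Submodule.Quotient.mk_eq_zero _).1 (congrFun h ⟨x, hx⟩)

/-- The kernel of the restriction to the local ring of a subscheme. -/
abbrev kerStalk (f : X ⟶ Y) (x : X) : Ideal (Y.presheaf.stalk (f x)) :=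
  RingHom.ker (f.stalkMap x).hom

/-- The stalk of `E` modulo the equations of a subscheme. -/
abbrev quotStalk (f : X ⟶ Y) (E : Y.Modules) (x : X) : Type :=
  stk (pm E) (f x) ⧸ (kerStalk f x • ⊤ : Submodule (Y.presheaf.stalk (f x)) (stk (pm E) (f x)))

instance (x : X) : Module (X.presheaf.stalk x) (quotStalk f E x) :=
  Module.compHom _ ((RingHom.quotientKerEquivOfSurjective (f := (f.stalkMap x).hom)
    (f.stalkMap_surjective x)).symm : X.presheaf.stalk x →+* Y.presheaf.stalk (f x) ⧸ kerStalk f x)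

lemma stalkMap_smul_mk (x : X) (r : Y.presheaf.stalk (f x)) (m : stk (pm E) (f x)) :
    (f.stalkMap x).hom r • (Submodule.Quotient.mk m : quotStalk f E x) =
      Submodule.Quotient.mk (r • m) := by
  have : (RingHom.quotientKerEquivOfSurjective (f := (f.stalkMap x).hom)
    (f.stalkMap_surjective x)).symm ((f.stalkMap x).hom r) = Ideal.Quotient.mk _ r := by
    rw [RingEquiv.symm_apply_eq]
    rfl
  change (RingHom.quotientKerEquivOfSurjective (f := (f.stalkMap x).hom)
    (f.stalkMap_surjective x)).symm ((f.stalkMap x).hom r) • (Submodule.Quotient.mk m :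
      stk (pm E) (f x) ⧸ (kerStalk f x • ⊤ : Submodule (Y.presheaf.stalk (f x)) (stk (pm E) (f x)))) = _
  rw [this]
  rfl

/-- The kernel of the pull-back of sections. -/
lemma grm_mem_of_pb_eq_zero {V : Y.Opens} (e : (pm E).presheaf.obj (op V)) (he : pb f E V e = 0)
    {x : X} (hx : f x ∈ V) :
    grm (pm E) hx e ∈ (kerStalk f x • ⊤ : Submodule (Y.presheaf.stalk (f x)) (stk (pm E) (f x))) := by
  -- The reduction of germs modulo the kernel ideal is linear over the local rings of the subscheme,
  -- hence factors through the pull-back; a section with zero pull-back has zero reductions.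
  let G : X.Modules := familySheaf (quotStalk f E)
  let a : (pm E).presheaf ⟶ (pm ((Scheme.Modules.pushforward f).obj G)).presheaf :=
    { app V := AddCommGrpCat.ofHom (AddMonoidHom.mk'
        (fun s => (fun y => Submodule.Quotient.mk (grm (pm E) (U := V.unop) y.2 s) :
          fam (quotStalk f E) (f ⁻¹ᵁ V.unop)))
        fun s t => funext fun y => congrArg Submodule.Quotient.mk (map_add _ _ _))
      naturality U V i := by
        ext s
        refine funext fun y => ?_
        exact congrArg Submodule.Quotient.mk (grm_rs (pm E) i.unop.le y.2 s) }
  let q : E ⟶ (Scheme.Modules.pushforward f).obj G := modHom a fun V r s => funext fun y => by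
    refine (congrArg Submodule.Quotient.mk (grm_smul (pm E) (U := V) y.2 r s)).trans ?_
    refine (stalkMap_smul_mk _ _ _).symm.trans ?_
    exact congrArg (· • (Submodule.Quotient.mk (grm (pm E) (U := V) y.2 s) : quotStalk f E y.1))
      (gr_app (V := V) y.2 r).symm
  obtain ⟨ψ, hψ⟩ := exists_pullback_desc f q
  have h := hψ V e
  rw [he, map_zero] at h
  exact (Submodule.Quotient.mk_eq_zero _).1 (congrFun h ⟨x, hx⟩).symm

end Surjective

end Stalks

/-! ### Coordinates on a free sheaf of modules. -/

section Coordinates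

variable {X : Scheme.{0}}

/-- The structure sheaf as a sheaf of modules. -/
def strSheaf (X : Scheme.{0}) : X.Modules := SheafOfModules.unit X.ringCatSheaf

/-- A section of the structure sheaf as a regular function. -/
def toReg {V : X.Opens} : (pm (strSheaf X)).presheaf.obj (op V) →+ Γ(X, V) where
  toFun s := s
  map_zero' := rfl
  map_add' _ _ := rfl

lemma toReg_injective {V : X.Opens} : Function.Injective (toReg (X := X) (V := V)) := fun _ _ h => h

lemma toReg_surjective {V : X.Opens} : Function.Surjective (toReg (X := X) (V := V)) := fun r => ⟨r, rfl⟩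

lemma toReg_smul {V : X.Opens} (r : Γ(X, V)) (s) : toReg (X := X) (r • s) = r * toReg s := rfl

lemma toReg_rs {U V : X.Opens} (i : V ≤ U) (s) : toReg (X := X) (rs i s) = rr i (toReg s) := rfl

lemma pmMap_sum {ι : Type} (S : Finset ι) {F G : X.Modules} (f : ι → (F ⟶ G)) {V : X.Opens}
    (s : (pm F).presheaf.obj (op V)) :
    (pmMap (∑ k ∈ S, f k)).app (op V) s = ∑ k ∈ S, (pmMap (f k)).app (op V) s := by
  let φ : (F ⟶ G) →+ (pm G).presheaf.obj (op V) :=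
    AddMonoidHom.mk' (fun f => (pmMap f).app (op V) s) fun f g => rfl
  exact map_sum φ f S

/-- Coordinates on a free sheaf. -/
lemma exists_coordinates {G : X.Modules} {N : ℕ} (θ : G ≅ freeSheaf X N) :
    ∃ κ : Fin N → (G ⟶ strSheaf X), ∀ V : X.Opens, Function.Bijective
      (fun (s : (pm G).presheaf.obj (op V)) k => toReg ((pmMap (κ k)).app (op V) s)) := by
  let ι : Fin N → (strSheaf X ⟶ freeSheaf X N) := fun k => SheafOfModules.ιFree k
  have hι : ∀ {K : X.Modules} (p q : freeSheaf X N ⟶ K), (∀ k, ι k ≫ p = ι k ≫ q) → p = q :=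
    fun p q h => Cofan.IsColimit.hom_ext
      (SheafOfModules.isColimitFreeCofan (R := X.ringCatSheaf) (Fin N)) p q h
  -- Projections come from the coproduct property. Together with the inclusions they present the
  -- free sheaf as a biproduct, which gives bijectivity on sections.
  have hπ : ∃ π : Fin N → (freeSheaf X N ⟶ strSheaf X), ∀ j k, ι j ≫ π k = if j = k then 𝟙 _ else 0 := by
    let a (k j : Fin N) : strSheaf X ⟶ strSheaf X := if j = k then 𝟙 _ else 0
    exact ⟨fun k => Cofan.IsColimit.desc
      (SheafOfModules.isColimitFreeCofan (R := X.ringCatSheaf) (Fin N)) (a k),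
      fun j k => Cofan.IsColimit.fac _ _ _⟩
  obtain ⟨π, hπ⟩ := hπ
  have hid : ∑ k, π k ≫ ι k = 𝟙 _ := by
    refine hι _ _ fun j => ?_
    rw [Preadditive.comp_sum, Finset.sum_eq_single j]
    · rw [← Category.assoc, hπ, if_pos rfl, Category.id_comp, Category.comp_id]
    · intro k _ hk
      rw [← Category.assoc, hπ, if_neg (Ne.symm hk), zero_comp]
    · simp
  refine ⟨fun k => θ.hom ≫ π k, fun V => ⟨fun s t h => ?_, fun r => ?_⟩⟩
  · have key : ∀ u : (pm G).presheaf.obj (op V), u = (pmMap θ.inv).app (op V)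
        (∑ k, (pmMap (ι k)).app (op V) ((pmMap (θ.hom ≫ π k)).app (op V) u)) := by
      intro u
      have h1 : θ.hom ≫ (∑ k, π k ≫ ι k) ≫ θ.inv = 𝟙 _ := by
        rw [hid, Category.id_comp, Iso.hom_inv_id]
      have h2 : (pmMap (θ.hom ≫ (∑ k, π k ≫ ι k) ≫ θ.inv)).app (op V) u = u := by
        rw [h1]; rfl
      rw [← h2]
      refine congrArg ((pmMap θ.inv).app (op V)) ?_
      refine (pmMap_sum _ _ _).trans ?_
      rw [h2]
      rfl
    rw [key s, key t]
    refine congrArg _ (Finset.sum_congr rfl fun k _ => ?_)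
    exact congrArg _ (toReg_injective (congrFun h k))
  · choose s hs using fun k => toReg_surjective (r k)
    refine ⟨(pmMap θ.inv).app (op V) (∑ k, (pmMap (ι k)).app (op V) (s k)), funext fun k => ?_⟩
    have h1 : θ.inv ≫ θ.hom ≫ π k = π k := by rw [Iso.inv_hom_id_assoc]
    have h2 : ∀ u, (pmMap (θ.hom ≫ π k)).app (op V) ((pmMap θ.inv).app (op V) u) =
        (pmMap (π k)).app (op V) u := fun u => by
      conv_rhs => rw [← h1]
      rfl
    simp only
    rw [h2, map_sum, map_sum, Finset.sum_eq_single k, ← hs k]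
    · have h3 : (pmMap (ι k ≫ π k)).app (op V) (s k) = s k := by
        rw [hπ, if_pos rfl]; rfl
      exact congrArg toReg h3
    · intro j _ hj
      have h3 : (pmMap (ι j ≫ π k)).app (op V) (s j) = 0 := by
        rw [hπ, if_neg hj]; rfl
      exact congrArg toReg h3
    · simp

end Coordinates

/-! ### The local equation of the plane. -/

section HyperplaneGeometry

/-- The inclusion of the plane at infinity. -/
abbrev hpl : PSpace 2 ⟶ PSpace 3 := hyperplane 2

/-- The point of `ℙ³` below a point of the plane. -/
abbrev hpt (y : ProjectiveSpectrum (grading 3)) : ProjectiveSpectrum (grading 4) := hpl y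

/-- The homomorphism between the local rings of the cones. -/
def lh (y : ProjectiveSpectrum (grading 3)) : Loc (grading 4) (hpt y) →+* Loc (grading 3) y :=
  Localization.localRingHom _ _ (setZero 2 : MvPolynomial (Fin 4) ℂ →+* MvPolynomial (Fin 3) ℂ) rfl

lemma lh_al (y : ProjectiveSpectrum (grading 3)) (r : MvPolynomial (Fin 4) ℂ) :
    lh y (al (hpt y) r) = al y (setZero 2 r) :=
  Localization.localRingHom_to_map _ _ _ _ _

lemma lh_mul_al {y : ProjectiveSpectrum (grading 3)} {u : Loc (grading 4) (hpt y)}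
    {r s : MvPolynomial (Fin 4) ℂ} (h : u * al (hpt y) s = al (hpt y) r) :
    lh y u * al y (setZero 2 s) = al y (setZero 2 r) := by
  rw [← lh_al, ← lh_al, ← map_mul, h]

/-- The restriction of a regular function to the plane. -/
abbrev hres (V : (PSpace 3).Opens) : Γ(PSpace 3, V) →+* Γ(PSpace 2, hpl ⁻¹ᵁ V) := (hpl.app V).hom

lemma fval_hres {V : (PSpace 3).Opens} (a : Reg (grading 4) V) (y : ProjectiveSpectrum (grading 3))
    (hy : hpt y ∈ V) :
    fval (V := hpl ⁻¹ᵁ V) (𝒜 := grading 3) (hres V a) ⟨y, hy⟩ = lh y (fval a ⟨hpt y, hy⟩) :=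
  HomogeneousLocalization.val_localRingHom _

/-- Modulo z_0 every polynomial agrees with the one obtained by setting z_0 to zero and shifting the
variables back. -/
lemma setZero_eq_zero {r : MvPolynomial (Fin 4) ℂ} (h : setZero 2 r = 0) : X 0 ∣ r := by
  have key : ∀ p : MvPolynomial (Fin 4) ℂ, X 0 ∣ p - rename Fin.succ (setZero 2 p) := by
    intro p
    induction p using MvPolynomial.induction_on with
    | C a =>
      have : setZero 2 (C a) = C a := by
        change aeval _ (C a) = _
        simp
      rw [this, rename_C, sub_self]
      exact dvd_zero _
    | add p q hp hq =>
      rw [map_add, map_add, add_sub_add_comm]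
      exact dvd_add hp hq
    | mul_X p k hp =>
      rw [map_mul, map_mul]
      refine Fin.cases ?_ (fun k => ?_) k
      · rw [setZero_X_zero, map_zero, mul_zero, sub_zero]
        exact dvd_mul_left _ _
      · rw [setZero_X_succ, rename_X, ← sub_mul]
        exact hp.mul_right _
  have := key r
  rwa [h, map_zero, sub_zero] at this

lemma sub_rename_mem {r : MvPolynomial (Fin 4) ℂ} : X 0 ∣ r - rename Fin.succ (setZero 2 r) :=
  setZero_eq_zero (by rw [map_sub, setZero_rename, sub_self])

/-- Existence of a regular function given by a fraction. -/
lemma exists_reg {n m : ℕ} {V : Opens (ProjectiveSpectrum.top (grading n))} {r s : MvPolynomial (Fin n) ℂ}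
    (hr : r ∈ grading n m) (hs : s ∈ grading n m) (h : ∀ x ∈ V, s ∉ x.asHomogeneousIdeal) :
    ∃ a : Reg (grading n) V, ∀ x, fval a x * al x.1 s = al x.1 r := by
  obtain ⟨a, ha⟩ := exists_fval (twFrac (b := 0) (V := V) (by simp) hr hs h)
  exact ⟨a, fun x => by rw [ha]; exact twFrac_mul_al _ hr hs h x⟩

/-- Regular functions are locally fractions. -/
lemma exists_fraction {n : ℕ} {V : Opens (ProjectiveSpectrum.top (grading n))} (a : Reg (grading n) V)
    {x : ProjectiveSpectrum.top (grading n)} (hx : x ∈ V) :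
    ∃ (W : Opens (ProjectiveSpectrum.top (grading n))) (_ : x ∈ W) (i : W ≤ V) (m : ℕ)
      (r s : MvPolynomial (Fin n) ℂ), r ∈ grading n m ∧ s ∈ grading n m ∧
      ∀ y : W, s ∉ y.1.asHomogeneousIdeal ∧ fval a ⟨y.1, i y.2⟩ * al y.1 s = al y.1 r := by
  obtain ⟨W, hW, i, m, r, s, hs, h⟩ := a.2 ⟨x, hx⟩
  refine ⟨W, hW, i.le, m, r.1, s.1, r.2, s.2, fun y => ⟨hs y, ?_⟩⟩
  refine (eq_mk_iff (hs y) _).1 ?_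
  exact (congrArg HomogeneousLocalization.val (h y)).trans (HomogeneousLocalization.val_mk _)

lemma gr_eq_of_fval {n : ℕ} {U V W : (PSpace n).Opens} {x : PSpace n} (hW : x ∈ W)
    (i : W ≤ U) (j : W ≤ V) (a : Γ(PSpace n, U)) (b : Γ(PSpace n, V))
    (h : ∀ (y : ProjectiveSpectrum.top (grading (n + 1))) (hy : y ∈ W),
      fval (V := U) (𝒜 := grading (n + 1)) a ⟨y, i hy⟩ = fval (V := V) (𝒜 := grading (n + 1)) b ⟨y, j hy⟩) :
    gr (i hW) a = gr (j hW) b := by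
  rw [← gr_rr i hW, ← gr_rr j hW]
  exact congrArg (gr hW) (fval_ext (V := W) (𝒜 := grading (n + 1)) fun y => h y.1 y.2)

lemma fval_eq_zero_of_gr {n : ℕ} {U : (PSpace n).Opens} {x : ProjectiveSpectrum.top (grading (n + 1))}
    (hx : x ∈ U) (a : Γ(PSpace n, U)) (h : gr (X := PSpace n) hx a = 0) :
    fval (V := U) (𝒜 := grading (n + 1)) a ⟨x, hx⟩ = 0 := by
  obtain ⟨W, hW, i, j, e⟩ := TopCat.Presheaf.germ_eq (PSpace n).presheaf x hx hx a 0
    (h.trans (map_zero _).symm)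
  have h1 := congrArg (fun b : Reg (grading (n + 1)) W => fval b ⟨x, hW⟩) e
  refine h1.trans ?_
  have h2 : rr (X := PSpace n) j.le 0 = 0 := map_zero _
  exact (congrArg (fun b : Reg (grading (n + 1)) W => fval b ⟨x, hW⟩) h2).trans (fval_zero _)

/-- A local fraction on the plane lifts by regarding numerator and denominator as forms in z_1, z_2,
z_3. -/
instance : SurjectiveOnStalks hpl := by
  refine ⟨fun y t => ?_⟩
  obtain ⟨W, hW, a, rfl⟩ := (PSpace 2).presheaf.exists_germ_eq t
  obtain ⟨W', hW', i, m, r, s, hr, hs, h⟩ := exists_fraction (n := 3) (V := W) a hW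
  have hm {p : MvPolynomial (Fin 3) ℂ} (hp : p ∈ grading 3 m) : rename Fin.succ p ∈ grading 4 m :=
    IsHomogeneous.rename_isHomogeneous hp
  let V : (PSpace 3).Opens := Proj.basicOpen (grading 4) (rename Fin.succ s)
  obtain ⟨b, hb⟩ := exists_reg (V := V) (hm hr) (hm hs) fun x hx => hx
  have hyV : hpl y ∈ V := by
    change setZero 2 (rename Fin.succ s) ∉ ProjectiveSpectrum.asHomogeneousIdeal (𝒜 := grading 3) y
    rw [setZero_rename]
    exact (h ⟨y, hW'⟩).1
  refine ⟨gr hyV b, ?_⟩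
  refine (gr_app hyV b).symm.trans ?_
  refine gr_eq_of_fval (W := hpl ⁻¹ᵁ V ⊓ W') ⟨hyV, hW'⟩ inf_le_left (inf_le_right.trans i) _ a ?_
  intro z hz
  refine (fval_hres b z hz.1).trans ?_
  apply (isUnit_al (h ⟨z, hz.2⟩).1).mul_left_injective
  have h1 := lh_mul_al (hb ⟨hpt z, hz.1⟩)
  rw [setZero_rename, setZero_rename] at h1
  exact h1.trans (h ⟨z, hz.2⟩).2.symm

/-- The regular function `z_k / z_i`. -/
lemma exists_ratio (i k : Fin 4) {V : (PSpace 3).Opens} (hV : V ≤ UU i) :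
    ∃ a : Reg (grading 4) V, ∀ x, fval a x * al x.1 (X i) = al x.1 (X k) :=
  exists_reg (X_mem_grading k) (X_mem_grading i) fun _ hx => hV hx

/-- The regular function `z_k / z_i` where `z_i` does not vanish. -/
def ratio {i : Fin 4} (k : Fin 4) {V : (PSpace 3).Opens} (hV : V ≤ UU i) : Γ(PSpace 3, V) :=
  (exists_ratio i k hV).choose

lemma fval_ratio {i : Fin 4} (k : Fin 4) {V : (PSpace 3).Opens} (hV : V ≤ UU i) (x : V) :
    fval (V := V) (𝒜 := grading 4) (ratio k hV) x * al (𝒜 := grading 4) x.1 (X i) = al x.1 (X k) :=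
  (exists_ratio i k hV).choose_spec x

lemma rr_ratio {i : Fin 4} (k : Fin 4) {V W : (PSpace 3).Opens} (hV : V ≤ UU i) (h : W ≤ V) :
    rr h (ratio k hV) = ratio k (h.trans hV) := by
  refine fval_ext (V := W) (𝒜 := grading 4) fun x => ?_
  apply (isUnit_al (h.trans hV x.2)).mul_left_injective
  exact (fval_ratio k hV ⟨x.1, h x.2⟩).trans (fval_ratio k (h.trans hV) x).symm

lemma mul_cancel_aux {R : Type} [CommRing R] {a b r s t u v : R} (h₁ : a * s = u * v)
    (h₂ : b * s = t * v) (h₃ : r * t = u) : b * r * (s * t) = a * (s * t) := by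
  linear_combination r * t * h₂ + t * v * h₃ - t * h₁

/-- The equation of the plane generates the kernel of restriction to the plane. -/
lemma kerStalk_le {i : Fin 4} (y : PSpace 2) (hy : hpl y ∈ UU i) :
    kerStalk hpl y ≤ Ideal.span {gr hy (ratio 0 le_rfl)} := by
  intro t ht
  obtain ⟨V, hV, a, rfl⟩ := (PSpace 3).presheaf.exists_germ_eq t
  obtain ⟨W, hW, j, m, r, s, hr, hs, h⟩ := exists_fraction (n := 4) (V := V) a hV
  have h0 : fval (V := hpl ⁻¹ᵁ V) (𝒜 := grading 3) (hres V a) ⟨y, hV⟩ = 0 :=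
    fval_eq_zero_of_gr (n := 2) (U := hpl ⁻¹ᵁ V) (x := y) hV (hres V a) ((gr_app hV a).trans ht)
  rw [fval_hres a y hV] at h0
  have h1 := lh_mul_al (h ⟨hpt y, hW⟩).2
  rw [h0, zero_mul] at h1
  have h2 : setZero 2 r = 0 := al_injective (n := 3) y (h1.symm.trans (map_zero _).symm)
  -- The factorization wanted is r/s = (z_0/z_i) · (z_i u / s), so z_i u must again have degree m.
  -- In degree zero r is a constant vanishing on the plane, so u = 0 works.
  obtain ⟨u, hu⟩ : ∃ u, r = X 0 * u ∧ X i * u ∈ grading 4 m := by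
    obtain ⟨u, hu⟩ := setZero_eq_zero h2
    rcases m with - | m
    · have h3 : r = C (coeff 0 r) :=
        totalDegree_eq_zero_iff_eq_C.1 (Nat.le_zero.1 (IsHomogeneous.totalDegree_le hr))
      have h4 : setZero 2 (C (coeff 0 r)) = C (coeff 0 r) := by
        change aeval _ (C (coeff 0 r)) = _
        simp
      rw [← h3, h2, eq_comm, C_eq_zero] at h4
      exact ⟨0, by rw [h3, h4]; simp, by simp⟩
    · refine ⟨u, hu, ?_⟩
      have h3 := isHomogeneous_divMonomial (j := m) hr 0 (add_comm 1 m)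
      rw [hu, X_mul_divMonomial] at h3
      exact add_comm 1 m ▸ (isHomogeneous_X _ _).mul h3
  obtain ⟨b, hb⟩ := exists_reg (V := W) hu.2 hs fun x hx => (h ⟨x, hx⟩).1
  refine Ideal.mem_span_singleton'.2 ⟨gr hW b, ?_⟩
  let W' : (PSpace 3).Opens := W ⊓ UU i
  have hW' : hpl y ∈ W' := ⟨hW, hy⟩
  have e1 : gr hW b = gr hW' (rr inf_le_left b) :=
    (gr_rr (X := PSpace 3) (U := W) (V := W') inf_le_left hW' b).symm
  have e2 : gr hy (ratio 0 le_rfl) = gr hW' (ratio 0 inf_le_right) := by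
    rw [← rr_ratio 0 (le_refl (UU i)) (inf_le_right : W' ≤ UU i)]
    exact (gr_rr (X := PSpace 3) (U := UU i) (V := W') inf_le_right hW' (ratio 0 le_rfl)).symm
  rw [e1, e2, ← map_mul]
  refine gr_eq_of_fval (n := 3) hW' le_rfl (inf_le_left.trans j) _ a fun z hz => ?_
  apply (isUnit_al (mul_notMem z (h ⟨z, hz.1⟩).1 hz.2)).mul_left_injective
  have k1 := (h ⟨z, hz.1⟩).2
  have k2 := hb ⟨z, hz.1⟩
  have k3 := fval_ratio (i := i) (V := W') 0 inf_le_right ⟨z, hz⟩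
  have k4 : fval (V := W') (𝒜 := grading 4) (rr inf_le_left b * ratio 0 inf_le_right) ⟨z, hz⟩ =
    fval b ⟨z, hz.1⟩ * fval (V := W') (𝒜 := grading 4) (ratio 0 inf_le_right) ⟨z, hz⟩ := fval_mul _ _ _
  rw [hu.1, map_mul] at k1
  rw [map_mul] at k2
  refine (congrArg (· * _) k4).trans ?_
  change _ * _ * al (𝒜 := grading 4) z (s * X i) = _ * al (𝒜 := grading 4) z (s * X i)
  rw [map_mul]
  exact mul_cancel_aux k1 k2 k3

end HyperplaneGeometry

/-! ### The plane as a closed subset. -/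

section HyperplaneTopology

lemma exists_preimage_le {W : (PSpace 2).Opens} {y : PSpace 2} (hy : y ∈ W) :
    ∃ V : (PSpace 3).Opens, hpl y ∈ V ∧ hpl ⁻¹ᵁ V ≤ W := by
  obtain ⟨_, ⟨s, rfl⟩, hs, hsW⟩ :=
    (ProjectiveSpectrum.isTopologicalBasis_basic_opens (grading 3)).exists_subset_of_mem_open hy W.2
  refine ⟨Proj.basicOpen (grading 4) (rename Fin.succ s), ?_, fun z hz => hsW ?_⟩
  · change setZero 2 (rename Fin.succ s) ∉ ProjectiveSpectrum.asHomogeneousIdeal (𝒜 := grading 3) y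
    rw [setZero_rename]
    exact hs
  · have : setZero 2 (rename Fin.succ s) ∉ ProjectiveSpectrum.asHomogeneousIdeal (𝒜 := grading 3) z := hz
    rw [setZero_rename] at this
    exact this

/-- The graded homomorphism `z_i ↦ z_{i+1}`. -/
def renameSucc : grading 3 →+*ᵍ grading 4 where
  __ := ((rename Fin.succ : MvPolynomial (Fin 3) ℂ →ₐ[ℂ] MvPolynomial (Fin 4) ℂ) :
    MvPolynomial (Fin 3) ℂ →+* MvPolynomial (Fin 4) ℂ)
  map_mem hx := IsHomogeneous.rename_isHomogeneous hx

lemma renameSucc_apply (p : MvPolynomial (Fin 3) ℂ) : renameSucc p = rename Fin.succ p := rfl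

/-- The point of the plane is the preimage of the ideal of `x` under the shift of variables. Since
z_0 lies in that ideal, a polynomial belongs to it exactly when its restriction to the plane,
shifted back, does. -/
lemma exists_hpl_eq {x : PSpace 3} (hx : x ∉ UU 0) : ∃ y, hpl y = x := by
  have h0 : X 0 ∈ ProjectiveSpectrum.asHomogeneousIdeal (𝒜 := grading 4) x := not_not.1 hx
  let y : ProjectiveSpectrum (grading 3) :=
    { asHomogeneousIdeal := (ProjectiveSpectrum.asHomogeneousIdeal (𝒜 := grading 4) x).comap renameSucc
      isPrime := (ProjectiveSpectrum.isPrime (𝒜 := grading 4) x).comap renameSucc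
      not_irrelevant_le := fun h => by
        obtain ⟨i, hi⟩ := exists_mem_UU x
        revert hi
        refine Fin.cases (fun hi => hx hi) (fun j hj => ?_) i
        have := h (HomogeneousIdeal.mem_irrelevant_of_mem (grading 3) one_pos (X_mem_grading j))
        have h' : renameSucc (X j) ∈ ProjectiveSpectrum.asHomogeneousIdeal (𝒜 := grading 4) x := this
        rw [renameSucc_apply, rename_X] at h'
        exact hj h' }
  refine ⟨y, ?_⟩
  refine ProjectiveSpectrum.ext (𝒜 := grading 4) (HomogeneousIdeal.ext (Ideal.ext fun p => ?_))
  change rename Fin.succ (setZero 2 p) ∈ ProjectiveSpectrum.asHomogeneousIdeal (𝒜 := grading 4) x ↔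
    p ∈ ProjectiveSpectrum.asHomogeneousIdeal (𝒜 := grading 4) x
  have h1 : p - rename Fin.succ (setZero 2 p) ∈ ProjectiveSpectrum.asHomogeneousIdeal (𝒜 := grading 4) x :=
    Ideal.mem_of_dvd (HomogeneousIdeal.toIdeal _) sub_rename_mem h0
  let I : Ideal (MvPolynomial (Fin 4) ℂ) :=
    (ProjectiveSpectrum.asHomogeneousIdeal (𝒜 := grading 4) x).toIdeal
  exact ⟨fun h => (Submodule.sub_mem_iff_left I h).1 h1, fun h => (Submodule.sub_mem_iff_right I h).1 h1⟩

end HyperplaneTopology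

/-! ### Restriction of twisted functions to the plane. -/

section RestrictTwist

variable {b : ℤ} {V : (PSpace 3).Opens}

/-- Sections of a twisting sheaf on the plane. -/
abbrev PW (b : ℤ) (V : (PSpace 3).Opens) : Type :=
  twistSections (grading 3) b (hpl ⁻¹ᵁ V)

/-- The restriction of twisted functions to the plane. -/
def resTw (f : TW b V) : PW b V :=
  ⟨fun y => lh y.1 (f.1 ⟨hpt y.1, y.2⟩), mem_twistSections_iff.2 fun y => by
    obtain ⟨W, i, hx, m, n, r, s, hmn, hr, hs, h⟩ := mem_twistSections_iff.1 f.2 ⟨hpt y.1, y.2⟩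
    refine ⟨show Opens (ProjectiveSpectrum.top (grading 3)) from hpl ⁻¹ᵁ W, fun z hz => i hz, hx, m, n,
      setZero 2 r, setZero 2 s, hmn, (setZero 2).map_mem hr, (setZero 2).map_mem hs,
      fun z => ⟨(h ⟨hpt z.1, z.2⟩).1, lh_mul_al (h ⟨hpt z.1, z.2⟩).2⟩⟩⟩

lemma resTw_add (f g : TW b V) : resTw (f + g) = resTw f + resTw g :=
  tw_ext fun y => map_add (lh y.1) _ _

lemma resTw_smul (a : Γ(PSpace 3, V)) (f : TW b V) : resTw (a • f) = hres V a • resTw f :=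
  tw_ext fun y => (map_mul (lh y.1) _ _).trans
    (congrArg (· * (resTw f).1 y) (fval_hres a y.1 y.2).symm)

lemma resTw_twMul {a c : ℤ} (h : a + b = c) (f : TW a V) (g : TW b V) :
    resTw (twMul h f g) = twMul h (resTw f) (resTw g) :=
  tw_ext fun y => map_mul (lh y.1) _ _

lemma resTw_zs_zero : resTw (zs 0 V) = 0 :=
  tw_ext fun y => by
    have h1 : (zs 0 V).1 ⟨hpt y.1, y.2⟩ = al (hpt y.1) (X 0) := zs_apply 0 (V := V) ⟨hpt y.1, y.2⟩
    have h2 : al y.1 (setZero 2 (X 0)) = 0 := by rw [setZero_X_zero, map_zero]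
    change lh y.1 ((zs 0 V).1 ⟨hpt y.1, y.2⟩) = 0
    rw [h1]
    exact (lh_al y.1 (X 0)).trans h2

/-- A section with an inverse generates. -/
lemma existsUnique_smul {n : ℕ} {V : Opens (ProjectiveSpectrum.top (grading n))}
    {g : twistSections (grading n) b V} {g' : twistSections (grading n) (-b) V}
    (h : ∀ y, g.1 y * g'.1 y = 1) (t : twistSections (grading n) b V) :
    ∃! a : Reg (grading n) V, a • g = t := by
  obtain ⟨a, ha⟩ := exists_fval (twMul (by omega : b + -b = 0) t g')
  refine ⟨a, tw_ext fun x => ?_, fun a' ha' => fval_ext fun x => ?_⟩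
  · rw [smul_apply, ha, twMul_apply, mul_assoc, mul_comm (g'.1 x), h, mul_one]
  · rw [ha, twMul_apply, ← ha', smul_apply, mul_assoc, h, mul_one]

/-- The restriction of `z_i ^ b` is a generator. -/
lemma existsUnique_smul_resTw_zpw {i : Fin 4} (hV : V ≤ UU i) (b : ℤ) (t : PW b V) :
    ∃! a : Γ(PSpace 2, hpl ⁻¹ᵁ V), a • resTw (zpw hV b) = t := by
  refine existsUnique_smul (n := 3) (V := hpl ⁻¹ᵁ V) (g' := resTw (zpw hV (-b))) (fun y => ?_) t
  refine (map_mul (lh y.1) _ _).symm.trans ?_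
  exact (congrArg (lh y.1) (twPow_mul_cancel (V := V) (X_mem_grading i) (add_neg_cancel b)
    (fun _ hx => hV hx) ⟨hpt y.1, y.2⟩)).trans (map_one _)

end RestrictTwist

/-! ### Exactness of E(b) → E(b+1) → 𝒪(b+1)^N on the plane. -/

section Framing

variable {E : (PSpace 3).Modules} {b c : ℤ} {V : (PSpace 3).Opens}

/-- A coordinate of the restriction of a section to the plane. -/
def crd (κ : (Scheme.Modules.pullback hpl).obj E ⟶ strSheaf (PSpace 2)) (V : (PSpace 3).Opens) :
    (pm E).presheaf.obj (op V) →+ Γ(PSpace 2, hpl ⁻¹ᵁ V) :=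
  (toReg.comp ((pmMap κ).app (op (hpl ⁻¹ᵁ V))).hom).comp (pb hpl E V)

variable (κ : (Scheme.Modules.pullback hpl).obj E ⟶ strSheaf (PSpace 2))

lemma crd_smul (r : Γ(PSpace 3, V)) (e : (pm E).presheaf.obj (op V)) :
    crd κ V (r • e) = hres V r * crd κ V e := by
  refine (congrArg (fun s => toReg ((pmMap κ).app (op (hpl ⁻¹ᵁ V)) s)) (pb_smul r e)).trans ?_
  exact (congrArg toReg (pmMap_smul κ _ _)).trans (toReg_smul _ _)

lemma crd_rs {W : (PSpace 3).Opens} (i : W ≤ V) (e : (pm E).presheaf.obj (op V)) :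
    crd κ W (rs i e) = rr (preimage_le i) (crd κ V e) := by
  refine (congrArg (fun s => toReg ((pmMap κ).app (op (hpl ⁻¹ᵁ W)) s)) (rs_pb i e).symm).trans ?_
  exact (congrArg toReg (rs_app (pmMap κ) (preimage_le i) _).symm).trans (toReg_rs _ _)

lemma balanced_rho (b : ℤ) (V : (PSpace 3).Opens) : Balanced (M := pm E) (N := pm (OO 3 b)) (V := V) (G := PW b V)
    (fun m (f : TW b V) => crd κ V m • resTw f) where
  add_left m m' n := by rw [map_add, add_smul]
  add_right m n n' := (congrArg (crd κ V m • ·) (resTw_add n n')).trans (smul_add _ _ _)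
  smul r m n := by
    refine Eq.trans ?_ (congrArg (crd κ V m • ·) (resTw_smul r n)).symm
    rw [crd_smul, mul_comm, mul_smul]

/-- The restriction of a twisted section to the plane, in one coordinate. -/
def rhoOne (b : ℤ) : EE E b ⟶ (abSh (planeTwist b)).obj :=
  tmHom (M := pm E) (N := pm (OO 3 b)) (G := (abSh (planeTwist b)).obj)
    (f := fun V m (f : TW b V) => (crd κ V m • resTw f : PW b V))
    (fun V => balanced_rho κ b V)
    (fun U V i m n => by
      rw [crd_rs]
      rfl)

lemma rhoOne_etm (m : (pm E).presheaf.obj (op V)) (f : TW b V) :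
    (rhoOne κ b).app (op V) (etm m f) = (crd κ V m • resTw f : PW b V) :=
  tmLift_tm (balanced_rho κ b V) m f

lemma mul_eq_mul_aux {R : Type} [CommRing R] {a c r x y z w : R} (h₁ : a * z = c) (h₂ : r * x = y)
    (h₃ : z = x) (h₄ : w = y) : a * w = r * c := by
  subst h₁ h₂ h₃ h₄
  ring

lemma isDomain_Loc {n : ℕ} (x : ProjectiveSpectrum (grading n)) : IsDomain (Loc (grading n) x) :=
  have := x.isPrime
  IsLocalization.isDomain_localization (Ideal.primeCompl_le_nonZeroDivisors _)

/-- In the trivializations by powers of z_i, multiplication by z_k becomes multiplication of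
sections of E by the regular function z_k / z_i. -/
lemma etm_act_zs_ezpw {i : Fin 4} (hV : V ≤ UU i) (h : b + 1 = c) (k : Fin 4)
    (e : (pm E).presheaf.obj (op V)) :
    act h (zs k V) (ezpw E hV b e) = ezpw E hV c (ratio k hV • e) := by
  refine (act_etm h _ _ _).trans (Eq.trans ?_ (etm_smul _ _ _).symm)
  refine congrArg (etm e) (tw_ext fun x => ?_)
  change (zpw hV b).1 x * (zs k V).1 x = fval (V := V) (𝒜 := grading 4) (ratio k hV) x * (zpw hV c).1 x
  have h1 : (zpw hV b).1 x * (zs i V).1 x = (zpw hV c).1 x := by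
    rw [← zpw_one hV, ← zpw_mul hV h]
    rfl
  exact mul_eq_mul_aux h1 (fval_ratio k hV x) (zs_apply i x) (zs_apply k x)

/-- The values lie in local rings of the cone, which are domains in which z_0 is nonzero, even at
points of the plane. -/
lemma ratio_isRegular {i : Fin 4} (hV : V ≤ UU i) : IsRegular (ratio 0 hV) := by
  rw [← isLeftRegular_iff_isRegular]
  refine isLeftRegular_of_non_zero_divisor _ fun a ha => ?_
  refine fval_ext (V := V) (𝒜 := grading 4) fun x => ?_
  have h1 := congrArg (fun b => fval (V := V) (𝒜 := grading 4) b x) ha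
  have h2 : fval (V := V) (𝒜 := grading 4) (ratio 0 hV) x * fval (V := V) (𝒜 := grading 4) a x = 0 :=
    (fval_mul _ _ x).symm.trans (h1.trans (fval_zero x))
  have h3 := fval_ratio 0 hV x
  have h4 : al (𝒜 := grading 4) x.1 (X 0) ≠ 0 := fun h =>
    X_ne_zero (R := ℂ) (0 : Fin 4) (al_injective (n := 4) x.1 (h.trans (map_zero _).symm))
  have := isDomain_Loc (n := 4) x.1
  refine Eq.trans ((mul_eq_zero.1 h2).resolve_left fun h => h4 ?_) (fval_zero x).symm
  exact h3.symm.trans ((congrArg (· * _) h).trans (zero_mul _))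

/-- After trivialization the map is multiplication by the regular element z_0 / z_i, injective on a
torsion free module. -/
lemma act_zs_zero_injective (hE : IsTorsionFree E) (h : b + 1 = c) {i : Fin 4} (hV : V ≤ UU i) :
    Function.Injective (act (E := E) h (zs 0 V)) := by
  refine (injective_iff_map_eq_zero _).2 fun z hz => ?_
  obtain ⟨e, rfl⟩ := (ezpw_bijective hV b).2 z
  rw [etm_act_zs_ezpw hV h] at hz
  have h1 := (ezpw_bijective hV c).1 (hz.trans (map_zero _).symm)
  have := hE V
  have h2 : IsSMulRegular Γ(E, V) (ratio 0 hV) := (ratio_isRegular hV).isSMulRegular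
  have h3 : e = 0 := h2 (h1.trans (smul_zero _).symm)
  rw [h3, map_zero]

end Framing

section Framing

variable {E : (PSpace 3).Modules} {b c : ℤ} {V : (PSpace 3).Opens}

variable {N : ℕ} (κ : Fin N → ((Scheme.Modules.pullback hpl).obj E ⟶ strSheaf (PSpace 2)))

/-- The restriction of a twist of `E` to the plane, in coordinates. -/
def rho (b : ℤ) : EE E b ⟶ pw (Fin N) (abSh (planeTwist b)).obj := pwLift fun k => rhoOne (κ k) b

lemma rhoOne_act_zs_zero (κ : (Scheme.Modules.pullback hpl).obj E ⟶ strSheaf (PSpace 2))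
    (h : b + 1 = c) (z : (EE E b).obj (op V)) :
    (rhoOne κ c).app (op V) (act h (zs 0 V) z) = 0 := by
  induction z using etm_induction with
  | zero => rw [map_zero, map_zero]
  | tmul m f =>
    rw [act_etm, rhoOne_etm]
    have h1 : resTw (twMul h f (zs 0 V)) = 0 := by
      rw [resTw_twMul, resTw_zs_zero]
      exact tw_ext fun _ => mul_zero _
    rw [h1, smul_zero]
    rfl
  | add x y hx hy => 
    rw [map_add, map_add, hx, hy, add_zero]

lemma rhoOne_ezpw (κ : (Scheme.Modules.pullback hpl).obj E ⟶ strSheaf (PSpace 2)) {i : Fin 4}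
    (hV : V ≤ UU i) (e : (pm E).presheaf.obj (op V)) :
    (rhoOne κ b).app (op V) (ezpw E hV b e) = (crd κ V e • resTw (zpw hV b) : PW b V) :=
  rhoOne_etm κ e _

lemma crd_eq_zero (κ : (Scheme.Modules.pullback hpl).obj E ⟶ strSheaf (PSpace 2)) {i : Fin 4}
    (hV : V ≤ UU i) (e : (pm E).presheaf.obj (op V))
    (h : (rhoOne κ b).app (op V) (ezpw E hV b e) = 0) : crd κ V e = 0 :=
  (existsUnique_smul_resTw_zpw hV b 0).unique ((rhoOne_ezpw κ hV e).symm.trans h) (zero_smul _ _)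

variable {κ}

lemma pb_eq_zero (hκ : ∀ V : (PSpace 2).Opens, Function.Bijective
    (fun s k => toReg ((pmMap (κ k)).app (op V) s))) (e : (pm E).presheaf.obj (op V))
    (h : ∀ k, crd (κ k) V e = 0) : pb hpl E V e = 0 := by
  refine (hκ (hpl ⁻¹ᵁ V)).1 (funext fun k => (h k).trans ?_)
  exact ((congrArg toReg (map_zero _)).trans (map_zero toReg)).symm

/-- A section vanishing on the plane is locally a multiple of the equation of the plane. -/
lemma exists_eq_ratio_smul {i : Fin 4} (e : (pm E).presheaf.obj (op V))
    (he : pb hpl E V e = 0) (hV : V ≤ UU i) (y : PSpace 2) (hy : hpl y ∈ V) :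
    ∃ (W : (PSpace 3).Opens) (_ : hpl y ∈ W) (j : W ≤ V) (e' : (pm E).presheaf.obj (op W)),
      rs j e = ratio 0 (j.trans hV) • e' := by
  have h1 := grm_mem_of_pb_eq_zero e he hy
  -- The germ lies in the ideal of the plane times the stalk. That ideal is contained in a principal
  -- one, so the germ is a single multiple of z_0 / z_i, and the equality spreads to a
  -- neighbourhood.
  have h2 := Submodule.smul_mono_left (kerStalk_le y (hV hy)) h1
  rw [Submodule.ideal_span_singleton_smul] at h2
  obtain ⟨s, -, hs⟩ := Submodule.mem_smul_pointwise_iff_exists _ _ _ |>.1 h2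
  obtain ⟨U, hU, e', rfl⟩ := exists_grm (pm E) s
  have hUV : hpl y ∈ U ⊓ V := ⟨hU, hy⟩
  have h3 : grm (pm E) (U := U ⊓ V) hUV (ratio 0 (V := U ⊓ V) (inf_le_right.trans hV) • rs (inf_le_left : U ⊓ V ≤ U) e') =
      grm (pm E) hy e := by
    rw [grm_smul, grm_rs, ← hs, ← rr_ratio 0 le_rfl (inf_le_right.trans hV), gr_rr]
  obtain ⟨W, hW, j, k, h4⟩ := grm_eq (pm E) _ _ _ _ h3
  refine ⟨W, hW, k, rs j (rs inf_le_left e'), h4.symm.trans ?_⟩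
  rw [rs_smul, rr_ratio]

/-- The prescribed coordinates define a section of the pull-back, which near each point is the
pull-back of a section on space. Neighbourhoods in the plane contain traces of open sets of space.
-/
lemma exists_crd_eq (hκ : ∀ V : (PSpace 2).Opens, Function.Bijective
    (fun s k => toReg ((pmMap (κ k)).app (op V) s))) (a : Fin N → Γ(PSpace 2, hpl ⁻¹ᵁ V))
    (y : PSpace 2) (hy : hpl y ∈ V) :
    ∃ (W : (PSpace 3).Opens) (_ : hpl y ∈ W) (j : W ≤ V) (e : (pm E).presheaf.obj (op W)),
      ∀ k, crd (κ k) W e = rr (preimage_le j) (a k) := by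
  obtain ⟨σ, hσ⟩ := (hκ (hpl ⁻¹ᵁ V)).2 a
  obtain ⟨U, hU, e, he⟩ := mem_pbSub (f := hpl) (E := E) (W := hpl ⁻¹ᵁ V) (x := y) hy σ
  obtain ⟨W, hW, i, j, h⟩ := grm_eq _ _ _ _ _ he
  obtain ⟨T, hT, hTW⟩ := exists_preimage_le hW
  have hl : T ⊓ U ⊓ V ≤ U := inf_le_left.trans inf_le_right
  refine ⟨T ⊓ U ⊓ V, ⟨⟨hT, hU⟩, hy⟩, inf_le_right, rs hl e, fun k => ?_⟩
  have hm : hpl ⁻¹ᵁ (T ⊓ U ⊓ V) ≤ W := (preimage_le (inf_le_left.trans inf_le_left)).trans hTW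
  have h5 : pb hpl E (T ⊓ U ⊓ V) (rs hl e) = rs (preimage_le inf_le_right) σ := by
    have h6 := congrArg (rs hm) h
    rw [rs_rs, rs_rs] at h6
    exact (rs_pb hl e).symm.trans h6
  refine (congrArg (fun s => toReg ((pmMap (κ k)).app _ s)) h5).trans ?_
  refine (congrArg toReg (rs_app (pmMap (κ k)) (preimage_le inf_le_right) σ).symm).trans ?_
  exact (toReg_rs _ _).trans (congrArg (rr _) (congrFun hσ k))

variable (κ) in
/-- The restriction of a twist of `E` to the plane is a sum of twisting sheaves, and its kernel is
given by the multiples of the equation of the plane. -/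
lemma locallyExact_zop_rho (hE : IsTorsionFree E) (hκ : ∀ V : (PSpace 2).Opens, Function.Bijective
    (fun s k => toReg ((pmMap (κ k)).app (op V) s))) (h : b + 1 = c) :
    LocallyExact (zop (E := E) 0 h) (rho κ c) where
  zero := by
    ext V z
    exact funext fun k => rhoOne_act_zs_zero (κ k) h z
  inj U s hs x hx := by
    obtain ⟨i, hi⟩ := exists_mem_UU x
    refine ⟨U ⊓ UU i, homOfLE inf_le_left, ⟨hx, hi⟩, ?_⟩
    refine act_zs_zero_injective hE h (V := U ⊓ UU i) inf_le_right ?_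
    rw [map_zero]
    refine (rs_act h (zs 0 U) (inf_le_left : U ⊓ UU i ≤ U) s).symm.trans ?_
    exact (congrArg (rs _) hs).trans (map_zero _)
  exact U s hs x hx := by
    -- Off the plane z_0 is invertible, and one divides by it.
    by_cases h0 : x ∈ UU 0
    · let V := U ⊓ UU 0
      have hV : V ≤ UU 0 := inf_le_right
      refine ⟨V, homOfLE inf_le_left, ⟨hx, h0⟩, act (by omega : c + -1 = b) (zpw hV (-1))
        (rs (inf_le_left : V ≤ U) s), ?_⟩
      have h1 := act_zpw_zpw (E := E) hV (by omega : c + -1 = b) h (rs (inf_le_left : V ≤ U) s)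
      rw [zpw_one] at h1
      exact h1
    · obtain ⟨y, rfl⟩ := exists_hpl_eq h0
      obtain ⟨i, hi⟩ := exists_mem_UU (hpl y)
      let V := U ⊓ UU i
      have hV : V ≤ UU i := inf_le_right
      obtain ⟨e, he⟩ := (ezpw_bijective (E := E) hV c).2 (rs (inf_le_left : V ≤ U) s)
      have h1 : ∀ k, crd (κ k) V e = 0 := fun k => by
        refine crd_eq_zero (b := c) (κ k) hV e ?_
        rw [he]
        refine (rs_app (rhoOne (κ k) c) _ s).symm.trans ?_
        exact (congrArg (rs _) (congrFun hs k)).trans (map_zero _)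
      obtain ⟨W, hW, j, e', h2⟩ := exists_eq_ratio_smul e (pb_eq_zero hκ e h1) hV y ⟨hx, hi⟩
      refine ⟨W, homOfLE (j.trans inf_le_left), hW, ezpw E (j.trans hV) b e', ?_⟩
      refine (etm_act_zs_ezpw (j.trans hV) h 0 e').trans ?_
      rw [← h2]
      exact (congrArg (rs j) he).trans (rs_rs _ _ _)
  surj U s x hx := by
    by_cases h0 : x ∈ UU 0
    · refine ⟨U ⊓ UU 0, homOfLE inf_le_left, ⟨hx, h0⟩, 0, funext fun k => ?_⟩
      have := subsingleton_planeTwist c (V := U ⊓ UU 0) inf_le_right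
      exact this.elim _ _
    · obtain ⟨y, rfl⟩ := exists_hpl_eq h0
      obtain ⟨i, hi⟩ := exists_mem_UU (hpl y)
      let V := U ⊓ UU i
      have hV : V ≤ UU i := inf_le_right
      -- The twisted functions are written as multiples of the restricted generator z_i^c, which
      -- reduces surjectivity to prescribing coordinates of a section of E.
      choose a ha using fun k => (existsUnique_smul_resTw_zpw hV c
        (rs (F := (abSh (planeTwist c)).obj) (inf_le_left : V ≤ U) (s k))).exists
      obtain ⟨W, hW, j, e, h1⟩ := exists_crd_eq hκ a y ⟨hx, hi⟩
      refine ⟨W, homOfLE (j.trans inf_le_left), hW, ezpw E (j.trans hV) c e, funext fun k => ?_⟩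
      refine (rhoOne_ezpw (κ k) (j.trans hV) e).trans ?_
      rw [h1 k]
      refine Eq.trans ?_ ((congrArg (rs (F := (abSh (planeTwist c)).obj) j) (ha k)).trans (rs_rs _ _ _))
      rfl

lemma exists_locallyExact_zop {k : ℤ} (hE : IsInModuli N k E) (b c : ℤ) (h : b + 1 = c) :
    ∃ (N : ℕ) (ρ : EE E c ⟶ pw (Fin N) (abSh (planeTwist c)).obj),
      LocallyExact (zop (E := E) 0 h) ρ := by
  obtain ⟨θ⟩ := hE.framing
  obtain ⟨κ, hκ⟩ := exists_coordinates θ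
  exact ⟨N, rho κ c, locallyExact_zop_rho κ hE.torsionFree hκ h⟩

end Framing

/-! ### Extension of derivations to localizations. -/

section LocalDerivation

variable {R L : Type} [CommRing R] [CommRing L] [Algebra R L] (S : Submonoid R) [IsLocalization S L]
  {k : Type} [CommRing k] [Algebra k R] (D : Derivation k R R)

/-- The homomorphism to the dual numbers given by a derivation. -/
def dualHom : R →+* TrivSqZeroExt L L where
  toFun r := (algebraMap R L r, algebraMap R L (D r))
  map_one' := TrivSqZeroExt.ext (map_one _) (by
    change algebraMap R L (D 1) = 0
    rw [D.map_one_eq_zero, map_zero])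
  map_mul' r s := TrivSqZeroExt.ext (map_mul _ _ _) (by
    change algebraMap R L (D (r * s)) = algebraMap R L r • algebraMap R L (D s) +
      MulOpposite.op (algebraMap R L s) • algebraMap R L (D r)
    rw [D.leibniz, op_smul_eq_smul, map_add, smul_eq_mul, smul_eq_mul, smul_eq_mul, smul_eq_mul,
      map_mul, map_mul])
  map_zero' := TrivSqZeroExt.ext (map_zero _) (by
    change algebraMap R L (D 0) = 0
    rw [map_zero, map_zero])
  map_add' r s := TrivSqZeroExt.ext (map_add _ _ _) (by
    change algebraMap R L (D (r + s)) = algebraMap R L (D r) + algebraMap R L (D s)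
    rw [map_add, map_add])

/-- The extension of `dualHom` to a localization. -/
def dualLift : L →+* TrivSqZeroExt L L :=
  IsLocalization.lift (M := S) (g := dualHom (L := L) D) fun s =>
    TrivSqZeroExt.isUnit_iff_isUnit_fst.2 (IsLocalization.map_units L s)

lemma dualLift_algebraMap (r : R) : dualLift S D (algebraMap R L r) = dualHom D r :=
  IsLocalization.lift_eq _ _

/-- The first component is a ring homomorphism fixing the image of R, so it is the identity of the
localization. Multiplicativity in the dual numbers then becomes the Leibniz rule for the second
component. -/
lemma fst_dualLift (u : L) : (dualLift S D u).fst = u := by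
  have : ((TrivSqZeroExt.fstHom L L L : TrivSqZeroExt L L →+* L).comp (dualLift S D)) = RingHom.id L :=
    IsLocalization.ringHom_ext S (RingHom.ext fun r =>
      congrArg TrivSqZeroExt.fst (dualLift_algebraMap S D r))
  exact congr($this u)

/-- The extension of a derivation to a localization. -/
def locDer : L →+ L := AddMonoidHom.mk' (fun u => (dualLift S D u).snd) fun u v => by
  rw [map_add, TrivSqZeroExt.snd_add]

lemma locDer_algebraMap (r : R) : locDer S D (algebraMap R L r) = algebraMap R L (D r) :=
  congrArg TrivSqZeroExt.snd (dualLift_algebraMap S D r)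

lemma locDer_mul (u v : L) : locDer S D (u * v) = u * locDer S D v + v * locDer S D u := by
  change (dualLift S D (u * v)).snd = u * (dualLift S D v).snd + v * (dualLift S D u).snd
  rw [map_mul, TrivSqZeroExt.snd_mul, fst_dualLift, fst_dualLift, op_smul_eq_smul, smul_eq_mul,
    smul_eq_mul]

end LocalDerivation

/-! ### Homogeneous partial derivatives and Euler's identity. -/

section Partial

variable {V : (PSpace 3).Opens}

/-- The partial derivatives on the local rings of the cone. -/
def pdl (k : Fin 4) (x : ProjectiveSpectrum (grading 4)) : Loc (grading 4) x →+ Loc (grading 4) x :=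
  locDer x.asHomogeneousIdeal.toIdeal.primeCompl (pderiv k)

lemma pdl_al (k : Fin 4) (x : ProjectiveSpectrum (grading 4)) (r : MvPolynomial (Fin 4) ℂ) :
    pdl k x (al x r) = al x (pderiv k r) := locDer_algebraMap _ _ _

lemma pdl_mul (k : Fin 4) (x : ProjectiveSpectrum (grading 4)) (u v : Loc (grading 4) x) :
    pdl k x (u * v) = u * pdl k x v + v * pdl k x u := locDer_mul _ _ _ _

lemma pdl_fraction (k : Fin 4) {x : ProjectiveSpectrum (grading 4)} {u : Loc (grading 4) x}
    {r s : MvPolynomial (Fin 4) ℂ} (h : u * al x s = al x r) :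
    pdl k x u * al x (s * s) = al x (s * pderiv k r - r * pderiv k s) := by
  have h1 := congrArg (pdl k x) h
  rw [pdl_mul, pdl_al, pdl_al] at h1
  rw [map_sub, map_mul, map_mul, map_mul]
  linear_combination al x s * h1 - al x (pderiv k s) * h

/-- Numerator and denominator are multiplied by a coordinate so that the degree m is positive; then
m - 1 is the true degree of the partial derivatives. -/
lemma exists_fraction_pos (a : Γ(PSpace 3, V)) {x : PSpace 3} (hx : x ∈ V) :
    ∃ (W : (PSpace 3).Opens) (_ : x ∈ W) (i : W ≤ V) (m : ℕ)
      (r s : MvPolynomial (Fin 4) ℂ), 0 < m ∧ r ∈ grading 4 m ∧ s ∈ grading 4 m ∧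
      ∀ y : W, s ∉ ProjectiveSpectrum.asHomogeneousIdeal (𝒜 := grading 4) y.1 ∧
        fval (V := V) (𝒜 := grading 4) a ⟨y.1, i y.2⟩ * al (𝒜 := grading 4) y.1 s = al y.1 r := by
  obtain ⟨W, hW, i, m, r, s, hr, hs, h⟩ := exists_fraction (n := 4) (V := V) a hx
  obtain ⟨j, hj⟩ := exists_mem_UU x
  refine ⟨W ⊓ UU j, ⟨hW, hj⟩, inf_le_left.trans i, m + 1, r * X j, s * X j, m.succ_pos,
    SetLike.mul_mem_graded hr (X_mem_grading j), SetLike.mul_mem_graded hs (X_mem_grading j), fun y => ?_⟩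
  obtain ⟨h1, h2⟩ := h ⟨y.1, y.2.1⟩
  refine ⟨mul_notMem _ h1 y.2.2, ?_⟩
  rw [map_mul, map_mul, ← h2, mul_assoc]

lemma pderiv_mem_grading {m : ℕ} {r : MvPolynomial (Fin 4) ℂ} (hr : r ∈ grading 4 m) (k : Fin 4) :
    pderiv k r ∈ grading 4 (m - 1) := IsHomogeneous.pderiv hr

/-- The partial derivatives of a regular function. -/
def pd (k : Fin 4) (a : Γ(PSpace 3, V)) : TW (-1) V :=
  ⟨fun x => pdl k x.1 (fval (V := V) (𝒜 := grading 4) a x), mem_twistSections_iff.2 fun x => by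
    obtain ⟨W, hW, i, m, r, s, hm, hr, hs, h⟩ := exists_fraction_pos a x.2
    refine ⟨W, i, hW, m + (m - 1), m + m, s * pderiv k r - r * pderiv k s, s * s, by omega,
      sub_mem (SetLike.mul_mem_graded hs (pderiv_mem_grading hr k))
        (SetLike.mul_mem_graded hr (pderiv_mem_grading hs k)), SetLike.mul_mem_graded hs hs,
      fun y => ⟨mul_notMem _ (h y).1 (h y).1, pdl_fraction k (h y).2⟩⟩⟩

lemma pd_apply (k : Fin 4) (a : Γ(PSpace 3, V)) (x : V) :
    (pd k a).1 x = pdl k x.1 (fval (V := V) (𝒜 := grading 4) a x) := rfl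

lemma pd_add (k : Fin 4) (a a' : Γ(PSpace 3, V)) : pd k (a + a') = pd k a + pd k a' :=
  tw_ext fun x => (congrArg (pdl k x.1) (fval_add (V := V) (𝒜 := grading 4) a a' x)).trans (map_add _ _ _)

lemma pd_mul (k : Fin 4) (a a' : Γ(PSpace 3, V)) : pd k (a * a') = a • pd k a' + a' • pd k a :=
  tw_ext fun x => (congrArg (pdl k x.1) (fval_mul (V := V) (𝒜 := grading 4) a a' x)).trans (pdl_mul _ _ _ _)

/-- By the quotient rule s² Σ z_k d_k = s (n r) - r (n s) = 0: numerator and denominator have the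
same degree. -/
lemma euler_mul_aux {R : Type} [CommRing R] {z d r' s' : Fin 4 → R} {s r n : R} (hs : IsUnit s)
    (hd : ∀ k, d k * (s * s) = s * r' k - r * s' k)
    (hr : ∑ k, z k * r' k = n * r) (hs' : ∑ k, z k * s' k = n * s) : ∑ k, z k * d k = 0 := by
  apply (hs.mul hs).mul_left_injective
  simp only [Fin.sum_univ_four] at *
  linear_combination z 0 * hd 0 + z 1 * hd 1 + z 2 * hd 2 + z 3 * hd 3 + s * hr - r * hs'

/-- Euler's identity. -/
lemma sum_mul_pd (a : Γ(PSpace 3, V)) (x : V) :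
    ∑ k, al (𝒜 := grading 4) x.1 (X k) * (pd k a).1 x = 0 := by
  obtain ⟨W, hW, i, m, r, s, hr, hs, h⟩ := exists_fraction (n := 4) (V := V) a x.2
  obtain ⟨h1, h2⟩ := h ⟨x.1, hW⟩
  have h3 (p : MvPolynomial (Fin 4) ℂ) (hp : p ∈ grading 4 m) :
      ∑ k, al (𝒜 := grading 4) x.1 (X k) * al x.1 (pderiv k p) = (m : Loc (grading 4) x.1) * al x.1 p := by
    have h4 := congrArg (al (𝒜 := grading 4) x.1) (IsHomogeneous.sum_X_mul_pderiv hp)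
    simpa only [map_sum, map_mul, nsmul_eq_mul, map_natCast] using h4
  refine euler_mul_aux (isUnit_al h1) (fun k => ?_) (h3 r hr) (h3 s hs)
  have := pdl_fraction k h2
  rw [map_sub, map_mul, map_mul, map_mul] at this
  exact this

lemma rs_pd {W : (PSpace 3).Opens} (i : W ≤ V) (k : Fin 4) (a : Γ(PSpace 3, V)) :
    rs (F := twistPresheaf (grading 4) (-1)) i (pd k a) = pd k (rr i a) := rfl

end Partial

/-! ### Constants as regular functions. -/

section Constants

variable {V : (PSpace 3).Opens}

/-- A complex number as a regular function. -/
def cn (V : (PSpace 3).Opens) : ℂ →+* Γ(PSpace 3, V) := ((constants (structureMap 3)).app (op V)).hom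

/-- The structure morphism is unfolded on the principal open set of 1, which is all of space; there
sections are fractions, and the value of a constant can be read off. -/
lemma constants_eq : (Scheme.ΓSpecIso (CommRingCat.of ℂ)).inv ≫ (structureMap 3).appTop ≫
    (PSpace 3).presheaf.map (homOfLE (le_top : Proj.basicOpen (grading 4) 1 ≤ ⊤)).op =
      CommRingCat.ofHom (algebraMap ℂ (grading 4 0)) ≫
      CommRingCat.ofHom (HomogeneousLocalization.fromZeroRingHom (grading 4) (Submonoid.powers 1)) ≫
      Proj.awayToSection (grading 4) 1 := by
  have h1 : (Proj.basicOpen (grading 4) 1).ι ≫ structureMap 3 =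
      Proj.basicOpenToSpec (grading 4) 1 ≫ Spec.map (CommRingCat.ofHom
        (HomogeneousLocalization.fromZeroRingHom (grading 4) (Submonoid.powers 1))) ≫
      Spec.map (CommRingCat.ofHom (algebraMap ℂ (grading 4 0))) := by
    have h2 : (Proj.basicOpen (grading 4) 1).ι ≫ (Scheme.topIso _).inv ≫
        (Scheme.isoOfEq _ (Proj.basicOpen_one (grading 4))).inv = 𝟙 _ := by
      rw [← Category.assoc, Iso.comp_inv_eq, Iso.comp_inv_eq]
      simp
    rw [structureMap, Proj.toSpecZero]
    simp only [← Category.assoc]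
    simp only [Category.assoc]
    rw [reassoc_of% h2]
  have h3 := congrArg Scheme.Hom.appTop h1
  simp only [Scheme.Hom.comp_appTop, Scheme.Opens.ι_appTop, Proj.basicOpenToSpec_app_top] at h3
  have h4 := congrArg (fun φ => (Scheme.ΓSpecIso (CommRingCat.of ℂ)).inv ≫ φ ≫
    (Proj.basicOpen (grading 4) 1).topIso.hom) h3
  simp only [Category.assoc, ← Scheme.ΓSpecIso_inv_naturality_assoc, Iso.inv_hom_id_assoc, Iso.inv_hom_id, Category.comp_id] at h4
  refine Eq.trans ?_ h4
  have h5 : (PSpace 3).presheaf.map (homOfLE (le_top : Proj.basicOpen (grading 4) 1 ≤ ⊤)).op =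
      (PSpace 3).presheaf.map (homOfLE (le_top : (Proj.basicOpen (grading 4) 1).ι ''ᵁ ⊤ ≤ ⊤)).op ≫
        (Proj.basicOpen (grading 4) 1).topIso.hom := by
    rw [Scheme.Opens.topIso_hom]
    exact CategoryTheory.Functor.map_comp (PSpace 3).presheaf _ _
  exact congrArg (fun φ => (Scheme.ΓSpecIso (CommRingCat.of ℂ)).inv ≫ (structureMap 3).appTop ≫ φ) h5

lemma fval_cn (c : ℂ) (x : V) :
    fval (V := V) (𝒜 := grading 4) (cn V c) x = al (𝒜 := grading 4) x.1 (C c) := by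
  have h1 := congr($(congrArg CommRingCat.Hom.hom constants_eq) c)
  have hx : x.1 ∈ Proj.basicOpen (grading 4) 1 := by
    rw [Proj.basicOpen_one]; trivial
  have h2 := congrArg (fun a => fval (V := Proj.basicOpen (grading 4) 1) (𝒜 := grading 4) a ⟨x.1, hx⟩) h1
  refine Eq.trans ?_ (h2.trans ?_)
  · rfl
  · refine (ProjectiveSpectrum.Proj.awayToSection_apply (grading 4) 1 _ _).trans ?_
    change IsLocalization.map _ _ _ (Localization.mk (C c) 1) = _
    rw [Localization.mk_one_eq_algebraMap, IsLocalization.map_eq]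
    rfl

lemma pd_cn (k : Fin 4) (c : ℂ) : pd k (cn V c) = 0 := tw_ext fun x => by
  refine (pd_apply k _ x).trans ((congrArg (pdl k x.1) (fval_cn c x)).trans ?_)
  exact (pdl_al k x.1 (C c)).trans ((congrArg _ pderiv_C).trans (map_zero _))

end Constants

/-! ### Partial derivatives as linear maps on differentials. -/

section Differentials

/-- The presheaf of differentials on projective space. -/
def Om : PMod (PSpace 3) :=
  PresheafOfModules.DifferentialsConstruction.relativeDifferentials' (constants (structureMap 3))

/-- The group of differentials on an open set. -/
abbrev OmM (V : (PSpace 3).Opens) : Type := Om.presheaf.obj (op V)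

variable {V : (PSpace 3).Opens}

/-- The differential of a regular function. -/
def dO (a : Γ(PSpace 3, V)) : OmM V :=
  CommRingCat.KaehlerDifferential.d (f := (constants (structureMap 3)).app (op V)) a

lemma dO_add (a a' : Γ(PSpace 3, V)) : dO (a + a') = dO a + dO a' :=
  (CommRingCat.KaehlerDifferential.D ((constants (structureMap 3)).app (op V))).d_add a a'

lemma dO_mul (a a' : Γ(PSpace 3, V)) : dO (a * a') = a • dO a' + a' • dO a :=
  (CommRingCat.KaehlerDifferential.D ((constants (structureMap 3)).app (op V))).d_mul a a'

lemma dO_cn (c : ℂ) : dO (cn V c) = 0 :=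
  (CommRingCat.KaehlerDifferential.D ((constants (structureMap 3)).app (op V))).d_map c

lemma rs_dO {W : (PSpace 3).Opens} (i : W ≤ V) (a : Γ(PSpace 3, V)) :
    rs (F := Om.presheaf) i (dO a) = dO (rr i a) :=
  PresheafOfModules.DifferentialsConstruction.relativeDifferentials'_map_d
    (constants (structureMap 3)) (homOfLE i).op a

lemma span_dO : Submodule.span Γ(PSpace 3, V) (Set.range (dO (V := V))) = ⊤ := by
  let : Algebra (CommRingCat.of ℂ) Γ(PSpace 3, V) :=
    RingHom.toAlgebra ((constants (structureMap 3)).app (op V)).hom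
  exact KaehlerDifferential.span_range_derivation ((CommRingCat.of ℂ)) Γ(PSpace 3, V)

/-- A partial derivative on differentials. -/
def grad (k : Fin 4) (V : (PSpace 3).Opens) : OmM V →ₗ[Γ(PSpace 3, V)] TW (-1) V :=
  (ModuleCat.Derivation.desc (f := (constants (structureMap 3)).app (op V))
    (M := ModuleCat.of Γ(PSpace 3, V) (TW (-1) V))
    (ModuleCat.Derivation.mk (pd k) (pd_add k) (pd_mul k) (pd_cn k))).hom

lemma grad_dO (k : Fin 4) (a : Γ(PSpace 3, V)) : grad k V (dO a) = pd k a :=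
  ModuleCat.Derivation.desc_d (f := (constants (structureMap 3)).app (op V))
    (M := ModuleCat.of Γ(PSpace 3, V) (TW (-1) V))
    (ModuleCat.Derivation.mk (pd k) (pd_add k) (pd_mul k) (pd_cn k)) a

lemma OmM_induction {p : OmM V → Prop} (η : OmM V) (zero : p 0) (d : ∀ a, p (dO a))
    (add : ∀ x y, p x → p y → p (x + y)) (smul : ∀ (r : Γ(PSpace 3, V)) x, p x → p (r • x)) : p η := by
  have : η ∈ Submodule.span Γ(PSpace 3, V) (Set.range (dO (V := V))) := span_dO ▸ trivial
  induction this using Submodule.span_induction with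
  | mem x h =>
    obtain ⟨a, rfl⟩ := h
    exact d a
  | zero => exact zero
  | add x y _ _ hx hy => exact add x y hx hy
  | smul r x _ hx => exact smul r x hx

lemma rs_grad {W : (PSpace 3).Opens} (i : W ≤ V) (k : Fin 4) (η : OmM V) :
    rs (F := twistPresheaf (grading 4) (-1)) i (grad k V η) = grad k W (rs i η) := by
  induction η using OmM_induction with
  | zero =>
    refine (congrArg (rs _) (map_zero (grad k V))).trans (Eq.symm ?_)
    exact (congrArg (grad k W) (map_zero _)).trans (map_zero _)
  | d a => rw [grad_dO, rs_dO, grad_dO, rs_pd]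
  | add x y hx hy =>
    refine (congrArg (rs _) (map_add (grad k V) x y)).trans (Eq.symm ?_)
    refine (congrArg (grad k W) (map_add _ x y)).trans ((map_add _ _ _).trans ?_)
    exact (congrArg₂ (· + ·) hx hy).symm
  | smul r x hx =>
    rw [rs_smul, map_smul, map_smul, ← hx]
    rfl

/-- Euler's identity for differentials. -/
lemma sum_mul_grad (η : OmM V) (x : V) :
    ∑ k, al (𝒜 := grading 4) x.1 (X k) * (grad k V η).1 x = 0 := by
  induction η using OmM_induction with
  | zero =>
    refine Finset.sum_eq_zero fun k _ => ?_
    rw [map_zero]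
    exact mul_zero _
  | d a => simpa only [grad_dO] using sum_mul_pd a x
  | add η η' h h' =>
    have h1 (k : Fin 4) : al (𝒜 := grading 4) x.1 (X k) * (grad k V (η + η')).1 x =
        al (𝒜 := grading 4) x.1 (X k) * (grad k V η).1 x + al x.1 (X k) * (grad k V η').1 x := by
      rw [map_add]
      exact mul_add _ _ _
    simp only [h1, Finset.sum_add_distrib, h, h', add_zero]
  | smul r η h =>
    have h1 (k : Fin 4) : al (𝒜 := grading 4) x.1 (X k) * (grad k V (r • η)).1 x =
        fval (V := V) (𝒜 := grading 4) r x * (al (𝒜 := grading 4) x.1 (X k) * (grad k V η).1 x) := by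
      rw [map_smul]
      exact mul_left_comm _ _ _
    simp only [h1, ← Finset.mul_sum, h, mul_zero]

end Differentials

/-! ### Generators of the module of differentials on small affine open sets. -/

section Generators

lemma map_mul_pow_eq {L : Type} [CommRing L] {φ ψ : MvPolynomial (Fin 4) ℂ →+* L} {t : L}
    (hC : ∀ c, φ (C c) = ψ (C c)) (hX : ∀ k, φ (X k) * t = ψ (X k)) {n : ℕ}
    {r : MvPolynomial (Fin 4) ℂ} (hr : r ∈ grading 4 n) : φ r * t ^ n = ψ r := by
  rw [r.as_sum, map_sum, map_sum, Finset.sum_mul]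
  refine Finset.sum_congr rfl fun d hd => ?_
  have h1 : d.degree = n := by
    rw [Finsupp.degree_eq_weight_one]
    exact hr (mem_support_iff.1 hd)
  rw [monomial_eq, map_mul, map_mul, hC, mul_assoc, Finsupp.prod_fintype _ _ (by simp), map_prod, map_prod,
    ← h1, Finsupp.degree_eq_sum, ← Finset.prod_pow_eq_pow_sum, ← Finset.prod_mul_distrib]
  congr 1
  refine Finset.prod_congr rfl fun k _ => ?_
  rw [map_pow, map_pow, ← mul_pow, hX]

variable {V : (PSpace 3).Opens} {i : Fin 4}

/-- The regular function `r / z_i ^ m`, for a form `r` of degree `m`. -/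
def dehom (hV : V ≤ UU i) : MvPolynomial (Fin 4) ℂ →+* Γ(PSpace 3, V) :=
  eval₂Hom (cn V) fun k => ratio k hV

/-- The value at a point as a ring homomorphism. -/
def fvalHom (x : V) : Γ(PSpace 3, V) →+* Loc (grading 4) x.1 where
  toFun a := fval (V := V) (𝒜 := grading 4) a x
  map_one' := fval_one (V := V) (𝒜 := grading 4) x
  map_mul' a a' := fval_mul (V := V) (𝒜 := grading 4) a a' x
  map_zero' := fval_zero (V := V) (𝒜 := grading 4) x
  map_add' a a' := fval_add (V := V) (𝒜 := grading 4) a a' x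

lemma fvalHom_ext {a a' : Γ(PSpace 3, V)} (h : ∀ x, fvalHom x a = fvalHom x a') : a = a' :=
  fval_ext (V := V) (𝒜 := grading 4) h

lemma fvalHom_dehom (hV : V ≤ UU i) {n : ℕ} {r : MvPolynomial (Fin 4) ℂ} (hr : r ∈ grading 4 n) (x : V) :
    fvalHom x (dehom hV r) * al (𝒜 := grading 4) x.1 (X i) ^ n = al x.1 r := by
  refine map_mul_pow_eq (φ := (fvalHom x).comp (dehom hV)) (ψ := al (𝒜 := grading 4) x.1)
    (fun c => ?_) (fun k => ?_) hr
  · rw [RingHom.comp_apply, dehom, coe_eval₂Hom, eval₂_C]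
    exact fval_cn c x
  · rw [RingHom.comp_apply, dehom, coe_eval₂Hom, eval₂_X]
    exact fval_ratio k hV x

/-- The differentials of the coordinates `z_k / z_i`. -/
def dx (hV : V ≤ UU i) (a : Fin 3) : OmM V := dO (ratio (i.succAbove a) hV)

lemma rs_dx {W : (PSpace 3).Opens} (hV : V ≤ UU i) (h : W ≤ V) (a : Fin 3) :
    rs (F := Om.presheaf) h (dx hV a) = dx (h.trans hV) a := by
  rw [dx, rs_dO, rr_ratio]
  rfl

lemma ratio_self (hV : V ≤ UU i) : ratio i hV = 1 := fvalHom_ext fun x => by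
  apply (isUnit_al (hV x.2)).mul_left_injective
  exact (fval_ratio i hV x).trans ((congrArg (· * _) (map_one (fvalHom x))).trans (one_mul _)).symm

lemma dO_dehom_mem (hV : V ≤ UU i) (r : MvPolynomial (Fin 4) ℂ) :
    dO (dehom hV r) ∈ Submodule.span Γ(PSpace 3, V) (Set.range (dx hV)) := by
  induction r using MvPolynomial.induction_on with
  | C c =>
    rw [dehom, coe_eval₂Hom, eval₂_C, dO_cn]
    exact zero_mem _
  | add p q hp hq =>
    rw [map_add, dO_add]
    exact add_mem hp hq
  | mul_X p k hp =>
    rw [map_mul, dO_mul]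
    refine add_mem (Submodule.smul_mem _ _ ?_) (Submodule.smul_mem _ _ hp)
    rw [dehom, coe_eval₂Hom, eval₂_X]
    obtain rfl | ⟨a, rfl⟩ := Fin.eq_self_or_eq_succAbove i k
    · rw [ratio_self, ← map_one (cn V), dO_cn]
      exact zero_mem _
    · exact Submodule.subset_span ⟨a, rfl⟩

lemma dO_pow_mem {S : Submodule Γ(PSpace 3, V) (OmM V)} {a : Γ(PSpace 3, V)} (h : dO a ∈ S) (n : ℕ) :
    dO (a ^ n) ∈ S := by
  induction n with
  | zero =>
    rw [pow_zero, ← map_one (cn V), dO_cn]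
    exact zero_mem _
  | succ n ih =>
    rw [pow_succ, dO_mul]
    exact add_mem (Submodule.smul_mem _ _ h) (Submodule.smul_mem _ _ ih)

lemma dO_mem_of_mul_eq_one {S : Submodule Γ(PSpace 3, V) (OmM V)} {a b : Γ(PSpace 3, V)} (h : dO a ∈ S)
    (hab : a * b = 1) : dO b ∈ S := by
  have h1 : dO (a * b) = 0 := by rw [hab, ← map_one (cn V), dO_cn]
  rw [dO_mul] at h1
  have h2 : dO b = -(b * b) • dO a := by
    have h3 := congrArg (b • ·) h1
    simp only [smul_add, smul_smul, smul_zero] at h3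
    rw [mul_comm b a, hab, one_smul] at h3
    rw [neg_smul]
    exact eq_neg_of_add_eq_zero_left h3
  rw [h2]
  exact Submodule.smul_mem _ _ h

lemma pow_aux {R : Type} [CommRing R] {a e b f r t : R} {n m : ℕ} (hf : IsUnit f)
    (h1 : a * f ^ n = r) (h2 : e * t ^ (n * m) = r) (h3 : b * f = t ^ m) : a = e * b ^ n := by
  apply (hf.pow n).mul_left_injective
  simp only
  rw [h1, ← h2, mul_assoc, ← mul_pow, h3, ← pow_mul, mul_comm m n]

lemma inverse_aux {R : Type} [CommRing R] {c u a b f t : R} {m : ℕ} (h : c = a * b) (h' : u = 1)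
    (h1 : a * t ^ m = f) (h2 : b * f = t ^ m) : c * f = u * f := by
  rw [h, h', mul_assoc, h2, h1, one_mul]

/-- A regular function on D(f) has the form r / f^n, the product of r / z_i^(nm) and the n-th power
of z_i^m / f. The first factor is a polynomial in the ratios z_k / z_i, and z_i^m / f is the inverse
of another, so the Leibniz rule applies. -/
lemma span_dx {f : MvPolynomial (Fin 4) ℂ} {m : ℕ} (hf : f ∈ grading 4 m) (hm : 0 < m)
    (hVf : V = Proj.basicOpen (grading 4) f) (hV : V ≤ UU i) :
    Submodule.span Γ(PSpace 3, V) (Set.range (dx hV)) = ⊤ := by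
  rw [eq_top_iff, ← span_dO, Submodule.span_le]
  rintro _ ⟨a, rfl⟩
  have hfV (x : V) : f ∉ ProjectiveSpectrum.asHomogeneousIdeal (𝒜 := grading 4) x.1 := by
    have h : V ≤ Proj.basicOpen (grading 4) f := hVf.le
    exact h x.2
  have hXm : X i ^ m ∈ grading 4 m := by simpa using SetLike.pow_mem_graded m (X_mem_grading i)
  obtain ⟨b, hb⟩ : ∃ b : Γ(PSpace 3, V), ∀ x : V, fvalHom x b * al (𝒜 := grading 4) x.1 f =
      al (𝒜 := grading 4) x.1 (X i ^ m) :=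
    exists_reg (V := V) hXm hf fun x hx => hfV ⟨x, hx⟩
  obtain ⟨n, r, hr, ha⟩ : ∃ (n : ℕ) (r : MvPolynomial (Fin 4) ℂ), r ∈ grading 4 (n * m) ∧
      ∀ x : V, fvalHom x a * al (𝒜 := grading 4) x.1 (f ^ n) = al x.1 r := by
    subst hVf
    exact exists_fval_mul_pow hf hm a
  have h1 : dehom hV f * b = 1 := fvalHom_ext fun x => by
    apply (isUnit_al (hfV x)).mul_left_injective
    exact inverse_aux (map_mul _ _ _) (map_one _) (fvalHom_dehom hV hf x) ((hb x).trans (map_pow _ _ _))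
  have h2 : a = dehom hV r * b ^ n := fvalHom_ext fun x => by
    rw [map_mul, map_pow]
    refine pow_aux (isUnit_al (hfV x)) ?_ (fvalHom_dehom hV hr x) ((hb x).trans (map_pow _ _ _))
    rw [← map_pow]
    exact ha x
  rw [h2, dO_mul]
  exact add_mem (Submodule.smul_mem _ _ (dO_pow_mem (dO_mem_of_mul_eq_one (dO_dehom_mem hV f) h1) n))
    (Submodule.smul_mem _ _ (dO_dehom_mem hV r))

end Generators

/-! ### Differential forms and their Jacobian minors. -/

section Forms

/-- The presheaf of exterior powers of differentials. -/
def Lam (p : ℕ) : PMod (PSpace 3) := exteriorPowerPresheaf Om p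

/-- The group of differential forms on an open set. -/
abbrev LamM (p : ℕ) (V : (PSpace 3).Opens) : Type := (Lam p).presheaf.obj (op V)

variable {V : (PSpace 3).Opens} {p : ℕ}

/-- The exterior product of differentials. -/
def wd (p : ℕ) (V : (PSpace 3).Opens) : (OmM V) [⋀^Fin p]→ₗ[Γ(PSpace 3, V)] LamM p V :=
  exteriorPower.ιMulti Γ(PSpace 3, V) p (M := OmM V)

lemma rs_wd {W : (PSpace 3).Opens} (i : W ≤ V) (η : Fin p → OmM V) :
    rs (F := (Lam p).presheaf) i (wd p V η) = wd p W (fun a => rs i (η a)) :=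
  exteriorPowerMap_mk Om p (homOfLE i).op η

lemma span_wd {s : Set (OmM V)} (hs : Submodule.span Γ(PSpace 3, V) s = ⊤) :
    Submodule.span Γ(PSpace 3, V) (wd p V '' {η | Set.range η ⊆ s}) = ⊤ :=
  exteriorPower.ιMulti_span_of_span Γ(PSpace 3, V) p (OmM V) hs

lemma LamM_induction {P : LamM p V → Prop} (ω : LamM p V) (zero : P 0) (wd : ∀ η, P (wd p V η))
    (add : ∀ x y, P x → P y → P (x + y)) (smul : ∀ (r : Γ(PSpace 3, V)) x, P x → P (r • x)) : P ω := by
  have : ω ∈ Submodule.span Γ(PSpace 3, V) (ProjSheaf.wd p V '' {η | Set.range η ⊆ Set.univ}) := by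
    rw [span_wd Submodule.span_univ]
    trivial
  induction this using Submodule.span_induction with
  | mem x h =>
    obtain ⟨η, -, rfl⟩ := h
    exact wd η
  | zero => exact zero
  | add x y _ _ hx hy => exact add x y hx hy
  | smul r x _ hx => exact smul r x hx

lemma prod_mem_twistSections {ι : Type} [DecidableEq ι] (S : Finset ι) (g : ι → TW (-1) V) :
    (fun x : V => ∏ a ∈ S, (g a).1 x) ∈ twistSections (grading 4) (-(S.card : ℤ)) V := by
  induction S using Finset.induction_on with
  | empty =>
    have : (fun x : V => ∏ a ∈ (∅ : Finset ι), (g a).1 x) =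
        (toTw (V := V) (𝒜 := grading 4) 1).1 := by
      funext x
      exact Finset.prod_empty.trans (fval_one (V := V) (𝒜 := grading 4) x).symm
    rw [this]
    exact (toTw (V := V) (𝒜 := grading 4) 1).2
  | insert a S ha ih =>
    have h1 := (twMul (V := V) (𝒜 := grading 4)
      (by rw [Finset.card_insert_of_notMem ha]; push_cast; ring : -1 + -(S.card : ℤ) = -((insert a S).card : ℤ))
      (g a) ⟨_, ih⟩).2
    have h2 : (fun x : V => ∏ b ∈ insert a S, (g b).1 x) = fun x => (g a).1 x * ∏ b ∈ S, (g b).1 x :=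
      funext fun x => Finset.prod_insert ha
    rw [h2]
    exact h1

lemma det_mem_twistSections (M : Fin p → Fin p → TW (-1) V) :
    (fun x : V => Matrix.det (Matrix.of fun a b => (M a b).1 x)) ∈ twistSections (grading 4) (-(p : ℤ)) V := by
  have h1 : (fun x : V => Matrix.det (Matrix.of fun a b => (M a b).1 x)) =
      ∑ σ : Equiv.Perm (Fin p), (Equiv.Perm.sign σ : ℤ) • fun x : V => ∏ a, (M (σ a) a).1 x := by
    funext x
    rw [Matrix.det_apply, Finset.sum_apply]
    rfl
  rw [h1]
  refine sum_mem fun σ _ => zsmul_mem ?_ _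
  have := prod_mem_twistSections Finset.univ (fun a => M (σ a) a)
  rwa [Finset.card_univ, Fintype.card_fin] at this

/-- The Jacobian matrix. -/
def jac (m : Fin p → Fin 4) (η : Fin p → OmM V) (x : V) : Matrix (Fin p) (Fin p) (Loc (grading 4) x.1) :=
  Matrix.of fun a b => (grad (m b) V (η a)).1 x

lemma jac_update (m : Fin p → Fin 4) (η : Fin p → OmM V) (i : Fin p) (w : OmM V) (x : V) :
    jac m (Function.update η i w) x = (jac m η x).updateRow i fun b => (grad (m b) V w).1 x := by
  ext a b
  by_cases h : a = i
  · subst h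
    rw [Matrix.updateRow_self]
    exact congrArg (fun s => (grad (m b) V s).1 x) (Function.update_self a w η)
  · rw [Matrix.updateRow_ne h]
    exact congrArg (fun s => (grad (m b) V s).1 x) (Function.update_of_ne h w η)

lemma det_jac_add (m : Fin p → Fin 4) (η : Fin p → OmM V) (i : Fin p) (y z : OmM V) (x : V) :
    (jac m (Function.update η i (y + z)) x).det =
      (jac m (Function.update η i y) x).det + (jac m (Function.update η i z) x).det := by
  rw [jac_update, jac_update, jac_update, ← Matrix.det_updateRow_add]
  congr 2
  funext b
  exact congrArg (fun s => s.1 x) (map_add (grad (m b) V) y z)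

lemma det_jac_smul (m : Fin p → Fin 4) (η : Fin p → OmM V) (i : Fin p) (r : Γ(PSpace 3, V)) (y : OmM V)
    (x : V) : (jac m (Function.update η i (r • y)) x).det =
      fval (V := V) (𝒜 := grading 4) r x * (jac m (Function.update η i y) x).det := by
  rw [jac_update, jac_update, ← Matrix.det_updateRow_smul]
  congr 2
  funext b
  exact congrArg (fun s => s.1 x) (map_smul (grad (m b) V) r y)

/-- The minors of the Jacobian matrix. -/
def altD (m : Fin p → Fin 4) (V : (PSpace 3).Opens) :
    (OmM V) [⋀^Fin p]→ₗ[Γ(PSpace 3, V)] TW (-(p : ℤ)) V where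
  toFun η := ⟨fun x => (jac m η x).det, det_mem_twistSections fun a b => grad (m b) V (η a)⟩
  map_update_add' {inst} η i y z := tw_ext fun x => by
    obtain rfl : inst = instDecidableEqFin p := Subsingleton.elim _ _
    exact det_jac_add m η i y z x
  map_update_smul' {inst} η i r y := tw_ext fun x => by
    obtain rfl : inst = instDecidableEqFin p := Subsingleton.elim _ _
    exact det_jac_smul m η i r y x
  map_eq_zero_of_eq' η i j h hij := tw_ext fun x => by
    refine Matrix.det_zero_of_row_eq hij ?_
    funext b
    exact congrArg (fun s => (grad (m b) V s).1 x) h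

/-- The minors of the Jacobian matrix as functions on differential forms. -/
def mnr (m : Fin p → Fin 4) (V : (PSpace 3).Opens) : LamM p V →ₗ[Γ(PSpace 3, V)] TW (-(p : ℤ)) V :=
  exteriorPower.alternatingMapLinearEquiv (R := Γ(PSpace 3, V)) (M := OmM V) (altD m V)

lemma mnr_wd (m : Fin p → Fin 4) (η : Fin p → OmM V) (x : V) :
    (mnr m V (wd p V η)).1 x = (jac m η x).det :=
  congrArg (fun s => s.1 x) (exteriorPower.alternatingMapLinearEquiv_apply_ιMulti
    (R := Γ(PSpace 3, V)) (M := OmM V) (altD m V) η)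

lemma rs_mnr {W : (PSpace 3).Opens} (i : W ≤ V) (m : Fin p → Fin 4) (ω : LamM p V) :
    rs (F := twistPresheaf (grading 4) (-(p : ℤ))) i (mnr m V ω) = mnr m W (rs i ω) := by
  induction ω using LamM_induction with
  | zero =>
    refine (congrArg (rs _) (map_zero (mnr m V))).trans (Eq.symm ?_)
    exact (congrArg (mnr m W) (map_zero _)).trans (map_zero _)
  | wd η =>
    refine tw_ext fun x => ?_
    refine (mnr_wd m η ⟨x.1, i x.2⟩).trans (Eq.symm ?_)
    rw [rs_wd]
    refine (mnr_wd m _ x).trans ?_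
    refine congrArg Matrix.det ?_
    ext a b
    exact (congrArg (fun s => s.1 x) (rs_grad i (m b) (η a))).symm
  | add x y hx hy =>
    refine (congrArg (rs _) (map_add (mnr m V) x y)).trans (Eq.symm ?_)
    refine (congrArg (mnr m W) (map_add _ x y)).trans ((map_add _ _ _).trans ?_)
    exact (congrArg₂ (· + ·) hx hy).symm
  | smul r x hx =>
    rw [rs_smul, map_smul, map_smul, ← hx]
    rfl

end Forms

/-! ### Small open sets on which presheaves agree with their sheafifications. -/

section Comparison

/-- Families of sections of a sheaf form a sheaf. -/
lemma isSheaf_pw {X : TopCat.{0}} (ι : Type) (P : AbSheaf X) :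
    TopCat.Presheaf.IsSheaf (pw ι P.obj) := by
  refine (TopCat.Presheaf.isSheaf_iff_isSheaf_comp (forget Ab) (pw ι P.obj)).mpr ?_
  refine TopCat.Presheaf.isSheaf_of_isSheafUniqueGluing_types _ fun κ U s hs => ?_
  have h1 (k : ι) : TopCat.Presheaf.IsCompatible P.obj U fun j => s j k := fun a b =>
    congrFun (hs a b) k
  choose g hg hu using fun k => TopCat.Sheaf.existsUnique_gluing' P U (iSup U)
    (fun j => Opens.leSupr U j) le_rfl (fun j => s j k) (h1 k)
  exact ⟨g, fun j => funext fun k => hg k j, fun g' hg' => funext fun k =>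
    hu k (g' k) fun j => congrFun (hg' j) k⟩

/-- Principal open sets inside the standard affine ones. -/
def affBasis : Set (PSpace 3).Opens :=
  {V | ∃ (f : MvPolynomial (Fin 4) ℂ) (m : ℕ), f ∈ grading 4 m ∧ 0 < m ∧
    V = Proj.basicOpen (grading 4) f ∧ ∃ i, V ≤ UU i}

/-- A homogeneous component not vanishing at the point cuts out a smaller principal set.
Multiplication by z_i makes the degree positive and places the set inside a standard chart. -/
lemma isBasis_affBasis : Opens.IsBasis affBasis := by
  refine Opens.isBasis_iff_nbhd.2 fun {U x} hx => ?_
  obtain ⟨i, hi⟩ := exists_mem_UU x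
  obtain ⟨_, ⟨s, rfl⟩, hs, hsU⟩ :=
    (ProjectiveSpectrum.isTopologicalBasis_basic_opens (grading 4)).exists_subset_of_mem_open hx U.2
  have h1 : ∃ n, GradedRing.proj (grading 4) n s ∉
      ProjectiveSpectrum.asHomogeneousIdeal (𝒜 := grading 4) x := by
    by_contra! h
    refine hs ?_
    have := DirectSum.sum_support_decompose (grading 4) s
    rw [← this]
    exact sum_mem fun n _ => h n
  obtain ⟨n, hn⟩ := h1
  have hle : Proj.basicOpen (grading 4) (GradedRing.proj (grading 4) n s * X i) ≤ UU i :=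
    fun y hy h => hy (Ideal.mul_mem_left _ _ h)
  refine ⟨Proj.basicOpen (grading 4) (GradedRing.proj (grading 4) n s * X i),
    ⟨_, n + 1, SetLike.mul_mem_graded (SetLike.coe_mem _) (X_mem_grading i), n.succ_pos, rfl, i, hle⟩,
    mul_notMem _ hn hi, fun y hy => hsU fun h => hy (Ideal.mul_mem_right _ _ ?_)⟩
  exact y.asHomogeneousIdeal.isHomogeneous n h

variable {V : (PSpace 3).Opens}

/-- Below a standard chart the presheaf tensor product is identified with the sheaf F through z_i^b,
so sheafifying adds no sections there. -/
lemma bijective_toSheafifyMap_twist (F : (PSpace 3).Modules) (b : ℤ) {i : Fin 4} (hV : V ≤ UU i) :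
    Function.Bijective ((toSheafifyMap (tens (pm F) (pm (OO 3 b)))).app V) :=
  bijective_toSh isBasis_coordBasis ((SheafOfModules.toSheaf _).obj F) (EE F b) V ⟨i, hV⟩
    (fun _ h => ezpw F (h.trans hV) b) (fun _ _ _ _ _ => rfl)
    (fun _ h _ => ezpw_bijective (h.trans hV) b)

/-- The tensor product of families of linear maps, as a family of linear maps. -/
def ModMap.tens {X : Scheme.{0}} {M N M' N' : PMod X} (f : ModMap M M') (g : ModMap N N') :
    ModMap (tens M N) (tens M' N') where
  app V :=
    { toFun := (f.tensor g).app (op V)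
      map_add' := map_add _
      map_smul' := fun r z => by
        rw [RingHom.id_apply]
        induction z using tm_induction with
        | zero => rw [smul_zero, map_zero, smul_zero]
        | add x y hx hy => rw [smul_add, map_add, hx, hy, map_add, smul_add]
        | tmul m n =>
          rw [← LinearMap.smul_apply, ← map_smul]
          refine (tmHom_tm _ _ V _ _).trans (Eq.trans ?_ (congrArg (r • ·) (tmHom_tm _ _ V _ _)).symm)
          rw [map_smul, map_smul, LinearMap.smul_apply] }
  rs_app i z := ProjSheaf.rs_app (f.tensor g) i z

/-- The composition of families of linear maps. -/
def ModMap.comp {X : Scheme.{0}} {M N K : PMod X} (f : ModMap M N) (g : ModMap N K) : ModMap M K where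
  app V := (g.app V).comp (f.app V)
  rs_app i z := (g.rs_app i _).trans (congrArg _ (f.rs_app i z))

/-- The identity family. -/
def ModMap.id {X : Scheme.{0}} (M : PMod X) : ModMap M M where
  app _ := LinearMap.id
  rs_app _ _ := rfl

variable {p : ℕ}

lemma smul_zpw_eq_zero {i : Fin 4} {b : ℤ} (hV : V ≤ UU i) {a : Γ(PSpace 3, V)}
    (h : a • zpw hV b = 0) : a = 0 :=
  (exists_smul_twPow (V := V) (X_mem_grading i) (fun _ hx => hV hx) (0 : TW b V)).unique h
    (zero_smul Γ(PSpace 3, V) (zpw hV b))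

/-- Differential forms `w_t` generate the forms on an open set and there are minors which form
the dual basis, up to a twist. -/
structure IsDualBasis {i : Fin 4} (hV : V ≤ UU i) {T : Type} [Fintype T] [DecidableEq T]
    (ms : T → Fin p → Fin 4) (w : T → LamM p V) : Prop where
  dual (t t' : T) : mnr (ms t) V (w t') = if t = t' then zpw hV (-(p : ℤ)) else 0
  span (W : (PSpace 3).Opens) (h : W ≤ V) (hW : W ∈ affBasis) :
    Submodule.span Γ(PSpace 3, W) (Set.range fun t => (rs h (w t) : LamM p W)) = ⊤

variable {i : Fin 4} {hV : V ≤ UU i} {T : Type} [Fintype T] [DecidableEq T]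
  {ms : T → Fin p → Fin 4} {w : T → LamM p V}

lemma IsDualBasis.mnr_sum (h : IsDualBasis hV ms w) {W : (PSpace 3).Opens} (hW : W ≤ V)
    (a : T → Γ(PSpace 3, W)) (t : T) :
    mnr (ms t) W (∑ s, a s • rs hW (w s)) = a t • zpw (hW.trans hV) (-(p : ℤ)) := by
  rw [map_sum, Finset.sum_eq_single t]
  · rw [map_smul, ← rs_mnr, h.dual, if_pos rfl]
    rfl
  · intro s _ hs
    rw [map_smul, ← rs_mnr, h.dual, if_neg hs.symm]
    exact smul_zero _
  · simp

/-- Linear combinations of forms. -/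
def formSum (w : T → LamM p V) {W : (PSpace 3).Opens} (hW : W ≤ V) :
    (T → (pm (strSheaf (PSpace 3))).presheaf.obj (op W)) →+ LamM p W :=
  AddMonoidHom.mk' (fun a => ∑ s, toReg (a s) • rs hW (w s)) fun a b => by
    rw [← Finset.sum_add_distrib]
    exact Finset.sum_congr rfl fun s _ => add_smul _ _ _

/-- The forms `w` span, and the dual minors show their independence; hence forms below `V` are
compared with a finite power of the structure sheaf. -/
lemma IsDualBasis.bijective_toSheafifyMap (h : IsDualBasis hV ms w) (hVB : V ∈ affBasis) :
    Function.Bijective ((toSheafifyMap (Lam p)).app V) := by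
  refine bijective_toSh isBasis_affBasis
    ⟨pw T (pm (strSheaf (PSpace 3))).presheaf, isSheaf_pw T ((SheafOfModules.toSheaf _).obj (strSheaf _))⟩
    (Lam p).presheaf V hVB (fun W hW => formSum w hW) (fun W W' hW i a => ?_) (fun W hW hWB => ⟨?_, ?_⟩)
  · refine Eq.trans ?_ (map_sum _ _ _).symm
    refine Finset.sum_congr rfl fun t _ => ?_
    refine Eq.trans ?_ (rs_smul (Lam p) i _ _).symm
    rw [rs_rs]
    rfl
  · refine (injective_iff_map_eq_zero _).2 fun a ha => funext fun t => ?_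
    refine smul_zpw_eq_zero (hW.trans hV) (b := -(p : ℤ)) ((h.mnr_sum hW _ t).symm.trans ?_)
    exact (congrArg (mnr (ms t) W) ha).trans (map_zero _)
  · intro ω
    have h1 : ω ∈ Submodule.span Γ(PSpace 3, W) (Set.range fun t => (rs hW (w t) : LamM p W)) :=
      h.span W hW hWB ▸ trivial
    obtain ⟨a, ha⟩ := (Submodule.mem_span_range_iff_exists_fun _).1 h1
    exact ⟨a, ha⟩

end Comparison

/-! ### Coefficients of twisted forms with values in E(-1). -/

section Coefficients

variable {E : (PSpace 3).Modules} {V : (PSpace 3).Opens} {p : ℕ} {b c : ℤ}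

/-- The presheaf `U ↦ ⋀ᵖ Ω(U) ⊗ 𝒪(p)(U)`. -/
def LamTw (p : ℕ) : PMod (PSpace 3) := tens (Lam p) (pm (OO 3 p))

variable (E p) in
/-- The presheaf `U ↦ (E(U) ⊗ 𝒪(-1)(U)) ⊗ (⋀ᵖ Ω(U) ⊗ 𝒪(p)(U))`. -/
def formTens : PMod (PSpace 3) := tens (tens (pm E) (pm (OO 3 (-1)))) (LamTw p)

instance : Module Γ(PSpace 3, V) ((EE E b).obj (op V)) :=
  inferInstanceAs (Module Γ(PSpace 3, V) ((tens (pm E) (pm (OO 3 b))).presheaf.obj (op V)))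

lemma smul_etm (r : Γ(PSpace 3, V)) (m : (pm E).presheaf.obj (op V)) (f : TW b V) :
    r • etm m f = etm (r • m) f :=
  ((tm (pm E) (pm (OO 3 b)) V).map_smul₂ r m f).symm

lemma act_smul (h : b + 0 = c) (r : Γ(PSpace 3, V)) (s : TW 0 V) (z : (EE E b).obj (op V)) :
    act h s (r • z) = act h (r • s) z := by
  induction z using etm_induction with
  | zero =>
    rw [smul_zero, map_zero, map_zero]
  | add x y hx hy =>
    rw [smul_add, map_add, map_add, hx, hy]
  | tmul m f =>
    rw [smul_etm]
    rw [act_etm, act_etm, etm_smul]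
    exact congrArg (etm m) (tw_ext fun x => mul_left_comm _ _ _)

lemma balanced_mnr (m : Fin p → Fin 4) (V : (PSpace 3).Opens) :
    Balanced (M := Lam p) (N := pm (OO 3 p)) (V := V) (G := TW 0 V)
      (fun ω (f : TW (p : ℤ) V) => twMul (neg_add_cancel (p : ℤ)) (mnr m V ω) f) where
  add_left ω ω' f := by
    rw [map_add]
    exact add_twMul _ _ _ _
  add_right ω f f' := twMul_add _ _ _ _
  smul r ω f := by
    rw [map_smul]
    exact tw_ext fun x => (mul_assoc _ _ _).trans (mul_left_comm _ _ _)

/-- The coefficients of twisted differential forms. -/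
def lam (m : Fin p → Fin 4) : (LamTw p).presheaf ⟶ (pm (OO 3 0)).presheaf :=
  tmHom (M := Lam p) (N := pm (OO 3 p)) (G := (pm (OO 3 0)).presheaf)
    (f := fun V ω (f : TW (p : ℤ) V) => (twMul (neg_add_cancel (p : ℤ)) (mnr m V ω) f : TW 0 V))
    (fun V => balanced_mnr m V)
    (fun U V i ω f => by
      rw [← rs_mnr]
      rfl)

/-- The coefficients of twisted differential forms on an open set. -/
def lamV (m : Fin p → Fin 4) (V : (PSpace 3).Opens) : (LamTw p).presheaf.obj (op V) →+ TW 0 V :=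
  ((lam m).app (op V)).hom

/-- The twisted form `ω ⊗ f`. -/
def ltm (ω : LamM p V) (f : TW (p : ℤ) V) : (LamTw p).presheaf.obj (op V) :=
  tm (Lam p) (pm (OO 3 p)) V ω f

lemma lamV_ltm (m : Fin p → Fin 4) (ω : LamM p V) (f : TW (p : ℤ) V) :
    lamV m V (ltm ω f) = twMul (neg_add_cancel (p : ℤ)) (mnr m V ω) f :=
  tmLift_tm (balanced_mnr m V) ω f

lemma ltm_add (ω ω' : LamM p V) (f : TW (p : ℤ) V) : ltm (ω + ω') f = ltm ω f + ltm ω' f := by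
  rw [ltm, map_add]
  rfl

lemma smul_ltm (r : Γ(PSpace 3, V)) (ω : LamM p V) (f : TW (p : ℤ) V) :
    r • ltm ω f = ltm (r • ω) f := by
  rw [ltm, ltm, map_smul]
  rfl

lemma ltm_smul (r : Γ(PSpace 3, V)) (ω : LamM p V) (f : TW (p : ℤ) V) :
    ltm ω (r • f) = ltm (r • ω) f := by
  rw [← smul_ltm]
  exact (tm (Lam p) (pm (OO 3 p)) V ω).map_smul r f

lemma ltm_induction {P : (LamTw p).presheaf.obj (op V) → Prop} (y) (zero : P 0)
    (tmul : ∀ ω f, P (ltm ω f)) (add : ∀ x y, P x → P y → P (x + y)) : P y :=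
  tm_induction y zero tmul add

lemma lamV_smul (m : Fin p → Fin 4) (r : Γ(PSpace 3, V)) (y : (LamTw p).presheaf.obj (op V)) :
    lamV m V (r • y) = r • lamV m V y := by
  induction y using ltm_induction with
  | zero => rw [smul_zero, map_zero]; exact (smul_zero r).symm
  | add x y hx hy => rw [smul_add, map_add, map_add, hx, hy]; exact (smul_add r _ _).symm
  | tmul ω f =>
    rw [smul_ltm, lamV_ltm, lamV_ltm, map_smul]
    exact tw_ext fun x => mul_assoc _ _ _

lemma balanced_lam (m : Fin p → Fin 4) (V : (PSpace 3).Opens) :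
    Balanced (M := tens (pm E) (pm (OO 3 (-1)))) (N := LamTw p) (V := V) (G := (EE E (-1)).obj (op V))
      (fun z y => act (add_zero (-1)) (lamV m V y) z) where
  add_left z z' y := map_add _ _ _
  add_right z y y' := by
    rw [map_add]
    exact act_add _ _ _ _
  smul r z y := by
    rw [lamV_smul]
    exact act_smul _ r _ z

/-- The coefficients of twisted differential forms with values in `E(-1)`. -/
def coef (E : (PSpace 3).Modules) (m : Fin p → Fin 4) : (formTens E p).presheaf ⟶ EE E (-1) :=
  tmHom (M := tens (pm E) (pm (OO 3 (-1)))) (N := LamTw p) (G := EE E (-1))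
    (f := fun V z y => act (add_zero (-1)) (lamV m V y) z)
    (fun V => balanced_lam m V)
    (fun _ _ i z y => (rs_act _ _ i z).trans
      (congrArg (fun s => act _ s (rs i z)) (rs_app (lam m) i y)))

/-- The coefficients on an open set. -/
def coefV (E : (PSpace 3).Modules) (m : Fin p → Fin 4) (V : (PSpace 3).Opens) :
    (formTens E p).presheaf.obj (op V) →+ (EE E (-1)).obj (op V) :=
  ((coef E m).app (op V)).hom

/-- The tensor `z ⊗ y`. -/
def ftm (z : (EE E (-1)).obj (op V)) (y : (LamTw p).presheaf.obj (op V)) :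
    (formTens E p).presheaf.obj (op V) :=
  tm (tens (pm E) (pm (OO 3 (-1)))) (LamTw p) V z y

lemma coefV_ftm (m : Fin p → Fin 4) (z : (EE E (-1)).obj (op V)) (y) :
    coefV E m V (ftm z y) = act (add_zero (-1)) (lamV m V y) z :=
  tmLift_tm (balanced_lam m V) z y

lemma ftm_induction {P : (formTens E p).presheaf.obj (op V) → Prop} (q) (zero : P 0)
    (tmul : ∀ z ω f, P (ftm z (ltm ω f))) (add : ∀ x y, P x → P y → P (x + y)) : P q := by
  refine tm_induction q zero (fun z y => ?_) add
  induction y using ltm_induction with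
  | zero => rw [map_zero]; exact zero
  | add x y hx hy => rw [map_add]; exact add _ _ hx hy
  | tmul ω f => exact tmul z ω f

lemma coefV_ftm_ltm (m : Fin p → Fin 4) (z : (EE E (-1)).obj (op V)) (ω : LamM p V) (f : TW (p : ℤ) V) :
    coefV E m V (ftm z (ltm ω f)) =
      act (add_zero (-1)) (twMul (neg_add_cancel (p : ℤ)) (mnr m V ω) f) z := by
  rw [coefV_ftm, lamV_ltm]

variable {i : Fin 4} {hV : V ≤ UU i} {T : Type} [Fintype T]
  {ms : T → Fin p → Fin 4} {w : T → LamM p V}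

/-- Linear combinations of forms with coefficients in `E(-1)`. -/
def combine (E : (PSpace 3).Modules) (hV : V ≤ UU i) (w : T → LamM p V) (g : T → (EE E (-1)).obj (op V)) :
    (formTens E p).presheaf.obj (op V) :=
  ∑ t, ftm (g t) (ltm (w t) (zpw hV p))

lemma ftm_add (z z' : (EE E (-1)).obj (op V)) (y : (LamTw p).presheaf.obj (op V)) :
    ftm (z + z') y = ftm z y + ftm z' y :=
  (tm (tens (pm E) (pm (OO 3 (-1)))) (LamTw p) V).map_add₂ z z' y

lemma combine_add (g g' : T → (EE E (-1)).obj (op V)) :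
    combine E hV w (g + g') = combine E hV w g + combine E hV w g' := by
  rw [combine, combine, combine, ← Finset.sum_add_distrib]
  exact Finset.sum_congr rfl fun t _ => ftm_add _ _ _

/-- In a pure tensor the twisted function is a multiple of z_i^p and the form a combination of the
generators; all scalars move onto the section of E(-1). -/
lemma combine_surjective (hw : Submodule.span Γ(PSpace 3, V) (Set.range w) = ⊤) (q) :
    ∃ g, combine E hV w g = q := by
  induction q using ftm_induction with
  | zero =>
    refine ⟨0, Finset.sum_eq_zero fun t _ => ?_⟩
    exact LinearMap.map_zero₂ (tm (tens (pm E) (pm (OO 3 (-1)))) (LamTw p) V) _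
  | add x y hx hy =>
    obtain ⟨g, rfl⟩ := hx
    obtain ⟨g', rfl⟩ := hy
    exact ⟨g + g', combine_add _ _⟩
  | tmul z ω f =>
    obtain ⟨r, hr⟩ : ∃ r : Γ(PSpace 3, V), r • zpw hV p = f :=
      (exists_smul_twPow (V := V) (X_mem_grading i) (fun _ hx => hV hx) f).exists
    have h1 : r • ω ∈ Submodule.span Γ(PSpace 3, V) (Set.range w) := hw ▸ trivial
    obtain ⟨a, ha⟩ := (Submodule.mem_span_range_iff_exists_fun _).1 h1
    refine ⟨fun t => a t • z, ?_⟩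
    have h2 : ltm ω f = ∑ t, a t • ltm (w t) (zpw hV p) := by
      rw [← hr]
      refine (ltm_smul r ω (zpw hV p)).trans ?_
      rw [← ha]
      simp only [smul_ltm]
      exact LinearMap.map_sum₂ (tm (Lam p) (pm (OO 3 p)) V) _ _ _
    rw [h2]
    refine Eq.trans ?_ (map_sum (tm (tens (pm E) (pm (OO 3 (-1)))) (LamTw p) V z) _ _).symm
    refine Finset.sum_congr rfl fun t _ => ?_
    refine ((tm (tens (pm E) (pm (OO 3 (-1)))) (LamTw p) V).map_smul₂ _ _ _).trans ?_
    exact ((tm (tens (pm E) (pm (OO 3 (-1)))) (LamTw p) V z).map_smul _ _).symm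

lemma IsDualBasis.coefV_combine [DecidableEq T] (h : IsDualBasis hV ms w) (g : T → (EE E (-1)).obj (op V)) (t : T) :
    coefV E (ms t) V (combine E hV w g) = g t := by
  rw [combine, map_sum, Finset.sum_eq_single t]
  · rw [coefV_ftm_ltm, h.dual, if_pos rfl, zpw_mul]
    exact act_one _ (zpw_zero hV) _ _
  · intro s _ hs
    rw [coefV_ftm_ltm, h.dual, if_neg hs.symm]
    have : twMul (V := V) (𝒜 := grading 4) (neg_add_cancel (p : ℤ)) 0 (zpw hV p) = 0 :=
      tw_ext fun x => zero_mul _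
    rw [this, act_zero]
  · simp

end Coefficients

/-! ### From families satisfying Koszul relations to tensor products with forms. -/

section Transfer

variable {E : (PSpace 3).Modules} {p : ℕ} {I : Type}
  (ms : I → Fin p → Fin 4)
  (S : ∀ V : (PSpace 3).Opens, AddSubgroup (I → (EE E (-1)).obj (op V)))

/-- A system of equations which, on small open sets, determines families indexed by `I` by a part of
them for which the corresponding minors have a dual basis. -/
def HasDualBases : Prop :=
  ∀ V ∈ affBasis, ∃ (i : Fin 4) (hV : V ≤ UU i) (n : ℕ) (j : Fin n → I) (w : Fin n → LamM p V),
    IsDualBasis hV (fun t => ms (j t)) w ∧ ∀ g ∈ S V, (∀ t, g (j t) = 0) → g = 0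

/-- The equations hold for the coefficients of forms. -/
def HoldsForForms : Prop :=
  ∀ (V : (PSpace 3).Opens) (z : (EE E (-1)).obj (op V)) (η : Fin p → OmM V) (f : TW (p : ℤ) V),
    (fun k => coefV E (ms k) V (ftm z (ltm (wd p V η) f))) ∈ S V

variable {ms S}

lemma HoldsForForms.mem (h : HoldsForForms ms S) {V : (PSpace 3).Opens}
    (q : (formTens E p).presheaf.obj (op V)) : (fun k => coefV E (ms k) V q) ∈ S V := by
  induction q using ftm_induction with
  | zero =>
    have : (fun k => coefV E (ms k) V 0) = 0 := funext fun k => map_zero _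
    rw [this]
    exact zero_mem _
  | add x y hx hy =>
    have : (fun k => coefV E (ms k) V (x + y)) =
      (fun k => coefV E (ms k) V x) + fun k => coefV E (ms k) V y := funext fun k => map_add _ _ _
    rw [this]
    exact add_mem hx hy
  | tmul z ω f =>
    induction ω using LamM_induction generalizing f with
    | zero =>
      have : ltm (0 : LamM p V) f = 0 := (tm (Lam p) (pm (OO 3 p)) V).map_zero₂ f
      have h1 : (fun k => coefV E (ms k) V (ftm z (ltm 0 f))) = 0 := funext fun k => by
        rw [this]
        exact (congrArg (coefV E (ms k) V) (map_zero _)).trans (map_zero _)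
      rw [h1]
      exact zero_mem _
    | wd η => exact h V z η f
    | add x y hx hy =>
      have h1 : (fun k => coefV E (ms k) V (ftm z (ltm (x + y) f))) =
          (fun k => coefV E (ms k) V (ftm z (ltm x f))) + fun k => coefV E (ms k) V (ftm z (ltm y f)) :=
        funext fun k => by
          rw [ltm_add, ftm, map_add]
          exact map_add _ _ _
      rw [h1]
      exact add_mem (hx f) (hy f)
    | smul r x hx =>
      -- The scalar is absorbed into the twisted function, which is why the induction is over all
      -- `f`.
      rw [← ltm_smul]
      exact hx _

variable (hS : ∀ (U V : (PSpace 3).Opens) (i : V ≤ U),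
  ∀ s ∈ S U, rs (F := pw I (EE E (-1))) i s ∈ S V)

/-- The coefficients of forms as a morphism. -/
def coefMap (h : HoldsForForms ms S) : (formTens E p).presheaf ⟶ subP (pw I (EE E (-1))) S hS :=
  subPLift (P := pw I (EE E (-1))) S hS (pwLift fun k => coef E (ms k)) fun _ q => h.mem q

lemma coefMap_eq_zero {h : HoldsForForms ms S} {V : (PSpace 3).Opens} {q}
    (hq : (coefMap hS h).app (op V) q = 0) (k : I) : coefV E (ms k) V q = 0 := by
  have h1 := congrArg ((subPι (pw I (EE E (-1))) S hS).app (op V)) hq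
  rw [map_zero] at h1
  exact congrFun h1 k

lemma coefMap_eq {h : HoldsForForms ms S} {V : (PSpace 3).Opens} {q} {g : S V}
    (hq : (fun k => coefV E (ms k) V q) = g.1) : (coefMap hS h).app (op V) q = g :=
  Subtype.ext hq

/-- Coefficients at the chosen indices recover a combination of the dual basis, which gives
injectivity. For surjectivity, combine the chosen entries of a family: the result satisfies the same
equations, agrees at the chosen indices, and hence everywhere. -/
lemma bijOn_coefMap (h : HoldsForForms ms S) (h' : HasDualBases ms S) :
    BijOn affBasis (coefMap hS h) := by
  intro V hVB
  obtain ⟨i, hV, n, j, w, hw, hinj⟩ := h' V hVB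
  have hspan : Submodule.span Γ(PSpace 3, V) (Set.range w) = ⊤ := by
    have := hw.span V le_rfl hVB
    have h1 : (fun t => rs (le_refl V) (w t)) = w := funext fun t => rs_rfl _ _
    rwa [h1] at this
  refine ⟨(injective_iff_map_eq_zero _).2 fun q hq => ?_, fun g => ?_⟩
  · obtain ⟨g, rfl⟩ := combine_surjective (E := E) (hV := hV) hspan q
    have h0 (t : Fin n) : g t = 0 := by
      rw [← hw.coefV_combine g t]
      exact coefMap_eq_zero hS hq (j t)
    have h1 : g = 0 := funext h0
    have h2 : combine E hV w (0 : Fin n → (EE E (-1)).obj (op V)) = 0 := by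
      have := combine_add (E := E) (hV := hV) (w := w) 0 0
      rw [add_zero] at this
      exact left_eq_add.1 this
    rw [h1, h2]
  · obtain ⟨g, hg⟩ := g
    refine ⟨combine E hV w (g ∘ j), coefMap_eq hS (sub_eq_zero.1 ?_)⟩
    refine hinj _ (sub_mem (h.mem _) hg) fun t => ?_
    exact sub_eq_zero.2 (hw.coefV_combine (g ∘ j) t)

/-- The morphism to the sheaf of twisted differential forms. -/
def formMap (p : ℕ) : ModMap (LamTw p) (pm (twistBy (OmegaP 3 p) p)) :=
  ((toSheafifyMap (Lam p)).tens (ModMap.id (pm (OO 3 p)))).comp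
    (toSheafifyMap (tens (pm (OmegaP 3 p)) (pm (OO 3 p))))

lemma bijective_formMap (h' : HasDualBases ms S) {V : (PSpace 3).Opens} (hVB : V ∈ affBasis) :
    Function.Bijective ((formMap p).app V) := by
  obtain ⟨i, hV, n, j, w, hw, -⟩ := h' V hVB
  refine (bijective_toSheafifyMap_twist (OmegaP 3 p) p hV).comp ?_
  exact ModMap.tensor_bijective _ _ V (hw.bijective_toSheafifyMap hVB) Function.bijective_id

/-- The tensor product with a sheaf of differential forms is computed by coefficients. -/
theorem subsingleton_H_two_tensor_forms (h : HoldsForForms ms S) (h' : HasDualBases ms S)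
    (hK : Subsingleton ((aSh (subP (pw I (EE E (-1))) S hS)).H 2)) :
    Subsingleton (H 2 (tensor (twistBy E (-1)) (twistBy (OmegaP 3 p) p))) := by
  have h1 := (bijOn_coefMap hS h h').isIso isBasis_affBasis
  have h2 := subsingleton_H_of_isIso' (aShMap (coefMap hS h)) 2 hK
  -- The presheaf tensor product of unsheafified factors is compared with that of the sheaves E(-1)
  -- and Ω^p(p); both factors agree on the basis, so the sheafifications agree.
  let φ := (toSheafifyMap (tens (pm E) (pm (OO 3 (-1))))).tensor (formMap p)
  have h3 : BijOn affBasis φ := fun V hVB => by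
    obtain ⟨i, hV, -⟩ := h' V hVB
    exact ModMap.tensor_bijective _ _ V (bijective_toSheafifyMap_twist E (-1) hV)
      (bijective_formMap h' hVB)
  have h4 := h3.isIso isBasis_affBasis
  exact subsingleton_H_of_isIso (aShMap φ) 2 h2

end Transfer

/-! ### Coordinate differentials and the minors dual to their products. -/

section DualBasis

variable {V : (PSpace 3).Opens} {p : ℕ} {i : Fin 4}

lemma pd_ratio_aux {R : Type} [CommRing R] {u t d a b w e : R} (h : u * a + t * d = b) (ha : a = 0)
    (hw : w * t = 1) (hb : b = e) : d = e * w := by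
  subst ha hb
  linear_combination w * h - d * hw

/-- Differentiate (z_a/z_i) · z_i = z_a with respect to a coordinate other than z_i and divide by
z_i. -/
lemma pd_ratio (hV : V ≤ UU i) (c a : Fin 3) :
    pd (i.succAbove c) (ratio (i.succAbove a) hV) = if a = c then zpw hV (-1) else 0 :=
  tw_ext fun x => by
    have h1 := fval_ratio (i.succAbove a) hV x
    have h2 := congrArg (pdl (i.succAbove c) x.1) h1
    have h3 := (pdl_mul (i.succAbove c) x.1 _ _).symm.trans (h2.trans (pdl_al _ _ _))
    have h4 : pdl (i.succAbove c) x.1 (al (𝒜 := grading 4) x.1 (X i)) = 0 := by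
      refine (pdl_al _ _ _).trans ?_
      rw [pderiv_X_of_ne (Fin.succAbove_ne i c).symm]
      exact map_zero _
    have h5 : (zpw hV (-1)).1 x * al (𝒜 := grading 4) x.1 (X i) = 1 := by
      refine Eq.trans ?_ (twPow_mul_cancel (V := V) (X_mem_grading i) (neg_add_cancel 1) (fun _ hx => hV hx) x)
      exact congrArg ((zpw hV (-1)).1 x * ·) (twPow_one (V := V) (X_mem_grading i) (fun _ hx => hV hx) x).symm
    by_cases h : a = c
    · subst h
      rw [if_pos rfl]
      refine (pd_ratio_aux h3 h4 h5 (e := 1) ?_).trans (one_mul _)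
      rw [pderiv_X_self]
      exact map_one _
    · rw [if_neg h]
      refine (pd_ratio_aux h3 h4 h5 (e := 0) ?_).trans (zero_mul _)
      rw [pderiv_X_of_ne fun h' => h (Fin.succAbove_right_injective h')]
      exact map_zero _

lemma grad_dx (hV : V ≤ UU i) (c a : Fin 3) :
    grad (i.succAbove c) V (dx hV a) = if a = c then zpw hV (-1) else 0 :=
  (grad_dO _ _).trans (pd_ratio hV c a)

lemma zpw_neg_one_pow (hV : V ≤ UU i) (x : V) (n : ℕ) :
    (zpw hV (-1)).1 x ^ n = (zpw hV (-(n : ℤ))).1 x := by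
  induction n with
  | zero => exact (pow_zero _).trans (zpw_zero hV x).symm
  | succ n ih =>
    rw [pow_succ, ih]
    exact congrArg (fun s => s.1 x) (zpw_mul hV (by push_cast; ring : -(n : ℤ) + -1 = -((n + 1 : ℕ) : ℤ)))

/-- Exterior products of the differentials of the coordinates. -/
def wdx (hV : V ≤ UU i) (u : Fin p → Fin 3) : LamM p V := wd p V fun a => dx hV (u a)

lemma rs_wdx {W : (PSpace 3).Opens} (hV : V ≤ UU i) (h : W ≤ V) (u : Fin p → Fin 3) :
    rs (F := (Lam p).presheaf) h (wdx hV u) = wdx (h.trans hV) u := by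
  rw [wdx, rs_wd]
  simp only [rs_dx]
  rfl

lemma jac_dx (hV : V ≤ UU i) (u u' : Fin p → Fin 3) (x : V) (a b : Fin p) :
    jac (fun b => i.succAbove (u b)) (fun a => dx hV (u' a)) x a b =
      if u' a = u b then (zpw hV (-1)).1 x else 0 := by
  refine (congrArg (fun s => s.1 x) (grad_dx hV (u b) (u' a))).trans ?_
  split <;> rfl

lemma mnr_wdx_self (hV : V ≤ UU i) {u : Fin p → Fin 3} (hu : Function.Injective u) :
    mnr (fun b => i.succAbove (u b)) V (wdx hV u) = zpw hV (-(p : ℤ)) := tw_ext fun x => by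
  refine (mnr_wd _ _ x).trans ?_
  have : jac (fun b => i.succAbove (u b)) (fun a => dx hV (u a)) x =
      Matrix.diagonal fun _ => (zpw hV (-1)).1 x := by
    ext a b
    refine (jac_dx hV u u x a b).trans ?_
    by_cases hab : a = b
    · subst hab
      exact (if_pos rfl).trans (Matrix.diagonal_apply_eq (fun _ => (zpw hV (-1)).1 x) a).symm
    · exact (if_neg fun h => hab (hu h)).trans (Matrix.diagonal_apply_ne (fun _ => (zpw hV (-1)).1 x) hab).symm
  rw [this, Matrix.det_diagonal, Finset.prod_const, Finset.card_univ, Fintype.card_fin]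
  exact zpw_neg_one_pow hV x p

lemma mnr_wdx_of_ne (hV : V ≤ UU i) {u u' : Fin p → Fin 3} (a : Fin p) (h : ∀ b, u' a ≠ u b) :
    mnr (fun b => i.succAbove (u b)) V (wdx hV u') = 0 := tw_ext fun x => by
  refine (mnr_wd _ _ x).trans (Matrix.det_eq_zero_of_row_eq_zero a fun b => ?_)
  exact (jac_dx hV u u' x a b).trans (if_neg (h b))

/-- A product with a repeated factor vanishes, and any other is, up to sign, a permutation of one of
the listed products. -/
lemma span_wdx {T : Type} {u : T → Fin p → Fin 3}
    (h : ∀ v : Fin p → Fin 3, Function.Injective v → ∃ t, ∀ a, ∃ b, u t b = v a)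
    (hVB : V ∈ affBasis) (hV : V ≤ UU i) :
    Submodule.span Γ(PSpace 3, V) (Set.range fun t => wdx hV (u t)) = ⊤ := by
  obtain ⟨f, m, hf, hm, hVf, -⟩ := hVB
  rw [eq_top_iff, ← span_wd (p := p) (span_dx hf hm hVf hV), Submodule.span_le]
  rintro _ ⟨η, hη, rfl⟩
  choose v hv using fun a => hη ⟨a, rfl⟩
  obtain rfl : (fun a => dx hV (v a)) = η := funext hv
  by_cases hinj : Function.Injective v
  · obtain ⟨t, ht⟩ := h v hinj
    choose σ hσ using ht
    have hσi : Function.Injective σ := fun a b hab => hinj ((hσ a).symm.trans ((congrArg (u t) hab).trans (hσ b)))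
    let e : Equiv.Perm (Fin p) := Equiv.ofBijective σ (Finite.injective_iff_bijective.1 hσi)
    have h1 : (fun a => dx hV (v a)) = (fun a => dx hV (u t a)) ∘ e :=
      funext fun a => congrArg (dx hV) (hσ a).symm
    rw [h1, AlternatingMap.map_perm]
    have h2 : wdx hV (u t) ∈ Submodule.span Γ(PSpace 3, V) (Set.range fun t => wdx hV (u t)) :=
      Submodule.subset_span ⟨t, rfl⟩
    exact zsmul_mem h2 _
  · obtain ⟨a, b, hab, hne⟩ : ∃ a b, v a = v b ∧ a ≠ b := by
      rw [Function.Injective] at hinj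
      push Not at hinj
      exact hinj
    rw [(wd p V).map_eq_zero_of_eq _ (congrArg (dx hV) hab) hne]
    exact zero_mem _

/-- Exterior products of the differentials of the coordinates are dual to the corresponding minors. -/
lemma isDualBasis_wdx (hV : V ≤ UU i) {T : Type} [Fintype T] [DecidableEq T] {u : T → Fin p → Fin 3}
    {ms : T → Fin p → Fin 4} (hms : ∀ t b, ms t b = i.succAbove (u t b))
    (h₁ : ∀ t, Function.Injective (u t)) (h₂ : ∀ t t', t ≠ t' → ∃ a, ∀ b, u t' a ≠ u t b)
    (h₃ : ∀ v : Fin p → Fin 3, Function.Injective v → ∃ t, ∀ a, ∃ b, u t b = v a) :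
    IsDualBasis hV ms fun t => wdx hV (u t) where
  dual t t' := by
    obtain rfl : ms = fun t b => i.succAbove (u t b) := funext fun t => funext (hms t)
    split_ifs with h
    · subst h
      exact mnr_wdx_self hV (h₁ t)
    · obtain ⟨a, ha⟩ := h₂ t t' h
      exact mnr_wdx_of_ne hV a ha
  span W h hW := by
    simp only [rs_wdx]
    exact span_wdx h₃ hW _

end DualBasis

/-! ### Hodge duality for two and three indices out of four. -/

section Combinatorics

/-- Complementary pairs of indices, with orientation. -/
def hodgeTwo (q : Fin 4 × Fin 4) : Fin 2 → Fin 4 :=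
  (![![![0, 0], ![2, 3], ![3, 1], ![1, 2]], ![![3, 2], ![0, 0], ![0, 3], ![2, 0]],
    ![![1, 3], ![3, 0], ![0, 0], ![0, 1]], ![![2, 1], ![0, 2], ![1, 0], ![0, 0]]] :
    Fin 4 → Fin 4 → Fin 2 → Fin 4) q.1 q.2

/-- Complementary triples of indices, with orientation. -/
def hodgeThree : Fin 4 → Fin 3 → Fin 4 := ![![1, 2, 3], ![0, 3, 2], ![0, 1, 3], ![0, 2, 1]]

/-- A left inverse of `Fin.succAbove`. -/
def unskip (i k : Fin 4) : Fin 3 :=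
  (![![0, 0, 1, 2], ![0, 0, 1, 2], ![0, 1, 0, 2], ![0, 1, 2, 0]] : Fin 4 → Fin 4 → Fin 3) i k

variable {R : Type} [CommRing R] {z v u w : Fin 4 → R}

lemma hodgeTwo_self (m : Fin 4) : hodgeTwo (m, m) = ![0, 0] := by
  fin_cases m <;> rfl

lemma hodgeTwo_swap (m n : Fin 4) :
    hodgeTwo (n, m) 0 = hodgeTwo (m, n) 1 ∧ hodgeTwo (n, m) 1 = hodgeTwo (m, n) 0 := by
  revert m n
  decide

/-- If z pairs to zero with v and u, contraction with z kills v ∧ u. Its a-th entry is u_a (z·v) -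
v_a (z·u), where a is the index complementary to l, m, n; passing to complementary pairs turns this
contraction into the Koszul relation. -/
lemma hodgeTwo_relation (hv : ∑ k, z k * v k = 0) (hu : ∑ k, z k * u k = 0) (l m n : Fin 4) :
    z l * (v (hodgeTwo (m, n) 0) * u (hodgeTwo (m, n) 1) - v (hodgeTwo (m, n) 1) * u (hodgeTwo (m, n) 0)) +
    z m * (v (hodgeTwo (n, l) 0) * u (hodgeTwo (n, l) 1) - v (hodgeTwo (n, l) 1) * u (hodgeTwo (n, l) 0)) +
    z n * (v (hodgeTwo (l, m) 0) * u (hodgeTwo (l, m) 1) - v (hodgeTwo (l, m) 1) * u (hodgeTwo (l, m) 0)) =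
      0 := by
  rw [Fin.sum_univ_four] at hv hu
  fin_cases l <;> fin_cases m <;> fin_cases n <;> simp [hodgeTwo] <;>
  first
  | ring1
  | linear_combination v 0 * hu - u 0 * hv
  | linear_combination v 1 * hu - u 1 * hv
  | linear_combination v 2 * hu - u 2 * hv
  | linear_combination v 3 * hu - u 3 * hv
  | linear_combination u 0 * hv - v 0 * hu
  | linear_combination u 1 * hv - v 1 * hu
  | linear_combination u 2 * hv - v 2 * hu
  | linear_combination u 3 * hv - v 3 * hu

/-- The signed maximal minors of three vectors orthogonal to z are proportional to z. -/
lemma hodgeThree_relation (hv : ∑ k, z k * v k = 0) (hu : ∑ k, z k * u k = 0) (hw : ∑ k, z k * w k = 0)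
    (m n : Fin 4) :
    z m * Matrix.det (Matrix.of fun a b => ![v, u, w] a (hodgeThree n b)) =
      z n * Matrix.det (Matrix.of fun a b => ![v, u, w] a (hodgeThree m b)) := by
  rw [Fin.sum_univ_four] at hv hu hw
  -- Expanding along columns, this is Σ_k z_k det(columns k, a, b) = 0; only the two indices k
  -- outside {a, b} contribute.
  have key (a b : Fin 4) := congrArg₂ (· + ·) (congrArg₂ (· + ·)
    (congrArg (· * (u a * w b - u b * w a)) hv) (congrArg (· * (v b * w a - v a * w b)) hu))
    (congrArg (· * (v a * u b - v b * u a)) hw)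
  rw [Matrix.det_fin_three, Matrix.det_fin_three]
  fin_cases m <;> fin_cases n <;> simp [hodgeThree] <;>
  first
  | ring1
  | linear_combination key 0 1
  | linear_combination key 0 2
  | linear_combination key 0 3
  | linear_combination key 1 2
  | linear_combination key 1 3
  | linear_combination key 2 3
  | linear_combination -key 0 1
  | linear_combination -key 0 2
  | linear_combination -key 0 3
  | linear_combination -key 1 2
  | linear_combination -key 1 3
  | linear_combination -key 2 3

lemma hodgeTwo_eq (i : Fin 4) (t : Fin 3) (b : Fin 2) :
    hodgeTwo (i, i.succAbove t) b = i.succAbove (unskip i (hodgeTwo (i, i.succAbove t) b)) := by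
  revert i t b
  decide

lemma hodgeThree_eq (i : Fin 4) (b : Fin 3) :
    hodgeThree i b = i.succAbove (unskip i (hodgeThree i b)) := by
  revert i b
  decide

lemma injective_unskip_hodgeTwo (i : Fin 4) (t : Fin 3) :
    Function.Injective fun b => unskip i (hodgeTwo (i, i.succAbove t) b) := by
  revert i t
  decide

lemma exists_unskip_hodgeTwo_ne (i : Fin 4) (t t' : Fin 3) (h : t ≠ t') :
    ∃ a, ∀ b, unskip i (hodgeTwo (i, i.succAbove t') a) ≠ unskip i (hodgeTwo (i, i.succAbove t) b) := by
  revert i t t'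
  decide

lemma exists_unskip_hodgeTwo_eq (i : Fin 4) (v : Fin 2 → Fin 3) (hv : Function.Injective v) :
    ∃ t, ∀ a, ∃ b, unskip i (hodgeTwo (i, i.succAbove t) b) = v a := by
  have key : ∀ (i : Fin 4) (x y : Fin 3), x ≠ y → ∃ t : Fin 3,
      (∃ b, unskip i (hodgeTwo (i, i.succAbove t) b) = x) ∧
      ∃ b, unskip i (hodgeTwo (i, i.succAbove t) b) = y := by decide
  obtain ⟨t, h0, h1⟩ := key i (v 0) (v 1) fun h => by simpa using hv h
  exact ⟨t, Fin.forall_fin_two.2 ⟨h0, h1⟩⟩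

lemma bijective_unskip_hodgeThree (i : Fin 4) :
    Function.Bijective fun b => unskip i (hodgeThree i b) := by
  rw [← Finite.injective_iff_bijective]
  revert i
  decide

end Combinatorics

/-! ### The Koszul relations hold for forms and determine their coefficients. -/

section Instances

variable {E : (PSpace 3).Modules} {V : (PSpace 3).Opens} {p : ℕ}

/-- A minor of the matrix of partial derivatives of functions, times a twisted function. -/
def minorTwist (m : Fin p → Fin 4) (η : Fin p → OmM V) (f : TW (p : ℤ) V) : TW 0 V :=
  twMul (neg_add_cancel (p : ℤ)) (mnr m V (wd p V η)) f

lemma minorTwist_apply (m : Fin p → Fin 4) (η : Fin p → OmM V) (f : TW (p : ℤ) V) (x : V) :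
    (minorTwist m η f).1 x = (jac m η x).det * f.1 x :=
  congrArg (· * f.1 x) (mnr_wd m η x)

lemma coefV_ftm_wd (m : Fin p → Fin 4) (z : (EE E (-1)).obj (op V)) (η : Fin p → OmM V)
    (f : TW (p : ℤ) V) : coefV E m V (ftm z (ltm (wd p V η) f)) =
      act (add_zero (-1)) (minorTwist m η f) z :=
  coefV_ftm_ltm m z _ f

/-- A minor of the matrix of partial derivatives of functions, times a coordinate. -/
def minorCoord (k : Fin 4) (m : Fin p → Fin 4) (η : Fin p → OmM V) (f : TW (p : ℤ) V) : TW 1 V :=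
  twMul (zero_add 1) (minorTwist m η f) (zs k V)

lemma minorCoord_apply (k : Fin 4) (m : Fin p → Fin 4) (η : Fin p → OmM V) (f : TW (p : ℤ) V)
    (x : V) : (minorCoord k m η f).1 x =
      al (𝒜 := grading 4) x.1 (X k) * (jac m η x).det * f.1 x := by
  have h1 : (minorCoord k m η f).1 x = (jac m η x).det * f.1 x * al (𝒜 := grading 4) x.1 (X k) :=
    congrArg₂ (· * ·) (minorTwist_apply m η f x) (zs_apply k x)
  rw [h1]
  ring

lemma act_zs_coefV (k : Fin 4) (m : Fin p → Fin 4) (z : (EE E (-1)).obj (op V))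
    (η : Fin p → OmM V) (f : TW (p : ℤ) V) :
    act (by rfl : (-1 : ℤ) + 1 = 0) (zs k V) (coefV E m V (ftm z (ltm (wd p V η) f))) =
      act (by rfl : (-1 : ℤ) + 1 = 0) (minorCoord k m η f) z := by
  rw [coefV_ftm_wd]
  exact act_act _ _ _ _ _ _

/-- The vanishing of the pairing of a form with the Euler vector field. -/
lemma sum_coord_mul_grad (η : OmM V) (x : V) :
    ∑ k, al (𝒜 := grading 4) x.1 (X k) * (grad k V η).1 x = 0 := sum_mul_grad η x

lemma add_mul_four {R : Type} [CommRing R] {a b c d f : R} (h : a + b + c + d = 0) :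
    a * f + b * f + c * f + d * f = 0 := by
  linear_combination f * h

lemma holdsForForms_kosOne : HoldsForForms (p := 1) (fun k _ => k) (kosOneSub E) := by
  intro V z η f
  change ∑ k, _ = _
  simp only [act_zs_coefV]
  rw [Fin.sum_univ_four, ← act_add, ← act_add, ← act_add]
  refine Eq.trans ?_ (act_zero (E := E) (by rfl : (-1 : ℤ) + 1 = 0) z)
  refine congrArg (fun s => act _ s z) (tw_ext fun x => ?_)
  have h0 := (Fin.sum_univ_four _).symm.trans (sum_coord_mul_grad (η 0) x)
  have h1 (k : Fin 4) : (minorCoord k (fun _ => k) η f).1 x =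
      al (𝒜 := grading 4) x.1 (X k) * (grad k V (η 0)).1 x * f.1 x :=
    (minorCoord_apply k _ η f x).trans
      (congrArg (al (𝒜 := grading 4) x.1 (X k) * · * f.1 x) (Matrix.det_fin_one _))
  exact (congrArg₂ (· + ·) (congrArg₂ (· + ·) (congrArg₂ (· + ·) (h1 0) (h1 1)) (h1 2)) (h1 3)).trans
    (add_mul_four h0)

lemma det_jac_two (m : Fin 2 → Fin 4) (η : Fin 2 → OmM V) (x : V) :
    (jac m η x).det = (grad (m 0) V (η 0)).1 x * (grad (m 1) V (η 1)).1 x -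
      (grad (m 1) V (η 0)).1 x * (grad (m 0) V (η 1)).1 x :=
  Matrix.det_fin_two _

lemma det_jac_hodgeTwo_self (m : Fin 4) (η : Fin 2 → OmM V) (x : V) :
    (jac (hodgeTwo (m, m)) η x).det = 0 := by
  rw [hodgeTwo_self]
  exact (det_jac_two _ η x).trans (sub_self _)

lemma det_jac_hodgeTwo_swap (m n : Fin 4) (η : Fin 2 → OmM V) (x : V) :
    (jac (hodgeTwo (m, n)) η x).det = -(jac (hodgeTwo (n, m)) η x).det := by
  have h : hodgeTwo (n, m) = hodgeTwo (m, n) ∘ Equiv.swap 0 1 := by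
    ext b : 1
    fin_cases b
    · exact (hodgeTwo_swap m n).1
    · exact (hodgeTwo_swap m n).2
  rw [h]
  refine (neg_eq_iff_eq_neg.1 ?_).trans rfl
  exact ((Matrix.det_permute' (Equiv.swap 0 1) (jac (hodgeTwo (m, n)) η x)).trans
    (by rw [Equiv.Perm.sign_swap (by decide)]; simp)).symm

lemma holdsForForms_kosTwo : HoldsForForms (p := 2) hodgeTwo (kosTwoSub E) := by
  intro V z η f
  refine ⟨fun m => ?_, fun m n => ?_, fun l m n => ?_⟩
  · refine (coefV_ftm_wd _ z η f).trans ?_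
    refine (congrArg (fun s => act _ s z) (tw_ext fun x => ?_)).trans (act_zero (add_zero (-1)) z)
    refine (minorTwist_apply _ _ _ x).trans ?_
    exact (congrArg (· * f.1 x) (det_jac_hodgeTwo_self m η x)).trans (zero_mul _)
  · refine (coefV_ftm_wd _ z η f).trans ?_
    refine Eq.trans ?_ (congrArg (- ·) (coefV_ftm_wd (hodgeTwo (n, m)) z η f).symm)
    refine Eq.trans ?_ (act_neg _ _ z)
    refine congrArg (fun s => act _ s z) (tw_ext fun x => ?_)
    refine (minorTwist_apply _ _ _ x).trans ?_
    refine (congrArg (· * f.1 x) (det_jac_hodgeTwo_swap m n η x)).trans ?_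
    exact (neg_mul _ _).trans (congrArg (- ·) (minorTwist_apply _ _ _ x).symm)
  · simp only [act_zs_coefV]
    rw [← act_add, ← act_add]
    refine (congrArg (fun s => act _ s z) (tw_ext fun x => ?_)).trans
      (act_zero (by rfl : (-1 : ℤ) + 1 = 0) z)
    have h (k : Fin 4) (q : Fin 4 × Fin 4) := (minorCoord_apply k (hodgeTwo q) η f x).trans
      (congrArg (al (𝒜 := grading 4) x.1 (X k) * · * f.1 x) (det_jac_two (hodgeTwo q) η x))
    refine (congrArg₂ (· + ·) (congrArg₂ (· + ·) (h _ _) (h _ _)) (h _ _)).trans ?_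
    refine (congrArg (· + _) (add_mul _ _ _)).symm.trans ((add_mul _ _ _).symm.trans ?_)
    have := hodgeTwo_relation (v := fun k => (grad k V (η 0)).1 x) (u := fun k => (grad k V (η 1)).1 x)
      (sum_coord_mul_grad (η 0) x) (sum_coord_mul_grad (η 1) x) l m n
    exact (congrArg (· * f.1 x) this).trans (zero_mul _)

lemma holdsForForms_kosThree : HoldsForForms (p := 3) hodgeThree (kosThreeSub E) := by
  intro V z η f m n
  rw [act_zs_coefV, act_zs_coefV]
  refine congrArg (fun s => act _ s z) (tw_ext fun x => ?_)
  refine (minorCoord_apply _ _ _ _ x).trans (Eq.trans ?_ (minorCoord_apply _ _ _ _ x).symm)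
  have := hodgeThree_relation (v := fun k => (grad k V (η 0)).1 x)
    (u := fun k => (grad k V (η 1)).1 x) (w := fun k => (grad k V (η 2)).1 x)
    (sum_coord_mul_grad (η 0) x) (sum_coord_mul_grad (η 1) x) (sum_coord_mul_grad (η 2) x) m n
  have h1 (k : Fin 4) : jac (hodgeThree k) η x = Matrix.of fun a b =>
      ![fun k => (grad k V (η 0)).1 x, fun k => (grad k V (η 1)).1 x,
        fun k => (grad k V (η 2)).1 x] a (hodgeThree k b) := by
    ext a b
    fin_cases a <;> rfl
  rw [h1, h1]
  exact congrArg (· * f.1 x) this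

/-- The chosen indices are those different from i. If the entries there vanish, the relation leaves
z_i g_i = 0, and z_i is invertible. -/
lemma hasDualBases_kosOne : HasDualBases (p := 1) (fun k _ => k) (kosOneSub E) := by
  intro V hVB
  obtain ⟨f, m, hf, hm, hVf, i, hV⟩ := id hVB
  refine ⟨i, hV, 3, i.succAbove, _, isDualBasis_wdx hV (u := fun t _ => t) (fun _ _ => rfl)
    (fun t => Function.injective_of_subsingleton _) (fun t t' h => ⟨0, fun _ => h.symm⟩)
    (fun v _ => ⟨v 0, fun a => ⟨0, congrArg v (Subsingleton.elim _ _)⟩⟩), fun g hg h => ?_⟩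
  have hg' : ∑ k, act (by rfl : (-1 : ℤ) + 1 = 0) (zs k V) (g k) = 0 := hg
  rw [Fin.sum_univ_succAbove _ i, Finset.sum_eq_zero fun t _ => by rw [h t, map_zero], add_zero] at hg'
  have h1 : g i = 0 := act_zs_injective _ hV (hg'.trans (map_zero _).symm)
  funext k
  exact (Fin.eq_self_or_eq_succAbove i k).elim (fun hk => hk ▸ h1) fun ⟨t, ht⟩ => ht ▸ h t

/-- The chosen entries are w_ik with k ≠ i, whose complementary pairs avoid i and so index products
of the coordinate differentials. If row i vanishes, the Koszul relation gives z_i w_mn = 0 for all m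
and n. -/
lemma hasDualBases_kosTwo : HasDualBases (p := 2) hodgeTwo (kosTwoSub E) := by
  intro V hVB
  obtain ⟨f, m, hf, hm, hVf, i, hV⟩ := id hVB
  refine ⟨i, hV, 3, fun t => (i, i.succAbove t), _,
    isDualBasis_wdx hV (u := fun t b => unskip i (hodgeTwo (i, i.succAbove t) b)) (hodgeTwo_eq i)
    (injective_unskip_hodgeTwo i) (exists_unskip_hodgeTwo_ne i) (exists_unskip_hodgeTwo_eq i),
    fun w hw h => ?_⟩
  obtain ⟨h₁, h₂, h₃⟩ := hw
  have h4 (k : Fin 4) : w (i, k) = 0 :=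
    (Fin.eq_self_or_eq_succAbove i k).elim (fun hk => hk ▸ h₁ i) fun ⟨t, ht⟩ => ht ▸ h t
  funext ⟨m, n⟩
  have h5 := h₃ i m n
  rw [h₂ n i, h4, h4, neg_zero, map_zero, map_zero, add_zero, add_zero] at h5
  exact act_zs_injective _ hV (h5.trans (map_zero _).symm)

/-- The single entry c_i belongs to the triple avoiding i, and z_i c_n = z_n c_i determines the
others. -/
lemma hasDualBases_kosThree : HasDualBases (p := 3) hodgeThree (kosThreeSub E) := by
  intro V hVB
  obtain ⟨f, m, hf, hm, hVf, i, hV⟩ := id hVB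
  refine ⟨i, hV, 1, fun _ => i, _,
    isDualBasis_wdx hV (u := fun _ b => unskip i (hodgeThree i b)) (fun _ => hodgeThree_eq i)
    (fun _ => (bijective_unskip_hodgeThree i).1) (fun t t' h => (h (Subsingleton.elim _ _)).elim)
    (fun v _ => ⟨0, fun a => (bijective_unskip_hodgeThree i).2 (v a)⟩), fun c hc h => ?_⟩
  funext n
  refine act_zs_injective (by rfl : (-1 : ℤ) + 1 = 0) hV ?_
  refine (hc i n).trans ?_
  rw [h 0]
  exact (map_zero _).trans (map_zero _).symm

variable (E) in
/-- No equations at all. -/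
def allSub (V : (PSpace 3).Opens) : AddSubgroup (Unit → (EE E (-1)).obj (op V)) := ⊤

lemma allSub_rs (U V : (PSpace 3).Opens) (i : V ≤ U) :
    ∀ g ∈ allSub E U, (fun k => rs i (g k)) ∈ allSub E V := fun _ _ => AddSubgroup.mem_top _

lemma holdsForForms_allSub : HoldsForForms (p := 0) (fun _ => Fin.elim0) (allSub E) :=
  fun _ _ _ _ => AddSubgroup.mem_top _

lemma hasDualBases_allSub : HasDualBases (p := 0) (fun _ => Fin.elim0) (allSub E) := by
  intro V hVB
  obtain ⟨f, m, hf, hm, hVf, i, hV⟩ := id hVB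
  exact ⟨i, hV, 1, fun _ => (), _, isDualBasis_wdx hV (u := fun _ => Fin.elim0) (fun _ b => b.elim0)
    (fun _ a => a.elim0) (fun t t' h => (h (Subsingleton.elim _ _)).elim)
    (fun v _ => ⟨0, fun a => a.elim0⟩), fun g _ h => funext fun _ => h 0⟩

lemma subsingleton_H_two_allSub (h : Subsingleton ((aSh (EE E (-1))).H 2)) :
    Subsingleton ((aSh (subP (pw Unit (EE E (-1))) (allSub E) allSub_rs)).H 2) := by
  have h1 : BijOn Set.univ (subPι (pw Unit (EE E (-1))) (allSub E) allSub_rs ≫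
      pwProj (EE E (-1)) ()) := fun V _ =>
    ⟨fun s t hst => Subtype.ext (funext fun _ => hst), fun s => ⟨⟨fun _ => s, trivial⟩, rfl⟩⟩
  have := h1.isIso (Opens.isBasis_iff_nbhd.2 fun {U x} hx => ⟨U, trivial, hx, le_rfl⟩)
  exact subsingleton_H_of_isIso' (aShMap (subPι (pw Unit (EE E (-1))) (allSub E) allSub_rs ≫
    pwProj (EE E (-1)) ())) 2 h

end Instances

/-! ### The vanishing of the row q = 2. -/

section Beilinson

variable {N : ℕ} {k : ℤ} {E : (PSpace 3).Modules} (hE : IsInModuli N k E)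
  (h : Subsingleton (H 2 (twistBy E (-2))))
include hE h

lemma subsingleton_H_two_twist_neg_one : Subsingleton (H 2 (twistBy E (-1))) :=
  subsingleton_H_two_neg_one (exists_locallyExact_zop hE) h

/-- The row `q = 2` of the Beilinson spectral sequence vanishes. -/
theorem subsingleton_H_two_tensor_omega (p : ℕ) (hp : p ≤ 3) :
    Subsingleton (H 2 (tensor (twistBy E (-1)) (twistBy (OmegaP 3 p) p))) := by
  have hE' := exists_locallyExact_zop hE
  interval_cases p
  · exact subsingleton_H_two_tensor_forms allSub_rs holdsForForms_allSub hasDualBases_allSub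
      (subsingleton_H_two_allSub (subsingleton_H_two_neg_one hE' h))
  · exact subsingleton_H_two_tensor_forms kosOneSub_rs holdsForForms_kosOne hasDualBases_kosOne
      (subsingleton_H_two_kosOne hE' h)
  · exact subsingleton_H_two_tensor_forms kosTwoSub_rs holdsForForms_kosTwo hasDualBases_kosTwo
      (subsingleton_H_two_kosTwo hE' h)
  · exact subsingleton_H_two_tensor_forms kosThreeSub_rs holdsForForms_kosThree
      hasDualBases_kosThree (subsingleton_H_two_kosThree h)

end Beilinson

end ProjSheaf

end

theorem mainTheorem2 (N : ℕ) (k : ℤ) (E : (ProjSheaf.PSpace 3).Modules)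
    (hE : ProjSheaf.IsInModuli N k E)
    (hE2 : Subsingleton (ProjSheaf.H 2 (ProjSheaf.twistBy E (-2)))) :
    Subsingleton (ProjSheaf.H 2 (ProjSheaf.twistBy E (-1))) ∧
    Subsingleton (ProjSheaf.H 2 (ProjSheaf.tensor (ProjSheaf.twistBy E (-1))
      (ProjSheaf.twistBy (ProjSheaf.OmegaP 3 1) 1))) ∧
    Subsingleton (ProjSheaf.H 2 (ProjSheaf.tensor (ProjSheaf.twistBy E (-1))
      (ProjSheaf.twistBy (ProjSheaf.OmegaP 3 2) 2))) ∧
    ∀ p : ℕ, p ≤ 3 → Subsingleton (ProjSheaf.H 2 (ProjSheaf.tensor (ProjSheaf.twistBy E (-1))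
      (ProjSheaf.twistBy (ProjSheaf.OmegaP 3 p) (p : ℤ)))) :=
  have key := ProjSheaf.subsingleton_H_two_tensor_omega hE hE2
  ⟨ProjSheaf.subsingleton_H_two_twist_neg_one hE hE2, key 1 (by norm_num), key 2 (by norm_num), key⟩
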